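/- **Theorem.** Let $T$ be a tree on the vertex set $V=\{0,\dots,n-1\}$, $n\ge 2$, with a weight $\delta(e)>0$ for every edge $e$, and let $c:V^2\to\mathbb R_{\ge 0}$ be an arbitrary function. For distinct $u,v\in V$ (the shortcut $(u,v)$), let $T+(u,v)$ be the undirected multigraph obtained from $T$ by adding one edge of weight $c(u,v)$ between $u$ and $v$ (possibly parallel to an edge of $T$). The distance of two vertices of an edge-weighted multigraph is the length of a shortest path between them, and its diameter is the maximum distance of two vertices. The Diameter-Optimal Augmentation Problem asks for a shortcut $(u,v)$, $u\neq v$, such that $$\operatorname{diam}\big(T+(u,v)\big)\le \operatorname{diam}\big(T+(u',v')\big)\quad\text{for all } u'\ne v' \text{ in } V .$$ The Diameter-Optimal Augmentation Problem can be solved in $O(n^2)$ time and space: there are one program for a real random access machine and a constant $K$ such that, for every $n\ge 2$ and every such $T$, $\delta$ and $c$, the program, given $n$, a list of the $n-1$ edges of $T$ with their end vertices and weights (in any order), and an oracle that reports $c(u,v)$ for queried vertices $u,v$ in one unit of time, halts after at most $Kn^2$ units of time, uses at most $Kn^2$ memory cells, and outputs an optimal shortcut. Here the machine has a working memory of integer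 and real cells, initially $0$; its integers are words of $O(\log n)$ bits with the operations $+,-,\cdot$, integer division, comparison and indirect addressing, its real numbers are exact and are only added, subtracted, compared and copied, and every operation takes one unit of time. -/

import Mathlib

open scoped NNReal ENNReal

namespace Doap

/-! ### Edge-weighted multigraphs, distance and diameter -/

/-- An undirected multigraph with vertex set `V`, edge set `E` (parallel edges and loops are
allowed) and nonnegative edge weights. -/
structure WeightedMultigraph (V E : Type*) where
  /-- the unordered pair of end vertices of an edge -/
  ends : E → Sym2 V
  /-- the weight of an edge -/
  weight : E → ℝ≥0

namespace WeightedMultigraph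

variable {V E : Type*} (G : WeightedMultigraph V E)

/-- `G.IsWalk u es v`: the edges of the list `es`, traversed in this order, lead from `u` to `v`. -/
inductive IsWalk : V → List E → V → Prop
  | nil (u : V) : IsWalk u [] u
  | cons {u w v : V} {e : E} {es : List E} :
      G.ends e = s(u, w) → IsWalk w es v → IsWalk u (e :: es) v

/-- The length of a list of edges: the sum of their weights. -/
def length (es : List E) : ℝ≥0 := (es.map G.weight).sum

/-- The distance of `u` and `v`: the least length of a walk from `u` to `v` (as weights are
nonnegative, this is the length of a shortest path), and `∞` if there is none. -/
noncomputable def dist (u v : V) : ℝ≥0∞ :=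
  ⨅ (es : List E) (_ : G.IsWalk u es v), (G.length es : ℝ≥0∞)

/-- The diameter: the maximum distance of two vertices. -/
noncomputable def diam : ℝ≥0∞ := ⨆ (u : V) (v : V), G.dist u v

end WeightedMultigraph

/-! ### The diameter-optimal augmentation problem -/

/-- An instance with `n` vertices: a tree on the vertices `0, …, n - 1` with positive edge weights,
and a nonnegative weight `c u v` for every possible shortcut `(u, v)`, subject to no further
condition. -/
structure Instance (n : ℕ) where
  tree : SimpleGraph (Fin n)
  isTree : tree.IsTree
  δ : tree.edgeSet → ℝ≥0
  δ_pos : ∀ e, 0 < δ e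
  c : Fin n → Fin n → ℝ≥0

namespace Instance

variable {n : ℕ} (I : Instance n)

/-- The multigraph `T + (u, v)`: the edges of the tree (`some e`) and one additional edge (`none`)
of weight `c u v` between `u` and `v`. It may be parallel to an edge of the tree. -/
def augment (u v : Fin n) : WeightedMultigraph (Fin n) (Option I.tree.edgeSet) where
  ends
    | none => s(u, v)
    | some e => e.1
  weight
    | none => I.c u v
    | some e => I.δ e

/-- `(u, v)` is a shortcut whose addition to the tree gives the least possible diameter. -/
def IsOptimalShortcut (u v : Fin n) : Prop :=
  u ≠ v ∧ ∀ u' v' : Fin n, u' ≠ v' → (I.augment u v).diam ≤ (I.augment u' v').diam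

/-- A representation of the tree as a list of its `n - 1` edges, in any order, each of them with its
two end vertices in any order. -/
structure EdgeList where
  ends : Fin (n - 1) → Fin n × Fin n
  bijOn : Set.BijOn (fun k => s((ends k).1, (ends k).2)) Set.univ I.tree.edgeSet

end Instance

/-! ### The machine model

A real random access machine with an oracle, programmed in a structured language. The machine has
`k` integer arrays and `k` real arrays as its working memory, for a number `k` fixed by the program.
For a capacity `W`, every array has the `W` cells `0, …, W - 1`, and every integer that occurs in a
computation is a machine word with a value in `{0, …, W - 1}` (so a word has `⌈log₂ W⌉` bits).
Real numbers are only added, subtracted, compared, and copied; no operation leads from real numbers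
to integers but comparison. Every operation takes one unit of time. An access out of range or an
integer overflow has no continuation. -/

/-- What a machine has read-only access to: the number `n` of vertices, the end vertices and the
weight of the `i`-th edge of the tree, for `i < n - 1`, and the oracle for the weight of a
shortcut. -/
structure Input where
  n : ℕ
  fst : ℕ → ℕ
  snd : ℕ → ℕ
  weight : ℕ → ℝ
  query : ℕ → ℕ → ℝ

/-- The input given by an instance and an edge list of its tree. The values for indices out of range
are irrelevant, as a machine cannot access them. -/
noncomputable def Instance.input {n : ℕ} (I : Instance n) (L : I.EdgeList) : Input where
  n := n
  fst i := if h : i < n - 1 then ((L.ends ⟨i, h⟩).1 : ℕ) else 0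
  snd i := if h : i < n - 1 then ((L.ends ⟨i, h⟩).2 : ℕ) else 0
  weight i := if h : i < n - 1 then
    (I.δ ⟨s((L.ends ⟨i, h⟩).1, (L.ends ⟨i, h⟩).2), L.bijOn.mapsTo (Set.mem_univ _)⟩ : ℝ) else 0
  query u v := if h : u < n ∧ v < n then (I.c ⟨u, h.1⟩ ⟨v, h.2⟩ : ℝ) else 0

/-- The contents of the working memory: `k` integer arrays and `k` real arrays. -/
@[ext]
structure Mem (k : ℕ) where
  int : Fin k → ℕ → ℕ
  real : Fin k → ℕ → ℝ

namespace Mem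

variable {k : ℕ}

/-- The initial memory: all cells hold `0`. -/
def zero : Mem k := ⟨fun _ _ => 0, fun _ _ => 0⟩

/-- Store the integer `x` in cell `i` of the integer array `a`. -/
def setInt (m : Mem k) (a : Fin k) (i x : ℕ) : Mem k :=
  { m with int := Function.update m.int a (Function.update (m.int a) i x) }

/-- Store the real number `x` in cell `i` of the real array `a`. -/
noncomputable def setReal (m : Mem k) (a : Fin k) (i : ℕ) (x : ℝ) : Mem k :=
  { m with real := Function.update m.real a (Function.update (m.real a) i x) }

end Mem

/-- Integer expressions: constants, the number of vertices, the end vertices of an edge of the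
tree, the cell of an integer array, and word arithmetic. -/
inductive IExp (k : ℕ) : Type
  | lit (x : ℕ)
  | numVertices
  | fst (i : IExp k)
  | snd (i : IExp k)
  | read (a : Fin k) (i : IExp k)
  | add (x y : IExp k)
  | sub (x y : IExp k)
  | mul (x y : IExp k)
  | div (x y : IExp k)

namespace IExp

variable {k : ℕ}

/-- The value of an integer expression. -/
def eval (X : Input) (m : Mem k) : IExp k → ℕ
  | lit x => x
  | numVertices => X.n
  | fst i => X.fst (i.eval X m)
  | snd i => X.snd (i.eval X m)
  | read a i => m.int a (i.eval X m)
  | add x y => x.eval X m + y.eval X m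
  | sub x y => x.eval X m - y.eval X m
  | mul x y => x.eval X m * y.eval X m
  | div x y => x.eval X m / y.eval X m

/-- The expression can be evaluated on a machine of capacity `W`: all accesses are in range and all
values, also those of the subexpressions, are less than `W`. -/
def Fits (X : Input) (W : ℕ) (m : Mem k) : IExp k → Prop
  | lit x => x < W
  | numVertices => X.n < W
  | fst i => i.Fits X W m ∧ i.eval X m < X.n - 1 ∧ X.fst (i.eval X m) < W
  | snd i => i.Fits X W m ∧ i.eval X m < X.n - 1 ∧ X.snd (i.eval X m) < W
  | read a i => i.Fits X W m ∧ m.int a (i.eval X m) < W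
  | add x y => x.Fits X W m ∧ y.Fits X W m ∧ x.eval X m + y.eval X m < W
  | sub x y => x.Fits X W m ∧ y.Fits X W m
  | mul x y => x.Fits X W m ∧ y.Fits X W m ∧ x.eval X m * y.eval X m < W
  | div x y => x.Fits X W m ∧ y.Fits X W m

/-- The time that the evaluation takes: one unit for every operation. -/
def cost : IExp k → ℕ
  | lit _ => 1
  | numVertices => 1
  | fst i => i.cost + 1
  | snd i => i.cost + 1
  | read _ i => i.cost + 1
  | add x y => x.cost + y.cost + 1
  | sub x y => x.cost + y.cost + 1
  | mul x y => x.cost + y.cost + 1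
  | div x y => x.cost + y.cost + 1

end IExp

/-- Real expressions: the constant `0`, the weight of an edge of the tree, a query to the oracle,
the cell of a real array, sums and differences. -/
inductive RExp (k : ℕ) : Type
  | zero
  | weight (i : IExp k)
  | query (u v : IExp k)
  | read (a : Fin k) (i : IExp k)
  | add (x y : RExp k)
  | sub (x y : RExp k)

namespace RExp

variable {k : ℕ}

/-- The value of a real expression. -/
noncomputable def eval (X : Input) (m : Mem k) : RExp k → ℝ
  | zero => 0
  | weight i => X.weight (i.eval X m)
  | query u v => X.query (u.eval X m) (v.eval X m)
  | read a i => m.real a (i.eval X m)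
  | add x y => x.eval X m + y.eval X m
  | sub x y => x.eval X m - y.eval X m

/-- The expression can be evaluated on a machine of capacity `W`. -/
def Fits (X : Input) (W : ℕ) (m : Mem k) : RExp k → Prop
  | zero => True
  | weight i => i.Fits X W m ∧ i.eval X m < X.n - 1
  | query u v => u.Fits X W m ∧ v.Fits X W m ∧ u.eval X m < X.n ∧ v.eval X m < X.n
  | read _ i => i.Fits X W m
  | add x y => x.Fits X W m ∧ y.Fits X W m
  | sub x y => x.Fits X W m ∧ y.Fits X W m

/-- The time that the evaluation takes; a query to the oracle takes one unit. -/
def cost : RExp k → ℕ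
  | zero => 1
  | weight i => i.cost + 1
  | query u v => u.cost + v.cost + 1
  | read _ i => i.cost + 1
  | add x y => x.cost + y.cost + 1
  | sub x y => x.cost + y.cost + 1

end RExp

/-- Tests: comparisons of integers and of real numbers, negation, and conjunction, whose second part
is only evaluated if the first part holds. -/
inductive Test (k : ℕ) : Type
  | ilt (x y : IExp k)
  | ieq (x y : IExp k)
  | rle (x y : RExp k)
  | not (b : Test k)
  | and (b b' : Test k)

namespace Test

variable {k : ℕ}

/-- The test holds. -/
def Holds (X : Input) (m : Mem k) : Test k → Prop
  | ilt x y => x.eval X m < y.eval X m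
  | ieq x y => x.eval X m = y.eval X m
  | rle x y => x.eval X m ≤ y.eval X m
  | not b => ¬ b.Holds X m
  | and b b' => b.Holds X m ∧ b'.Holds X m

/-- The test can be evaluated on a machine of capacity `W`. -/
def Fits (X : Input) (W : ℕ) (m : Mem k) : Test k → Prop
  | ilt x y => x.Fits X W m ∧ y.Fits X W m
  | ieq x y => x.Fits X W m ∧ y.Fits X W m
  | rle x y => x.Fits X W m ∧ y.Fits X W m
  | not b => b.Fits X W m
  | and b b' => b.Fits X W m ∧ (b.Holds X m → b'.Fits X W m)

/-- The time charged for the evaluation. -/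
def cost : Test k → ℕ
  | ilt x y => x.cost + y.cost + 1
  | ieq x y => x.cost + y.cost + 1
  | rle x y => x.cost + y.cost + 1
  | not b => b.cost + 1
  | and b b' => b.cost + b'.cost + 1

end Test

/-- Programs. -/
inductive Program (k : ℕ) : Type
  | skip
  | setInt (a : Fin k) (i x : IExp k)
  | setReal (a : Fin k) (i : IExp k) (x : RExp k)
  | seq (p q : Program k)
  | ite (b : Test k) (p q : Program k)
  | loop (b : Test k) (p : Program k)

/-- `Exec X W p m t m'`: on the input `X`, on a machine of capacity `W`, the program `p`, started
with the memory `m`, halts after `t` units of time with the memory `m'`. Here `setInt a i x` and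
`setReal a i x` store the value of `x` in cell `i` of array `a`, and `loop b p` repeats `p` as long
as `b` holds. -/
inductive Exec {k : ℕ} (X : Input) (W : ℕ) : Program k → Mem k → ℕ → Mem k → Prop
  | skip (m : Mem k) : Exec X W .skip m 1 m
  | setInt (m : Mem k) (a : Fin k) (i x : IExp k) :
      i.Fits X W m → x.Fits X W m →
      Exec X W (.setInt a i x) m (i.cost + x.cost + 1) (m.setInt a (i.eval X m) (x.eval X m))
  | setReal (m : Mem k) (a : Fin k) (i : IExp k) (x : RExp k) :
      i.Fits X W m → x.Fits X W m →
      Exec X W (.setReal a i x) m (i.cost + x.cost + 1) (m.setReal a (i.eval X m) (x.eval X m))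
  | seq {p q : Program k} {m m' m'' : Mem k} {t t' : ℕ} :
      Exec X W p m t m' → Exec X W q m' t' m'' → Exec X W (.seq p q) m (t + t') m''
  | ite_true {b : Test k} {p q : Program k} {m m' : Mem k} {t : ℕ} :
      b.Fits X W m → b.Holds X m → Exec X W p m t m' →
      Exec X W (.ite b p q) m (b.cost + t) m'
  | ite_false {b : Test k} {p q : Program k} {m m' : Mem k} {t : ℕ} :
      b.Fits X W m → ¬ b.Holds X m → Exec X W q m t m' →
      Exec X W (.ite b p q) m (b.cost + t) m'
  | loop_true {b : Test k} {p : Program k} {m m' m'' : Mem k} {t t' : ℕ} :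
      b.Fits X W m → b.Holds X m → Exec X W p m t m' → Exec X W (.loop b p) m' t' m'' →
      Exec X W (.loop b p) m (b.cost + t + t') m''
  | loop_false {b : Test k} {p : Program k} {m : Mem k} :
      b.Fits X W m → ¬ b.Holds X m → Exec X W (.loop b p) m b.cost m

/-- The number of memory cells of a machine of capacity `W` with `k` integer arrays and `k` real
arrays. -/
def space (k W : ℕ) : ℕ := 2 * (k * W)

/-- On the instance `I`, with its tree given by the edge list `L`, the program `p` finds an optimal
shortcut in time at most `time` and in a memory of at most `cells` cells: it halts with the end
vertices of the shortcut in the cells `0` and `1` of the integer array `0`. -/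
def Solves {k : ℕ} (p : Program (k + 1)) {n : ℕ} (I : Instance n) (L : I.EdgeList)
    (time cells : ℕ) : Prop :=
  ∃ (W t : ℕ) (m : Mem (k + 1)) (u v : Fin n),
    space (k + 1) W ≤ cells ∧ t ≤ time ∧ Exec (I.input L) W p Mem.zero t m ∧
      m.int 0 0 = u ∧ m.int 0 1 = v ∧ I.IsOptimalShortcut u v

end Doap

/-! Fix a diametral pair `(a, b)` of the tree. Every vertex gets a position on the path from `a` to
`b` and a height over this path, both doubled so that sums and differences of distances suffice and
nothing has to be halved. As the pair is diametral, a height never exceeds the distance of the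
position from either end. A shortcut `(u, v)` of weight `c` then acts like a connection of weight `h
u + 2 * c + h v` between two positions on a line.

Sort the vertices by position and consider the grid of index pairs `(i, j)`. The number `E i j` is
the cheapest way to connect the two positions when walking along the line before and after a
shortcut is allowed; hence it is 1-Lipschitz in either coordinate. The value of a cell is the
maximum of four quantities: `U` (end to end), `L` and `R` (from the left and the right end), and `C`
(around the cycle closed by the connection). Two inequalities tie values to diameters. Every
shortcut has a cell whose value is at most twice its diameter (`Represents.exists_val_le`, resting
on the four-point estimates `FourPoint.aug_left`, `FourPoint.aug_right`, `FourPoint.aug_cycle`).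
Conversely, the shortcut that serves a cell most cheaply has twice its diameter at most the value of
the cell (`Represents.augDist_le`). So it suffices to minimize the value over the grid and to pick
the shortcut afterwards.

Evaluating all cells would be cubic. But the Lipschitz property makes `U` grow with `i` and fall
with `j`, makes `C` do the opposite, and makes `R` fall and `L` grow in both coordinates. Therefore
the conditions `C < U` and `R < L` have staircase boundaries, and off these boundaries one can
always move in one direction without increasing the value. The minimum is thus attained on the
border or next to a staircase (`Grid.Valid.le_val`). These are `O(n)` cells, traced by `walk_spec`.
Each of them is evaluated in linear time, the cycle part with two pointers and precomputed prefix
and suffix maxima (`evalCycle_spec`).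

The tree distances (the tree is grown by one leaf at a time, `distances_spec`), the sorting, the
table of weights and the final choice are quadratic in a direct way. The program is verified in a
calculus of total correctness, `Ex`, in which time bounds are computed from loop bounds and
unassigned arrays are known to be unchanged. -/

namespace Doap

/-! ### Programs with loop bounds -/

/-- Programs in which every loop carries a bound, depending on the number of vertices, for the
number of its iterations. -/
inductive BProgram (k : ℕ) : Type
  | skip
  | setInt (a : Fin k) (i x : IExp k)
  | setReal (a : Fin k) (i : IExp k) (x : RExp k)
  | seq (p q : BProgram k)
  | ite (b : Test k) (p q : BProgram k)
  | loop (β : ℕ → ℕ) (b : Test k) (p : BProgram k)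

namespace BProgram

variable {k : ℕ}

/-- Forget the loop bounds. -/
def erase : BProgram k → Program k
  | skip => .skip
  | setInt a i x => .setInt a i x
  | setReal a i x => .setReal a i x
  | seq p q => .seq p.erase q.erase
  | ite b p q => .ite b p.erase q.erase
  | loop _ b p => .loop b p.erase

/-- The time bound that results from the loop bounds. -/
def time (n : ℕ) : BProgram k → ℕ
  | skip => 1
  | setInt _ i x => i.cost + x.cost + 1
  | setReal _ i x => i.cost + x.cost + 1
  | seq p q => p.time n + q.time n
  | ite b p q => b.cost + (p.time n + q.time n)
  | loop β b p => β n * (b.cost + p.time n) + b.cost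

/-- The program contains an assignment to the integer array `c`. -/
def wi (c : Fin k) : BProgram k → Bool
  | skip => false
  | setInt a _ _ => decide (c = a)
  | setReal _ _ _ => false
  | seq p q => p.wi c || q.wi c
  | ite _ p q => p.wi c || q.wi c
  | loop _ _ p => p.wi c

/-- The program contains an assignment to the real array `c`. -/
def wr (c : Fin k) : BProgram k → Bool
  | skip => false
  | setInt _ _ _ => false
  | setReal a _ _ => decide (c = a)
  | seq p q => p.wr c || q.wr c
  | ite _ p q => p.wr c || q.wr c
  | loop _ _ p => p.wr c

/-- `m` and `m'` agree on all arrays to which `p` does not assign. -/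
def Frame (p : BProgram k) (m m' : Mem k) : Prop :=
  (∀ a, p.wi a = false → m'.int a = m.int a) ∧ (∀ a, p.wr a = false → m'.real a = m.real a)

theorem Frame.refl (p : BProgram k) (m : Mem k) : p.Frame m m :=
  ⟨fun _ _ => rfl, fun _ _ => rfl⟩

theorem Frame.trans {p : BProgram k} {m m' m'' : Mem k} (h : p.Frame m m') (h' : p.Frame m' m'') :
    p.Frame m m'' :=
  ⟨fun a ha => (h'.1 a ha).trans (h.1 a ha), fun a ha => (h'.2 a ha).trans (h.2 a ha)⟩

end BProgram

namespace Mem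

variable {k : ℕ}

@[simp] theorem setInt_real (m : Mem k) (a : Fin k) (i x : ℕ) : (m.setInt a i x).real = m.real :=
  rfl

@[simp] theorem setReal_int (m : Mem k) (a : Fin k) (i : ℕ) (x : ℝ) :
    (m.setReal a i x).int = m.int := rfl

@[simp] theorem setInt_int (m : Mem k) (a : Fin k) (i x : ℕ) :
    (m.setInt a i x).int a = Function.update (m.int a) i x := by simp [setInt]

@[simp] theorem setInt_int_ne (m : Mem k) {a b : Fin k} (i x : ℕ) (h : b ≠ a) :
    (m.setInt a i x).int b = m.int b := by simp [setInt, Function.update_of_ne h]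

@[simp] theorem setReal_real (m : Mem k) (a : Fin k) (i : ℕ) (x : ℝ) :
    (m.setReal a i x).real a = Function.update (m.real a) i x := by simp [setReal]

@[simp] theorem setReal_real_ne (m : Mem k) {a b : Fin k} (i : ℕ) (x : ℝ) (h : b ≠ a) :
    (m.setReal a i x).real b = m.real b := by simp [setReal, Function.update_of_ne h]

theorem setReal_self (m : Mem k) (a : Fin k) (i : ℕ) : m.setReal a i (m.real a i) = m := by
  simp [setReal]

end Mem

/-! ### Total correctness -/

variable {k : ℕ} {X : Input} {W : ℕ}

/-- `p`, started with `m`, halts within its time bound, with a memory that satisfies `Q`. -/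
def Ex (X : Input) (W : ℕ) (p : BProgram k) (m : Mem k) (Q : Mem k → Prop) : Prop :=
  ∃ t m', t ≤ p.time X.n ∧ Exec X W p.erase m t m' ∧ p.Frame m m' ∧ Q m'

namespace Ex

theorem mono {p : BProgram k} {m : Mem k} {Q Q' : Mem k → Prop} (h : Ex X W p m Q)
    (hQ : ∀ m', p.Frame m m' → Q m' → Q' m') : Ex X W p m Q' := by
  obtain ⟨t, m', ht, he, hf, hq⟩ := h
  exact ⟨t, m', ht, he, hf, hQ m' hf hq⟩

theorem skip {m : Mem k} {Q : Mem k → Prop} (h : Q m) : Ex X W .skip m Q :=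
  ⟨1, m, le_rfl, .skip m, .refl _ _, h⟩

theorem setInt {m : Mem k} {Q : Mem k → Prop} {a : Fin k} {i x : IExp k} (hi : i.Fits X W m)
    (hx : x.Fits X W m) (h : Q (m.setInt a (i.eval X m) (x.eval X m))) :
    Ex X W (.setInt a i x) m Q := by
  refine ⟨_, _, le_rfl, .setInt m a i x hi hx, ⟨fun b hb => ?_, fun b _ => rfl⟩, h⟩
  have : b ≠ a := by simpa [BProgram.wi] using hb
  simp [this]

theorem setReal {m : Mem k} {Q : Mem k → Prop} {a : Fin k} {i : IExp k} {x : RExp k}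
    (hi : i.Fits X W m) (hx : x.Fits X W m) (h : Q (m.setReal a (i.eval X m) (x.eval X m))) :
    Ex X W (.setReal a i x) m Q := by
  refine ⟨_, _, le_rfl, .setReal m a i x hi hx, ⟨fun b _ => rfl, fun b hb => ?_⟩, h⟩
  have : b ≠ a := by simpa [BProgram.wr] using hb
  simp [this]

theorem seq {p q : BProgram k} {m : Mem k} {Q : Mem k → Prop}
    (h : Ex X W p m (fun m' => Ex X W q m' Q)) : Ex X W (.seq p q) m Q := by
  obtain ⟨t, m', ht, he, hf, t', m'', ht', he', hf', hq⟩ := h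
  refine ⟨t + t', m'', Nat.add_le_add ht ht', .seq he he', ⟨fun a ha => ?_, fun a ha => ?_⟩, hq⟩
  · simp only [BProgram.wi, Bool.or_eq_false_iff] at ha
    rw [hf'.1 a ha.2, hf.1 a ha.1]
  · simp only [BProgram.wr, Bool.or_eq_false_iff] at ha
    rw [hf'.2 a ha.2, hf.2 a ha.1]

theorem ite {b : Test k} {p q : BProgram k} {m : Mem k} {Q : Mem k → Prop} (hb : b.Fits X W m)
    (hp : b.Holds X m → Ex X W p m Q) (hq : ¬ b.Holds X m → Ex X W q m Q) :
    Ex X W (.ite b p q) m Q := by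
  by_cases h : b.Holds X m
  · obtain ⟨t, m', ht, he, hf, hQ⟩ := hp h
    refine ⟨_, m', ?_, .ite_true hb h he, ⟨fun a ha => hf.1 a ?_, fun a ha => hf.2 a ?_⟩, hQ⟩
    · simp only [BProgram.time]; omega
    · simp only [BProgram.wi, Bool.or_eq_false_iff] at ha; exact ha.1
    · simp only [BProgram.wr, Bool.or_eq_false_iff] at ha; exact ha.1
  · obtain ⟨t, m', ht, he, hf, hQ⟩ := hq h
    refine ⟨_, m', ?_, .ite_false hb h he, ⟨fun a ha => hf.1 a ?_, fun a ha => hf.2 a ?_⟩, hQ⟩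
    · simp only [BProgram.time]; omega
    · simp only [BProgram.wi, Bool.or_eq_false_iff] at ha; exact ha.2
    · simp only [BProgram.wr, Bool.or_eq_false_iff] at ha; exact ha.2

/-- Every round strictly lowers the index of the invariant, so each unit of it pays for one test and
one run of the body; the last summand pays for the failing test. The frame relative to the first
memory is carried along so that facts about arrays outside the body need not be part of invariants.
-/
theorem loop_aux {b : Test k} {p : BProgram k} {m₀ : Mem k} (Inv : ℕ → Mem k → Prop)
    (hstep : ∀ f m, Inv f m → p.Frame m₀ m →
      b.Fits X W m ∧ (b.Holds X m → Ex X W p m (fun m' => ∃ f' < f, Inv f' m'))) :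
    ∀ f m, Inv f m → p.Frame m₀ m → ∃ t m', t ≤ f * (b.cost + p.time X.n) + b.cost ∧
      Exec X W (.loop b p.erase) m t m' ∧ p.Frame m₀ m' ∧ (∃ f', Inv f' m') ∧
        ¬ b.Holds X m' := by
  intro f
  induction f using Nat.strong_induction_on with
  | _ f ih =>
    intro m hI hF
    obtain ⟨hfit, hb⟩ := hstep f m hI hF
    by_cases h : b.Holds X m
    · obtain ⟨t, m', ht, he, hf, f', hf', hI'⟩ := hb h
      obtain ⟨t', m'', ht', he', hF', hI'', hn⟩ := ih f' hf' m' hI' (hF.trans hf)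
      refine ⟨_, m'', ?_, .loop_true hfit h he he', hF', hI'', hn⟩
      have : (f' + 1) * (b.cost + p.time X.n) ≤ f * (b.cost + p.time X.n) :=
        Nat.mul_le_mul_right _ hf'
      rw [add_mul] at this
      omega
    · exact ⟨_, m, Nat.le_add_left _ _, .loop_false hfit h, hF, ⟨f, hI⟩, h⟩

/-- The rule for loops: the index of the invariant bounds the number of further iterations. -/
theorem loop {b : Test k} {p : BProgram k} {β : ℕ → ℕ} {m₀ : Mem k} {Q : Mem k → Prop}
    (Inv : ℕ → Mem k → Prop) (f : ℕ) (hβ : f ≤ β X.n) (h₀ : Inv f m₀)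
    (hstep : ∀ f m, Inv f m → p.Frame m₀ m →
      b.Fits X W m ∧ (b.Holds X m → Ex X W p m (fun m' => ∃ f' < f, Inv f' m')))
    (hQ : ∀ f m, Inv f m → ¬ b.Holds X m → p.Frame m₀ m → Q m) :
    Ex X W (.loop β b p) m₀ Q := by
  obtain ⟨t, m', ht, he, hF, ⟨f', hI⟩, hn⟩ :=
    loop_aux Inv hstep f m₀ h₀ (.refl _ _)
  refine ⟨t, m', ht.trans ?_, he, hF, hQ f' m' hI hn hF⟩
  exact Nat.add_le_add_right (Nat.mul_le_mul_right _ hβ) _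

end Ex

/-! ### Derived program constructs -/

/-- The integer variable `a`: cell `0` of the integer array `a`. -/
abbrev iv (a : Fin k) : IExp k := .read a (.lit 0)

/-- The real variable `a`: cell `0` of the real array `a`. -/
abbrev rv (a : Fin k) : RExp k := .read a (.lit 0)

namespace BProgram

/-- For `v = 0, …, N - 1` do `p`. -/
def forTo (v : Fin k) (N : IExp k) (p : BProgram k) : BProgram k :=
  .seq (.setInt v (.lit 0) (.lit 0))
    (.loop id (.ilt (iv v) N) (.seq p (.setInt v (.lit 0) (.add (iv v) (.lit 1)))))

/-- Replace a real cell by its minimum with `e`. -/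
def minInto (a : Fin k) (i : IExp k) (e : RExp k) : BProgram k :=
  .ite (.rle e (.read a i)) (.setReal a i e) .skip

/-- Replace a real cell by its maximum with `e`. -/
def maxInto (a : Fin k) (i : IExp k) (e : RExp k) : BProgram k :=
  .ite (.rle (.read a i) e) (.setReal a i e) .skip

end BProgram

namespace Ex

open BProgram

/-- The bound `N` has to evaluate to `B` in every memory, so the body cannot move it. The invariant
of index `i` always speaks of the memory in which the counter already holds `i`; this is why a
`setInt` of the counter appears in the conclusion of a step. -/
theorem forTo {v : Fin k} {N : IExp k} {p : BProgram k} {m₀ : Mem k} {Q : Mem k → Prop}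
    (B : ℕ) (Inv : ℕ → Mem k → Prop) (hB : B ≤ X.n) (hBW : B < W)
    (hN : ∀ m : Mem k, N.Fits X W m ∧ N.eval X m = B) (hp : p.wi v = false)
    (h₀ : Inv 0 (m₀.setInt v 0 0))
    (hstep : ∀ i m, i < B → Inv i m → m.int v 0 = i →
      (BProgram.forTo v N p).Frame m₀ m →
      Ex X W p m (fun m' => Inv (i + 1) (m'.setInt v 0 (i + 1))))
    (hQ : ∀ m, Inv B m → (BProgram.forTo v N p).Frame m₀ m → Q m) :
    Ex X W (BProgram.forTo v N p) m₀ Q := by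
  -- The loop starts after the reset of the counter, but the whole program assigns to the counter
  -- anyway, so the reset is invisible to its frame.
  have hlift : ∀ {m m' : Mem k}, (BProgram.seq p (.setInt v (.lit 0) (.add (iv v) (.lit 1)))).Frame
      (m.setInt v 0 0) m' → (BProgram.forTo v N p).Frame m m' := by
    intro m m' h
    refine ⟨fun a ha => ?_, fun a ha => ?_⟩
    · have ha' := ha
      simp only [BProgram.forTo, BProgram.wi, Bool.or_eq_false_iff] at ha'
      rw [h.1 a (by simp only [BProgram.wi, Bool.or_eq_false_iff]; exact ha'.2)]
      have : a ≠ v := by simpa using ha'.1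
      simp [this]
    · have ha' := ha
      simp only [BProgram.forTo, BProgram.wr, Bool.or_eq_false_iff] at ha'
      rw [h.2 a (by simp only [BProgram.wr, Bool.or_eq_false_iff]; exact ha'.2)]
      simp
  have key : Ex X W (BProgram.forTo v N p) m₀
      (fun m => Inv B m ∧ (BProgram.forTo v N p).Frame m₀ m) := by
    refine Ex.seq (Ex.setInt (by simp [IExp.Fits]; omega) (by simp [IExp.Fits]; omega) ?_)
    simp only [IExp.eval]
    refine Ex.loop (fun f m => ∃ i, i + f = B ∧ m.int v 0 = i ∧ Inv i m) B hB
      ⟨0, by simp, by simp, h₀⟩ ?_ ?_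
    · rintro f m ⟨i, hi, hv, hI⟩ hF
      refine ⟨⟨⟨by simp [IExp.Fits]; omega, by simp [IExp.eval]; omega⟩, (hN m).1⟩, ?_⟩
      simp only [Test.Holds, IExp.eval, (hN m).2, hv]
      intro hlt
      refine Ex.seq ((hstep i m hlt hI hv (hlift hF)).mono fun m' hF' h' => ?_)
      have hv' : m'.int v 0 = i := by rw [hF'.1 v hp, hv]
      refine Ex.setInt (by simp [IExp.Fits]; omega) ?_ ?_
      · simp [IExp.Fits, IExp.eval, hv']; omega
      · simp only [IExp.eval, hv']
        exact ⟨B - (i + 1), by omega, i + 1, by omega, by simp, h'⟩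
    · rintro f m ⟨i, hi, hv, hI⟩ hn hF
      simp only [Test.Holds, IExp.eval, (hN m).2, hv] at hn
      obtain rfl : i = B := by omega
      exact ⟨hI, hlift hF⟩
  exact key.mono fun m _ h => hQ m h.1 h.2

theorem minInto {a : Fin k} {i : IExp k} {e : RExp k} {m : Mem k} {Q : Mem k → Prop}
    (hi : i.Fits X W m) (he : e.Fits X W m)
    (h : Q (m.setReal a (i.eval X m) (min (m.real a (i.eval X m)) (e.eval X m)))) :
    Ex X W (BProgram.minInto a i e) m Q := by
  refine Ex.ite ⟨he, hi⟩ (fun hb => Ex.setReal hi he ?_) (fun hb => Ex.skip ?_)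
  · simp only [Test.Holds, RExp.eval] at hb
    rwa [min_eq_right hb] at h
  · simp only [Test.Holds, RExp.eval, not_le] at hb
    rwa [min_eq_left hb.le, Mem.setReal_self] at h

theorem maxInto {a : Fin k} {i : IExp k} {e : RExp k} {m : Mem k} {Q : Mem k → Prop}
    (hi : i.Fits X W m) (he : e.Fits X W m)
    (h : Q (m.setReal a (i.eval X m) (max (m.real a (i.eval X m)) (e.eval X m)))) :
    Ex X W (BProgram.maxInto a i e) m Q := by
  refine Ex.ite ⟨hi, he⟩ (fun hb => Ex.setReal hi he ?_) (fun hb => Ex.skip ?_)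
  · simp only [Test.Holds, RExp.eval] at hb
    rwa [max_eq_right hb] at h
  · simp only [Test.Holds, RExp.eval, not_le] at hb
    rwa [max_eq_left hb.le, Mem.setReal_self] at h

end Ex

end Doap

namespace Doap

/-! ### The program

Integer arrays: `0` output, `1` vertices sorted by their position, `2` marks of the visited
vertices, `3`, `4` ends of a diametral path, `5`, `6` best grid cell, `7`, `8` best shortcut,
`9`–`13` variables of `distances`, `14`–`16` further loop variables, `17`, `18` grid cell to be
evaluated, `19`, `20` variables of `evalAt`, `21`, `22` position of a walk, `23` position on the
border.

Real arrays: `0` distances in the tree, `1`, `2` positions and heights of the vertices, `3`, `4` the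
same in sorted order, `5` table of the shortcut weights, closed along the rows, `6`, `7` prefix
and suffix maxima, `8` twice the diameter of the tree, `9`–`15` variables of `evalAt`, `16` best
value, `17`, `18` weights of the connections to the best grid cell, `19` best shortcut value. -/

namespace BProgram

/-- The number of vertices. -/
abbrev nV : IExp 24 := .numVertices

/-- The index of the cell `(i, j)` of a square table. -/
abbrev ix (i j : IExp 24) : IExp 24 := .add (.mul i .numVertices) j

/-- Assignment to an integer variable. -/
abbrev assignI (a : Fin 24) (x : IExp 24) : BProgram 24 := .setInt a (.lit 0) x

/-- Assignment to a real variable. -/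
abbrev assignR (a : Fin 24) (x : RExp 24) : BProgram 24 := .setReal a (.lit 0) x

/-- Find an edge of the tree between a visited and a new vertex. -/
def findEdge : BProgram 24 :=
  .seq (assignI 11 (.lit 0))
    (forTo 10 (.sub nV (.lit 1))
      (.ite (.not (.ieq (.read 2 (.fst (iv 10))) (.read 2 (.snd (iv 10)))))
        (assignI 11 (iv 10)) .skip))

/-- Let variable `12` be the visited and `13` the new end of the edge. -/
def orient : BProgram 24 :=
  .ite (.ieq (.read 2 (.fst (iv 11))) (.lit 1))
    (.seq (assignI 12 (.fst (iv 11))) (assignI 13 (.snd (iv 11))))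
    (.seq (assignI 12 (.snd (iv 11))) (assignI 13 (.fst (iv 11))))

/-- Enter the distances of the new vertex. -/
def enterVertex : BProgram 24 :=
  forTo 10 nV
    (.ite (.ieq (.read 2 (iv 10)) (.lit 1))
      (.seq
        (.setReal 0 (ix (iv 10) (iv 13)) (.add (.read 0 (ix (iv 10) (iv 12))) (.weight (iv 11))))
        (.setReal 0 (ix (iv 13) (iv 10)) (.read 0 (ix (iv 10) (iv 13)))))
      .skip)

/-- Compute the distances of all pairs of vertices in the tree. -/
def distances : BProgram 24 :=
  .seq (.setInt 2 (.lit 0) (.lit 1))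
    (forTo 9 (.sub nV (.lit 1))
      (.seq findEdge (.seq orient (.seq enterVertex (.setInt 2 (iv 13) (.lit 1))))))

/-- Find two vertices of maximum distance. -/
def diametral : BProgram 24 :=
  .seq (assignI 3 (.lit 0))
  (.seq (assignI 4 (.lit 0))
    (forTo 14 nV (forTo 15 nV
      (.ite (.rle (.read 0 (ix (iv 14) (iv 15))) (.read 0 (ix (iv 3) (iv 4)))) .skip
        (.seq (assignI 3 (iv 14)) (assignI 4 (iv 15)))))))

/-- Compute the positions and heights of the vertices. -/
def coordinates : BProgram 24 :=
  .seq (assignR 8 (.add (.read 0 (ix (iv 3) (iv 4))) (.read 0 (ix (iv 3) (iv 4)))))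
    (forTo 14 nV
      (.seq
        (.setReal 1 (iv 14) (.add (.sub (.read 0 (ix (iv 3) (iv 14))) (.read 0 (ix (iv 4) (iv 14))))
          (.read 0 (ix (iv 3) (iv 4)))))
        (.setReal 2 (iv 14) (.sub (.add (.read 0 (ix (iv 3) (iv 14))) (.read 0 (ix (iv 4) (iv 14))))
          (.read 0 (ix (iv 3) (iv 4)))))))

/-- Sort the vertices by their position. -/
def sortVertices : BProgram 24 :=
  forTo 14 nV
    (.seq (assignI 16 (.lit 0))
    (.seq
      (forTo 15 nV
        (.ite (.and (.rle (.read 1 (iv 15)) (.read 1 (iv 14)))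
            (.not (.and (.rle (.read 1 (iv 14)) (.read 1 (iv 15)))
              (.not (.ilt (iv 15) (iv 14))))))
          (assignI 16 (.add (iv 16) (.lit 1))) .skip))
    (.seq (.setInt 1 (iv 16) (iv 14))
    (.seq (.setReal 3 (iv 16) (.read 1 (iv 14)))
      (.setReal 4 (iv 16) (.read 2 (iv 14)))))))

/-- The doubled weight of the shortcut from the `i`-th to the `j`-th vertex. -/
abbrev dq (i j : IExp 24) : RExp 24 :=
  .add (.query (.read 1 i) (.read 1 j)) (.query (.read 1 i) (.read 1 j))

/-- Compute the table of the shortcut weights and close it along the rows. -/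
def fillTable : BProgram 24 :=
  forTo 14 nV
    (.seq
      (forTo 15 nV
        (.seq
          (.ite (.ieq (iv 14) (iv 15)) (.setReal 5 (ix (iv 14) (iv 15)) (rv 8))
            (.seq (.setReal 5 (ix (iv 14) (iv 15))
                (.add (.add (dq (iv 14) (iv 15)) (.read 4 (iv 14))) (.read 4 (iv 15))))
              (minInto 5 (ix (iv 14) (iv 15))
                (.add (.add (dq (iv 15) (iv 14)) (.read 4 (iv 14))) (.read 4 (iv 15))))))
          (.ite (.ieq (iv 15) (.lit 0)) .skip
            (minInto 5 (ix (iv 14) (iv 15)) (.add (.read 5 (ix (iv 14) (.sub (iv 15) (.lit 1))))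
              (.sub (.read 3 (iv 15)) (.read 3 (.sub (iv 15) (.lit 1)))))))))
      (forTo 15 (.sub nV (.lit 1))
        (.seq (assignI 16 (.sub nV (.add (iv 15) (.lit 2))))
          (minInto 5 (ix (iv 14) (iv 16)) (.add (.read 5 (ix (iv 14) (.add (iv 16) (.lit 1))))
            (.sub (.read 3 (.add (iv 16) (.lit 1))) (.read 3 (iv 16))))))))

/-- Compute prefix maxima of height plus position and suffix maxima of height minus position. -/
def prefixMaxima : BProgram 24 :=
  .seq (assignR 6 .zero)
  (.seq
    (forTo 14 nV
      (.seq (.setReal 6 (.add (iv 14) (.lit 1)) (.read 6 (iv 14)))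
        (maxInto 6 (.add (iv 14) (.lit 1)) (.add (.read 4 (iv 14)) (.read 3 (iv 14))))))
    (forTo 14 nV
      (.seq (assignI 15 (.sub nV (.add (iv 14) (.lit 1))))
        (.seq (.setReal 7 (iv 15) (.sub (.read 4 (iv 15)) (.read 3 (iv 15))))
          (.ite (.ieq (iv 14) (.lit 0)) .skip
            (maxInto 7 (iv 15) (.read 7 (.add (iv 15) (.lit 1)))))))))

/-- Compute the closed weight of the grid cell. -/
def evalWeight : BProgram 24 :=
  .seq (assignR 9 (.read 5 (ix (iv 17) (iv 18))))
    (forTo 19 nV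
      (.ite (.ilt (iv 17) (iv 19))
        (minInto 9 (.lit 0) (.add (.read 5 (ix (iv 19) (iv 18)))
          (.sub (.read 3 (iv 19)) (.read 3 (iv 17)))))
        (minInto 9 (.lit 0) (.add (.read 5 (ix (iv 19) (iv 18)))
          (.sub (.read 3 (iv 17)) (.read 3 (iv 19)))))))

/-- Position of the row and of the column of the grid cell. -/
abbrev xI : RExp 24 := .read 3 (iv 17)
/-- The position of the column of the grid cell. -/
abbrev xJ : RExp 24 := .read 3 (iv 18)
/-- The position of the vertex under consideration. -/
abbrev xK : RExp 24 := .read 3 (iv 19)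
/-- The height of the vertex under consideration. -/
abbrev hK : RExp 24 := .read 4 (iv 19)

/-- Compute the first three parts of the value. -/
def evalLinear : BProgram 24 :=
  .seq (assignR 10 (rv 8))
  (.seq (minInto 10 (.lit 0) (.add (rv 8) (.sub (.add (rv 9) xI) xJ)))
  (.seq (assignR 11 .zero)
  (.seq (assignR 12 .zero)
    (forTo 19 nV
      (.seq (assignR 14 (.add hK (.sub (rv 8) xK)))
      (.seq (minInto 14 (.lit 0) (.add hK (.add (rv 8) (.add (.sub (.sub (rv 9) xI) xJ) xK))))
      (.seq (maxInto 11 (.lit 0) (rv 14))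
      (.seq (assignR 14 (.add hK xK))
      (.seq (minInto 14 (.lit 0) (.add hK (.sub (.add (.add (rv 9) xI) xJ) xK)))
        (maxInto 12 (.lit 0) (rv 14)))))))))))

/-- Compute the cycle part of the value, with two pointers. -/
def evalCycle : BProgram 24 :=
  .seq (assignR 13 .zero)
  (.seq (assignR 14 (.add (.sub (rv 9) xI) xJ))
  (.seq (assignI 19 (.lit 0))
  (.seq (assignI 20 (.lit 0))
    (.loop (fun n => 2 * n) (.ilt (iv 19) nV)
      (.ite (.and (.ilt (iv 20) nV)
          (.rle (.add (.sub (.read 3 (iv 20)) xK) (.sub (.read 3 (iv 20)) xK)) (rv 14)))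
        (assignI 20 (.add (iv 20) (.lit 1)))
        (.seq (maxInto 13 (.lit 0) (.add (.sub hK xK) (.read 6 (iv 20))))
        (.seq
          (.ite (.ilt (iv 20) nV)
            (maxInto 13 (.lit 0) (.add (.add (.add hK xK) (rv 14)) (.read 7 (iv 20)))) .skip)
          (assignI 19 (.add (iv 19) (.lit 1))))))))))

/-- Update the best grid cell. -/
def updateBest : BProgram 24 :=
  .seq (assignR 15 (rv 10))
  (.seq (maxInto 15 (.lit 0) (rv 11))
  (.seq (maxInto 15 (.lit 0) (rv 12))
  (.seq (maxInto 15 (.lit 0) (rv 13))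
    (.ite (.rle (rv 15) (rv 16))
      (.seq (assignR 16 (rv 15)) (.seq (assignI 5 (iv 17)) (assignI 6 (iv 18)))) .skip))))

/-- Evaluate the grid cell given by the variables `17` and `18`. -/
def evalAt : BProgram 24 :=
  .seq evalWeight (.seq evalLinear (.seq evalCycle updateBest))

/-- Evaluate the grid cell `(i, j)`. -/
def evalCell (i j : IExp 24) : BProgram 24 :=
  .seq (assignI 17 i) (.seq (assignI 18 j) evalAt)

/-- Evaluate the border of the grid. -/
def border : BProgram 24 :=
  .seq (assignR 16 (rv 8))
  (.seq (assignI 5 (.lit 0))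
  (.seq (assignI 6 (.lit 0))
    (forTo 23 nV
      (.seq (evalCell (iv 23) (.lit 0))
      (.seq (evalCell (iv 23) (.sub nV (.lit 1)))
      (.seq (evalCell (.lit 0) (iv 23))
        (evalCell (.sub nV (.lit 1)) (iv 23))))))))

/-- Walk through the grid along the boundary that is described by the test `b`. -/
def walk (col : IExp 24 → IExp 24) (b : Test 24) : BProgram 24 :=
  .seq (assignI 21 (.lit 0))
  (.seq (assignI 22 (.lit 0))
    (.loop (fun n => 2 * n) (.and (.ilt (iv 21) nV) (.ilt (iv 22) nV))
      (.seq (evalCell (.sub (iv 21) (.lit 1)) (col (iv 22)))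
      (.seq (evalCell (iv 21) (col (.sub (iv 22) (.lit 1))))
      (.seq (evalCell (iv 21) (col (iv 22)))
        (.ite b (assignI 22 (.add (iv 22) (.lit 1))) (assignI 21 (.add (iv 21) (.lit 1)))))))))

/-- Compute the weights of the connections of the vertices to the best grid cell. -/
def connections : BProgram 24 :=
  forTo 14 nV
    (.seq
      (.ite (.ilt (iv 5) (iv 14))
        (.setReal 17 (iv 14)
          (.add (.read 4 (iv 14)) (.sub (.read 3 (iv 14)) (.read 3 (iv 5)))))
        (.setReal 17 (iv 14)
          (.add (.read 4 (iv 14)) (.sub (.read 3 (iv 5)) (.read 3 (iv 14))))))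
      (.ite (.ilt (iv 6) (iv 14))
        (.setReal 18 (iv 14)
          (.add (.read 4 (iv 14)) (.sub (.read 3 (iv 14)) (.read 3 (iv 6)))))
        (.setReal 18 (iv 14)
          (.add (.read 4 (iv 14)) (.sub (.read 3 (iv 6)) (.read 3 (iv 14)))))))

/-- Store the value of the shortcut from the `i`-th to the `j`-th vertex in the real variable
`14`. -/
def shortcutValue (i j : IExp 24) : BProgram 24 :=
  .seq (assignR 14 (.add (.read 17 i) (.read 18 j)))
  (.seq (minInto 14 (.lit 0) (.add (.read 17 j) (.read 18 i)))
    (assignR 14 (.add (dq i j) (rv 14))))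

/-- Choose a shortcut that realizes the weight of the best grid cell. -/
def chooseShortcut : BProgram 24 :=
  .seq connections
  (.seq (assignI 7 (.lit 0))
  (.seq (assignI 8 (.lit 1))
  (.seq (shortcutValue (iv 7) (iv 8))
  (.seq (assignR 19 (rv 14))
  (.seq
    (forTo 14 nV (forTo 15 nV
      (.ite (.ieq (iv 14) (iv 15)) .skip
        (.seq (shortcutValue (iv 14) (iv 15))
          (.ite (.rle (rv 14) (rv 19))
            (.seq (assignR 19 (rv 14)) (.seq (assignI 7 (iv 14)) (assignI 8 (iv 15)))) .skip)))))
    (.seq (.setInt 0 (.lit 0) (.read 1 (iv 7)))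
      (.setInt 0 (.lit 1) (.read 1 (iv 8)))))))))

/-- The program that finds an optimal shortcut. -/
def doap : BProgram 24 :=
  .seq distances (.seq diametral (.seq coordinates (.seq sortVertices (.seq fillTable
  (.seq prefixMaxima (.seq border
  (.seq (walk id (.not (.rle (rv 10) (rv 13))))
  (.seq (walk (fun j => .sub nV (.add j (.lit 1))) (.not (.rle (rv 12) (rv 11))))
    chooseShortcut))))))))

end BProgram

-- Loop nests have depth two with at most `2 * n` rounds per level, so the bound is a quadratic
-- polynomial in `n`; the constant is generous.
open BProgram in
theorem time_doap_le (n : ℕ) (hn : 2 ≤ n) : doap.time n ≤ 100000 * n ^ 2 := by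
  simp only [doap, distances, findEdge, orient, enterVertex, diametral, coordinates, sortVertices,
    fillTable, prefixMaxima, border, evalCell, evalAt, evalWeight, evalLinear, evalCycle,
    updateBest, walk, chooseShortcut, connections, shortcutValue, forTo, minInto, maxInto, time,
    Test.cost, IExp.cost, RExp.cost, id]
  ring_nf
  nlinarith

end Doap

namespace Doap

/-! ### Running minima and maxima -/

/-- The maximum of `0` and `f 0, …, f (k - 1)`. -/
noncomputable def runMax (f : ℕ → ℝ) : ℕ → ℝ
  | 0 => 0
  | k + 1 => max (runMax f k) (f k)

/-- The minimum of `b` and `f 0, …, f (k - 1)`. -/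
noncomputable def runMin (b : ℝ) (f : ℕ → ℝ) : ℕ → ℝ
  | 0 => b
  | k + 1 => min (runMin b f k) (f k)

theorem runMax_nonneg (f : ℕ → ℝ) (n : ℕ) : 0 ≤ runMax f n := by
  induction n with
  | zero => exact le_rfl
  | succ n ih => exact le_max_of_le_left ih

theorem le_runMax {f : ℕ → ℝ} {n i : ℕ} (h : i < n) : f i ≤ runMax f n := by
  induction n with
  | zero => omega
  | succ n ih =>
    rcases Nat.lt_succ_iff_lt_or_eq.1 h with h | rfl
    · exact le_max_of_le_left (ih h)
    · exact le_max_right _ _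

theorem runMax_le {f : ℕ → ℝ} {n : ℕ} {b : ℝ} (hb : 0 ≤ b) (h : ∀ i < n, f i ≤ b) :
    runMax f n ≤ b := by
  induction n with
  | zero => exact hb
  | succ n ih => exact max_le (ih fun i hi => h i (by omega)) (h n (by omega))

theorem runMax_mono {f g : ℕ → ℝ} {n : ℕ} (h : ∀ i < n, f i ≤ g i) : runMax f n ≤ runMax g n :=
  runMax_le (runMax_nonneg _ _) fun i hi => (h i hi).trans (le_runMax hi)

theorem runMin_le_base (b : ℝ) (f : ℕ → ℝ) (n : ℕ) : runMin b f n ≤ b := by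
  induction n with
  | zero => exact le_rfl
  | succ n ih => exact min_le_of_left_le ih

theorem runMin_le {b : ℝ} {f : ℕ → ℝ} {n i : ℕ} (h : i < n) : runMin b f n ≤ f i := by
  induction n with
  | zero => omega
  | succ n ih =>
    rcases Nat.lt_succ_iff_lt_or_eq.1 h with h | rfl
    · exact min_le_of_left_le (ih h)
    · exact min_le_right _ _

theorem le_runMin {b c : ℝ} {f : ℕ → ℝ} {n : ℕ} (hb : c ≤ b) (h : ∀ i < n, c ≤ f i) :
    c ≤ runMin b f n := by
  induction n with
  | zero => exact hb
  | succ n ih => exact le_min (ih fun i hi => h i (by omega)) (h n (by omega))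

/-! ### The grid of pairs of positions -/

/-- Positions `x i` and heights `h i` of `n` points, the length `D` of the line, and a table `T` of
connection weights. -/
structure Grid where
  n : ℕ
  x : ℕ → ℝ
  h : ℕ → ℝ
  D : ℝ
  T : ℕ → ℕ → ℝ

namespace Grid

variable (G : Grid)

/-- The table, closed along the columns. -/
noncomputable def E (i j : ℕ) : ℝ := runMin (G.T i j) (fun k => G.T k j + |G.x i - G.x k|) G.n

/-- The distance of the ends of the line, with a connection for the cell `(i, j)`. -/
noncomputable def U (i j : ℕ) : ℝ := min G.D (G.D + (G.E i j + G.x i - G.x j))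

/-- The maximum distance from the right end by the connection or on the line. -/
noncomputable def R (i j : ℕ) : ℝ :=
  runMax (fun k => min (G.h k + (G.D - G.x k))
    (G.h k + (G.D + (G.E i j - G.x i - G.x j + G.x k)))) G.n

/-- The maximum distance from the left end by the connection or on the line. -/
noncomputable def L (i j : ℕ) : ℝ :=
  runMax (fun k => min (G.h k + G.x k) (G.h k + (G.E i j + G.x i + G.x j - G.x k))) G.n

/-- The length of a path from the `k`-th to the `l`-th point, on the line or around a cycle of
length `w`. -/
noncomputable def arc (w : ℝ) (k l : ℕ) : ℝ :=
  G.h k + G.h l + min (G.x l - G.x k) (w - (G.x l - G.x k))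

/-- The maximum distance on a cycle of length `w`. -/
noncomputable def cyc (w : ℝ) : ℝ := runMax (fun k => runMax (G.arc w k) G.n) G.n

/-- The maximum distance on the cycle that is closed by the connection. -/
noncomputable def C (i j : ℕ) : ℝ := G.cyc (G.E i j - G.x i + G.x j)

/-- The value of a grid cell: the diameter of the line with heights and a connection. -/
noncomputable def val (i j : ℕ) : ℝ := max (max (max (G.U i j) (G.R i j)) (G.L i j)) (G.C i j)

/-- The positions are sorted, heights are bounded by the distances from the ends, and the table is
Lipschitz along the rows. -/
structure Valid : Prop where
  mono : ∀ i j, i ≤ j → j < G.n → G.x i ≤ G.x j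
  h_nonneg : ∀ i < G.n, 0 ≤ G.h i
  h_le : ∀ i < G.n, G.h i ≤ G.x i
  h_le' : ∀ i < G.n, G.h i ≤ G.D - G.x i
  lip : ∀ i j, i < G.n → j + 1 < G.n → G.T i (j + 1) ≤ G.T i j + (G.x (j + 1) - G.x j)
  lip' : ∀ i j, i < G.n → j + 1 < G.n → G.T i j ≤ G.T i (j + 1) + (G.x (j + 1) - G.x j)

variable {G}

theorem E_le_T (i j : ℕ) : G.E i j ≤ G.T i j := runMin_le_base _ _ _

/-- A minimum of the 1-Lipschitz functions `T k j + |x i - x k|` of `x i` is 1-Lipschitz; the base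
entry of the minimum is the term `k = i`. -/
theorem E_row {i i' j : ℕ} (hi' : i' < G.n) : G.E i j ≤ G.E i' j + |G.x i - G.x i'| := by
  have : G.E i j - |G.x i - G.x i'| ≤ G.E i' j := by
    refine le_runMin ?_ fun k hk => ?_
    · have := runMin_le (b := G.T i j) (f := fun k => G.T k j + |G.x i - G.x k|) hi'
      rw [E]; linarith
    · have := runMin_le (b := G.T i j) (f := fun k => G.T k j + |G.x i - G.x k|) hk
      have h2 := abs_sub_le (G.x i) (G.x i') (G.x k)
      rw [E]; linarith
  linarith

variable (hG : G.Valid)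
include hG

/-- Every term of the minimum over `k` inherits the Lipschitz bound of row `k` of the table, so
closing along the columns does not destroy the closure along the rows. -/
theorem Valid.E_col {i j : ℕ} (hi : i < G.n) (hj : j + 1 < G.n) :
    G.E i (j + 1) ≤ G.E i j + (G.x (j + 1) - G.x j) := by
  have : G.E i (j + 1) - (G.x (j + 1) - G.x j) ≤ G.E i j := by
    refine le_runMin ?_ fun k hk => ?_
    · have := runMin_le_base (G.T i (j + 1)) (fun k => G.T k (j + 1) + |G.x i - G.x k|) G.n
      have := hG.lip i j hi hj
      rw [E]; linarith
    · have := runMin_le (b := G.T i (j + 1)) (f := fun k => G.T k (j + 1) + |G.x i - G.x k|) hk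
      have := hG.lip k j hk hj
      rw [E]; linarith
  linarith

theorem Valid.E_col' {i j : ℕ} (hi : i < G.n) (hj : j + 1 < G.n) :
    G.E i j ≤ G.E i (j + 1) + (G.x (j + 1) - G.x j) := by
  have : G.E i j - (G.x (j + 1) - G.x j) ≤ G.E i (j + 1) := by
    refine le_runMin ?_ fun k hk => ?_
    · have := runMin_le_base (G.T i j) (fun k => G.T k j + |G.x i - G.x k|) G.n
      have := hG.lip' i j hi hj
      rw [E]; linarith
    · have := runMin_le (b := G.T i j) (f := fun k => G.T k j + |G.x i - G.x k|) hk
      have := hG.lip' k j hk hj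
      rw [E]; linarith
  linarith

theorem Valid.E_row_succ {i j : ℕ} (hi : i + 1 < G.n) :
    G.E (i + 1) j ≤ G.E i j + (G.x (i + 1) - G.x i) := by
  have h := G.E_row (i := i + 1) (i' := i) (j := j) (by omega)
  rwa [abs_of_nonneg (sub_nonneg.2 (hG.mono i (i + 1) (by omega) hi))] at h

theorem Valid.E_row_succ' {i j : ℕ} (hi : i + 1 < G.n) :
    G.E i j ≤ G.E (i + 1) j + (G.x (i + 1) - G.x i) := by
  have h := G.E_row (i := i) (i' := i + 1) (j := j) hi
  rwa [abs_sub_comm, abs_of_nonneg (sub_nonneg.2 (hG.mono i (i + 1) (by omega) hi))] at h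

/-- In `U`, `R`, `L` and `C` the weight `E i j` occurs together with `± x i ± x j`. In one step of
`i` or `j` the weight changes by no more than that position does, so the sign of the position alone
decides the direction of monotonicity. The same holds for the seven companions of this lemma. -/
theorem Valid.U_row {i j : ℕ} (hi : i + 1 < G.n) : G.U i j ≤ G.U (i + 1) j :=
  min_le_min le_rfl (by have := hG.E_row_succ' (j := j) hi; linarith)

theorem Valid.U_col {i j : ℕ} (hi : i < G.n) (hj : j + 1 < G.n) : G.U i (j + 1) ≤ G.U i j :=
  min_le_min le_rfl (by have := hG.E_col hi hj; linarith)

theorem Valid.R_row {i j : ℕ} (hi : i + 1 < G.n) : G.R (i + 1) j ≤ G.R i j :=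
  runMax_mono fun k _ => min_le_min le_rfl (by have := hG.E_row_succ (j := j) hi; linarith)

theorem Valid.R_col {i j : ℕ} (hi : i < G.n) (hj : j + 1 < G.n) : G.R i (j + 1) ≤ G.R i j :=
  runMax_mono fun k _ => min_le_min le_rfl (by have := hG.E_col hi hj; linarith)

theorem Valid.L_row {i j : ℕ} (hi : i + 1 < G.n) : G.L i j ≤ G.L (i + 1) j :=
  runMax_mono fun k _ => min_le_min le_rfl (by have := hG.E_row_succ' (j := j) hi; linarith)

theorem Valid.L_col {i j : ℕ} (hi : i < G.n) (hj : j + 1 < G.n) : G.L i j ≤ G.L i (j + 1) :=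
  runMax_mono fun k _ => min_le_min le_rfl (by have := hG.E_col' hi hj; linarith)

omit hG in
theorem cyc_mono {w w' : ℝ} (h : w ≤ w') : G.cyc w ≤ G.cyc w' :=
  runMax_mono fun _ _ => runMax_mono fun _ _ =>
    add_le_add le_rfl (min_le_min le_rfl (by linarith))

theorem Valid.C_row {i j : ℕ} (hi : i + 1 < G.n) : G.C (i + 1) j ≤ G.C i j :=
  cyc_mono (by have := hG.E_row_succ (j := j) hi; linarith)

theorem Valid.C_col {i j : ℕ} (hi : i < G.n) (hj : j + 1 < G.n) : G.C i j ≤ G.C i (j + 1) :=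
  cyc_mono (by have := hG.E_col' hi hj; linarith)

omit hG in
theorem arc_le_cyc {w : ℝ} {k l : ℕ} (hk : k < G.n) (hl : l < G.n) : G.arc w k l ≤ G.cyc w :=
  (le_runMax hl).trans (le_runMax (f := fun k => runMax (G.arc w k) G.n) hk)

/-- Each part has the alternative of staying on the line, and heights bounded by the distances from
the ends keep it below `D`. -/
theorem Valid.val_le (hD : 0 ≤ G.D) (i j : ℕ) : G.val i j ≤ G.D := by
  refine max_le (max_le (max_le (min_le_left _ _) ?_) ?_) ?_
  · refine runMax_le hD fun k hk => min_le_of_left_le ?_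
    have := hG.h_le k hk; linarith
  · refine runMax_le hD fun k hk => min_le_of_left_le ?_
    have := hG.h_le' k hk; linarith
  · refine runMax_le hD fun k hk => runMax_le hD fun l hl => ?_
    have h1 := hG.h_le k hk
    have h2 := hG.h_le' l hl
    have := min_le_left (G.x l - G.x k) (G.E i j - G.x i + G.x j - (G.x l - G.x k))
    rw [arc]; linarith

omit hG in
/-- All pairs of adjacent grid cells that differ in `P` are in `S`. -/
structure Crossed (n : ℕ) (P S : ℕ → ℕ → Prop) : Prop where
  row : ∀ i j, i < n → j + 1 < n → P i j → ¬ P i (j + 1) → S i j ∧ S i (j + 1)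
  col : ∀ i j, i + 1 < n → j < n → ¬ P i j → P (i + 1) j → S i j ∧ S (i + 1) j

/-- If no cell of the border and no cell at the boundaries of `C < U` and `R < L` has a value less
than `β`, then no cell has. -/
theorem Valid.le_val {β : ℝ}
    (hborder : ∀ t < G.n, β ≤ G.val t 0 ∧ β ≤ G.val t (G.n - 1) ∧ β ≤ G.val 0 t ∧
      β ≤ G.val (G.n - 1) t)
    (hA : Crossed G.n (fun i j => G.C i j < G.U i j) (fun i j => β ≤ G.val i j))
    (hB : Crossed G.n (fun i j => G.R i (G.n - (j + 1)) < G.L i (G.n - (j + 1)))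
      (fun i j => β ≤ G.val i (G.n - (j + 1)))) :
    ∀ i j, i < G.n → j < G.n → β ≤ G.val i j := by
  -- The boundary of `R < L` was described in mirrored columns. Undoing the reflection exchanges the
  -- two cells of a horizontal pair.
  have hBrow : ∀ i j, i < G.n → j + 1 < G.n → ¬ G.R i j < G.L i j → G.R i (j + 1) < G.L i (j + 1) →
      β ≤ G.val i j ∧ β ≤ G.val i (j + 1) := by
    intro i j hi hj h h'
    have e1 : G.n - (G.n - (j + 2) + 1) = j + 1 := by omega
    have e2 : G.n - (G.n - (j + 2) + 1 + 1) = j := by omega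
    have := hB.row i (G.n - (j + 2)) hi (by omega) (by rwa [e1]) (by rwa [e2])
    rw [e1, e2] at this
    exact this.symm
  have hBcol : ∀ i j, i + 1 < G.n → j < G.n → ¬ G.R i j < G.L i j → G.R (i + 1) j < G.L (i + 1) j →
      β ≤ G.val i j ∧ β ≤ G.val (i + 1) j := by
    intro i j hi hj h h'
    have e1 : G.n - (G.n - (j + 1) + 1) = j := by omega
    have := hB.col i (G.n - (j + 1)) hi (by omega) (by rwa [e1]) (by rwa [e1])
    rwa [e1] at this
  -- In this region the value is `max U R`, and both fall as `j` grows. Hence one moves to larger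
  -- `j`, with `d` columns left, until the border or a boundary of the region is met.
  have left : ∀ d i j, i < G.n → j + d + 1 = G.n → G.C i j < G.U i j → ¬ G.R i j < G.L i j →
      β ≤ G.val i j := by
    intro d
    induction d with
    | zero =>
      intro i j hi hj _ _
      obtain rfl : j = G.n - 1 := by omega
      exact (hborder i hi).2.1
    | succ d ih =>
      intro i j hi hj h h'
      by_cases hc : G.C i (j + 1) < G.U i (j + 1)
      · by_cases hr : G.R i (j + 1) < G.L i (j + 1)
        · exact (hBrow i j hi (by omega) h' hr).1
        · refine (ih i (j + 1) hi (by omega) hc hr).trans ?_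
          rw [val, val, max_eq_left (by
            exact hc.le.trans (le_max_of_le_left (le_max_left _ _))), max_eq_left (by
            exact (not_lt.1 hr).trans (le_max_right _ _))]
          exact le_max_of_le_left (le_max_of_le_left (max_le_max (hG.U_col hi (by omega))
            (hG.R_col hi (by omega))))
      · exact (hA.row i j hi (by omega) h hc).1
  -- Here the value is `max C L`, and both grow with `j`: move towards column `0`.
  have right : ∀ j i, i < G.n → j < G.n → ¬ G.C i j < G.U i j → G.R i j < G.L i j →
      β ≤ G.val i j := by
    intro j
    induction j with
    | zero => exact fun i hi _ _ _ => (hborder i hi).1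
    | succ j ih =>
      intro i hi hj h h'
      by_cases hc : G.C i j < G.U i j
      · exact (hA.row i j hi hj hc h).2
      · by_cases hr : G.R i j < G.L i j
        · refine (ih i hi (by omega) hc hr).trans ?_
          refine max_le (max_le (max_le ?_ ?_) ?_) ?_
          · exact (not_lt.1 hc).trans ((hG.C_col hi hj).trans (le_max_right _ _))
          · exact hr.le.trans ((hG.L_col hi hj).trans (le_max_of_le_left (le_max_right _ _)))
          · exact (hG.L_col hi hj).trans (le_max_of_le_left (le_max_right _ _))
          · exact (hG.C_col hi hj).trans (le_max_right _ _)
        · exact (hBrow i j hi hj hr h').2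
  -- Here the value is `max C R`, and both fall as `i` grows: move towards the last row.
  have top : ∀ d i j, i + d + 1 = G.n → j < G.n → ¬ G.C i j < G.U i j → ¬ G.R i j < G.L i j →
      β ≤ G.val i j := by
    intro d
    induction d with
    | zero =>
      intro i j hi hj _ _
      obtain rfl : i = G.n - 1 := by omega
      exact (hborder j hj).2.2.2
    | succ d ih =>
      intro i j hi hj h h'
      by_cases hc : G.C (i + 1) j < G.U (i + 1) j
      · exact (hA.col i j (by omega) hj h hc).1
      · by_cases hr : G.R (i + 1) j < G.L (i + 1) j
        · exact (hBcol i j (by omega) hj h' hr).1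
        · refine (ih (i + 1) j (by omega) hj hc hr).trans ?_
          have h1 : G.C (i + 1) j ≤ G.val i j :=
            (hG.C_row (by omega)).trans (le_max_right _ _)
          have h2 : G.R (i + 1) j ≤ G.val i j :=
            (hG.R_row (by omega)).trans
              (le_max_of_le_left (le_max_of_le_left (le_max_right _ _)))
          exact max_le (max_le (max_le ((not_lt.1 hc).trans h1) h2) ((not_lt.1 hr).trans h2)) h1
  -- Here the value is `max U L`, and both grow with `i`: move towards row `0`.
  have bottom : ∀ i j, i < G.n → j < G.n → G.C i j < G.U i j → G.R i j < G.L i j →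
      β ≤ G.val i j := by
    intro i
    induction i with
    | zero => exact fun j _ hj _ _ => (hborder j hj).2.2.1
    | succ i ih =>
      intro j hi hj h h'
      by_cases hc : G.C i j < G.U i j
      · by_cases hr : G.R i j < G.L i j
        · refine (ih j (by omega) hj hc hr).trans ?_
          have h1 : G.U i j ≤ G.val (i + 1) j :=
            (hG.U_row (by omega)).trans
              (le_max_of_le_left (le_max_of_le_left (le_max_left _ _)))
          have h2 : G.L i j ≤ G.val (i + 1) j :=
            (hG.L_row (by omega)).trans (le_max_of_le_left (le_max_right _ _))
          exact max_le (max_le (max_le h1 (hr.le.trans h2)) h2) (hc.le.trans h1)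
        · exact (hBcol i j hi hj hr h').2
      · exact (hA.col i j hi hj hc h).2
  intro i j hi hj
  by_cases hc : G.C i j < G.U i j <;> by_cases hr : G.R i j < G.L i j
  · exact bottom i j hi hj hc hr
  · exact left (G.n - (j + 1)) i j hi (by omega) hc hr
  · exact right j i hi hj hc hr
  · exact top (G.n - (i + 1)) i j (by omega) hj hc hr

end Grid

end Doap

namespace Doap

/-! ### Tree metrics and shortcuts -/

/-- A metric (distances of different points may vanish) with the four-point condition. -/
structure FourPoint {V : Type*} (d : V → V → ℝ) : Prop where
  self : ∀ x, d x x = 0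
  symm : ∀ x y, d x y = d y x
  nonneg : ∀ x y, 0 ≤ d x y
  four : ∀ x y z t, d x y + d z t ≤ max (d x z + d y t) (d x t + d y z)

/-- The distance of `x` and `y` after the addition of a shortcut `(u, v)` of weight `c`. -/
noncomputable def augDist {V : Type*} (d : V → V → ℝ) (u v : V) (c : ℝ) (x y : V) : ℝ :=
  min (d x y) (min (d x u + c + d v y) (d x v + c + d u y))

theorem augDist_le_iff {V : Type*} {d : V → V → ℝ} {u v x y : V} {c r : ℝ} :
    augDist d u v c x y ≤ r ↔ d x y ≤ r ∨ d x u + c + d v y ≤ r ∨ d x v + c + d u y ≤ r := by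
  simp [augDist]

/-- The doubled position of `v` on the path from `a` to `b`. -/
def position {V : Type*} (d : V → V → ℝ) (a b v : V) : ℝ := d a v - d b v + d a b

/-- The doubled distance of `v` from the path from `a` to `b`. -/
def height {V : Type*} (d : V → V → ℝ) (a b v : V) : ℝ := d a v + d b v - d a b

namespace FourPoint

variable {V : Type*} {d : V → V → ℝ} (hd : FourPoint d)
include hd

theorem triangle (x y z : V) : d x y ≤ d x z + d z y := by
  have := hd.four x y z z
  rw [hd.self, add_zero, hd.symm y z, max_self] at this
  exact this

variable {a b : V}

theorem height_nonneg (v : V) : 0 ≤ height d a b v := by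
  have := hd.triangle a b v
  rw [hd.symm v b] at this
  rw [height]; linarith

omit hd in
theorem two_dist_left (v : V) : 2 * d a v = position d a b v + height d a b v := by
  rw [position, height]; ring

omit hd in
theorem two_dist_right (v : V) :
    2 * d b v = 2 * d a b - position d a b v + height d a b v := by
  rw [position, height]; ring

/-- The four-point condition for `x`, `y`, `a`, `b`; its two alternatives are the two signs of the
difference of positions. -/
theorem two_dist_le (x y : V) :
    2 * d x y ≤ height d a b x + height d a b y + |position d a b x - position d a b y| := by
  have h := hd.four x y a b
  rw [hd.symm x a, hd.symm x b, hd.symm y a, hd.symm y b] at h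
  have h1 := le_abs_self (position d a b x - position d a b y)
  have h2 := neg_abs_le (position d a b x - position d a b y)
  rcases le_max_iff.1 h with h | h <;> simp only [position, height] at * <;> linarith

/-- Strictness matters: two vertices with the same position may hang in a common branch and be
closer than their heights suggest. For different positions, the alternative of the four-point
condition that would allow this contradicts the order of the positions. -/
theorem two_dist_eq_of_lt {x y : V} (hxy : position d a b x < position d a b y) :
    2 * d x y = height d a b x + height d a b y + (position d a b y - position d a b x) := by
  apply le_antisymm
  · have := hd.two_dist_le (a := a) (b := b) x y
    rwa [abs_sub_comm, abs_of_pos (sub_pos.2 hxy)] at this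
  · have h := hd.four b x a y
    rw [hd.symm b a, hd.symm x a] at h
    rcases le_max_iff.1 h with h | h <;> simp only [position, height] at * <;> linarith

/-- The substitute for the exact formula when two positions coincide. -/
theorem height_sub_le (x y : V) : height d a b x - height d a b y ≤ 2 * d x y := by
  have h1 := hd.triangle a x y
  have h2 := hd.triangle b x y
  rw [hd.symm y x] at h1 h2
  rw [height, height]; linarith

variable (hab : ∀ x y, d x y ≤ d a b)
include hab

-- Here and in `height_le'` the maximality of `d a b` enters: no branch is longer than the part of
-- the path on either side of its foot.
omit hd in
theorem height_le (v : V) : height d a b v ≤ position d a b v := by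
  have := hab b v
  rw [position, height]; linarith

omit hd in
theorem height_le' (v : V) : height d a b v ≤ 2 * d a b - position d a b v := by
  have := hab a v
  rw [position, height]; linarith

variable {u v : V} {c r : ℝ} (hc : 0 ≤ c) (huv : position d a b u ≤ position d a b v)
  (hr : ∀ x y, augDist d u v c x y ≤ r)
include hc huv hr

-- Using the shortcut backwards, from `v` to `u`, is no better than the direct path, because `u`
-- does not lie to the right of `v`.
omit hab in
theorem aug_ends : 2 * d a b ≤ 2 * r ∨
    2 * d a b + (height d a b u + 2 * c + height d a b v + position d a b u - position d a b v) ≤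
      2 * r := by
  have hu := two_dist_left (d := d) (a := a) (b := b) u
  have hv := two_dist_left (d := d) (a := a) (b := b) v
  have hu' := two_dist_right (d := d) (a := a) (b := b) u
  have hv' := two_dist_right (d := d) (a := a) (b := b) v
  have nu := hd.height_nonneg (a := a) (b := b) u
  have nv := hd.height_nonneg (a := a) (b := b) v
  have h := augDist_le_iff.1 (hr a b)
  rw [hd.symm v b, hd.symm u b] at h
  rcases h with h | h | h
  · left; linarith
  · right; linarith
  · left; linarith

/-- If `x` does not lie before `v`, then its height is at most the distance of its position from
`b`, and the estimate for the ends suffices. Otherwise `d x v` is given by the exact formula, and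
the backward route through the shortcut is at least as long as one of the two alternatives, apart
from the case that `x` and `u` have the same position. -/
theorem aug_left (x : V) : height d a b x + position d a b x ≤ 2 * r ∨
    height d a b x + (height d a b u + 2 * c + height d a b v + position d a b u +
      position d a b v - position d a b x) ≤ 2 * r := by
  have hu := two_dist_left (d := d) (a := a) (b := b) u
  have hv := two_dist_left (d := d) (a := a) (b := b) v
  have hx := two_dist_left (d := d) (a := a) (b := b) x
  have nu := hd.height_nonneg (a := a) (b := b) u
  have nv := hd.height_nonneg (a := a) (b := b) v
  have hx' := height_le' hab x
  have hends := hd.aug_ends hc huv hr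
  rcases le_or_gt (position d a b v) (position d a b x) with hs | hs
  · rcases hends with h | h
    · left; linarith
    · right; linarith
  · rcases augDist_le_iff.1 (hr a x) with h | h | h
    · left; linarith
    · right
      have := hd.two_dist_eq_of_lt hs
      rw [hd.symm x v] at this
      linarith
    · rcases lt_trichotomy (position d a b x) (position d a b u) with hp | hp | hp
      · right
        have := hd.two_dist_eq_of_lt hp
        rw [hd.symm x u] at this
        linarith
      -- Now `x` and `u` may share a branch, so only their heights bound `d u x`. The average of
      -- this estimate and the one for the ends still gives the claim.
      · have h1 := hd.height_sub_le (a := a) (b := b) x u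
        rw [hd.symm x u] at h1
        rcases hends with h' | h'
        · left; linarith
        · left; linarith
      · right
        have := hd.two_dist_eq_of_lt hp
        linarith

/-- Reflection: exchanging `a` with `b` and `u` with `v` keeps heights and replaces a position by
its distance from the other end. -/
theorem aug_right (x : V) : height d a b x + (2 * d a b - position d a b x) ≤ 2 * r ∨
    height d a b x + (2 * d a b + (height d a b u + 2 * c + height d a b v - position d a b u -
      position d a b v + position d a b x)) ≤ 2 * r := by
  have hp : ∀ y, position d b a y = 2 * d a b - position d a b y := by
    intro y; rw [position, position, hd.symm b a]; ring
  have hh : ∀ y, height d b a y = height d a b y := by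
    intro y; rw [height, height, hd.symm b a]; ring
  have := hd.aug_left (a := b) (b := a) (u := v) (v := u) (c := c) (r := r)
    (fun x y => by rw [hd.symm b a]; exact hab x y) hc (by rw [hp, hp]; linarith)
    (fun x y => by
      have := hr x y
      rw [augDist] at this ⊢
      rwa [min_comm (d x v + c + d u y)]) x
  simp only [hp, hh] at this
  rcases this with h | h
  · left; linarith
  · right; linarith

/-- If `x` reaches one end directly within the bound, its height is at most the other part of that
route. If both ends need the detour, the two detours sum to at least `2 * height + 2 * d a b`, and
`d a b` is at least the height. This handles pairs in `aug_cycle` whose order on the line is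
reversed. -/
theorem aug_height (x : V) : 2 * height d a b x ≤ 2 * r := by
  have h1 := height_le hab x
  have h2 := height_le' hab x
  have nu := hd.height_nonneg (a := a) (b := b) u
  have nv := hd.height_nonneg (a := a) (b := b) v
  rcases hd.aug_left hab hc huv hr x with h | h
  · linarith
  · rcases hd.aug_right hab hc huv hr x with h' | h' <;> linarith

/-- For `x` outside the open interval from `u` to `v`, the height of `x` is at most its position, so
`a` may take the role of `x`; likewise `b` for `y`. Strictly inside, all distances are given by the
exact formula. -/
theorem aug_cycle (x y : V) : height d a b x + height d a b y +
      (position d a b y - position d a b x) ≤ 2 * r ∨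
    height d a b x + height d a b y + ((height d a b u + 2 * c + height d a b v -
      position d a b u + position d a b v) - (position d a b y - position d a b x)) ≤ 2 * r := by
  rcases le_or_gt (position d a b y) (position d a b x) with hxy | hxy
  · have h1 := hd.aug_height hab hc huv hr x
    have h2 := hd.aug_height hab hc huv hr y
    left; linarith
  rcases le_or_gt (position d a b x) (position d a b u) with hxu | hxu
  · have h1 := height_le hab x
    rcases hd.aug_left hab hc huv hr y with h | h
    · left; linarith
    · right; linarith
  rcases le_or_gt (position d a b v) (position d a b y) with hvy | hvy
  · have h1 := height_le' hab y
    rcases hd.aug_right hab hc huv hr x with h | h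
    · left; linarith
    · right; linarith
  have e1 := hd.two_dist_eq_of_lt hxy
  have e2 := hd.two_dist_eq_of_lt hxu
  have e3 := hd.two_dist_eq_of_lt hvy
  have e4 := hd.two_dist_eq_of_lt (hxy.trans hvy)
  have e5 := hd.two_dist_eq_of_lt (hxu.trans hxy)
  have nu := hd.height_nonneg (a := a) (b := b) u
  have nv := hd.height_nonneg (a := a) (b := b) v
  have h := augDist_le_iff.1 (hr x y)
  rw [hd.symm x u, hd.symm v y] at h
  rcases h with h | h | h
  · left; linarith
  · right; linarith
  · left; linarith

end FourPoint

end Doap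

namespace Doap

/-! ### Distances in a tree with a shortcut -/

namespace WeightedMultigraph

variable {V E : Type*} {G : WeightedMultigraph V E}

theorem IsWalk.append {x y z : V} {es es' : List E} (h : G.IsWalk x es y) (h' : G.IsWalk y es' z) :
    G.IsWalk x (es ++ es') z := by
  induction h with
  | nil => exact h'
  | cons he _ ih => exact .cons he (ih h')

theorem length_append (es es' : List E) : G.length (es ++ es') = G.length es + G.length es' := by
  simp [length]

end WeightedMultigraph

namespace Instance

variable {n : ℕ} (I : Instance n)

/-- The length of a walk in the tree. -/
def wlen : ∀ {x y : Fin n}, I.tree.Walk x y → ℝ≥0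
  | _, _, .nil => 0
  | x, _, .cons (v := w) h p => I.δ ⟨s(x, w), h⟩ + wlen p

theorem wlen_append {x y z : Fin n} (p : I.tree.Walk x y) (q : I.tree.Walk y z) :
    I.wlen (p.append q) = I.wlen p + I.wlen q := by
  induction p with
  | nil => simp [wlen]
  | cons h p ih => simp [wlen, ih, add_assoc]

theorem isWalk_of_walk (u v : Fin n) {x y : Fin n} (p : I.tree.Walk x y) :
    ∃ es, (I.augment u v).IsWalk x es y ∧ (I.augment u v).length es = I.wlen p := by
  induction p with
  | nil => exact ⟨[], .nil _, rfl⟩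
  | cons h p ih =>
    obtain ⟨es, hes, hl⟩ := ih
    refine ⟨some ⟨_, h⟩ :: es, .cons rfl hes, ?_⟩
    simp only [WeightedMultigraph.length, List.map_cons, List.sum_cons, wlen] at hl ⊢
    rw [hl]
    rfl

/-- `d` gives the distances of the vertices in `S`, which span a subtree. -/
structure TreeDistOn (S : Set (Fin n)) (d : Fin n → Fin n → ℝ) : Prop where
  self : ∀ x ∈ S, d x x = 0
  symm : ∀ x ∈ S, ∀ y ∈ S, d x y = d y x
  nonneg : ∀ x ∈ S, ∀ y ∈ S, 0 ≤ d x y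
  four : ∀ x ∈ S, ∀ y ∈ S, ∀ z ∈ S, ∀ t ∈ S, d x y + d z t ≤ max (d x z + d y t) (d x t + d y z)
  walk : ∀ x ∈ S, ∀ y ∈ S, ∃ p : I.tree.Walk x y, (∀ z ∈ p.support, z ∈ S) ∧ (I.wlen p : ℝ) = d x y
  edge : ∀ x ∈ S, ∀ y ∈ S, ∀ h : I.tree.Adj x y, d x y = I.δ ⟨s(x, y), h⟩

variable {I}

theorem treeDistOn_singleton (x : Fin n) {d : Fin n → Fin n → ℝ} (h : d x x = 0) :
    I.TreeDistOn {x} d where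
  self := by rintro _ rfl; exact h
  symm := by rintro _ rfl _ rfl; rfl
  nonneg := by rintro _ rfl _ rfl; exact h.ge
  four := by rintro _ rfl _ rfl _ rfl _ rfl; simp [h]
  walk := by
    rintro _ rfl _ rfl
    exact ⟨.nil, by simp, by simp [wlen, h]⟩
  edge := by rintro _ rfl _ rfl h; exact absurd h (I.tree.loopless.irrefl _)

/-- Two edges from `v` into the connected set `S` would close a cycle: the two resulting paths from
`v` to `q` agree, hence so do their second vertices. -/
theorem TreeDistOn.eq_of_adj {S : Set (Fin n)} {d : Fin n → Fin n → ℝ} (hd : I.TreeDistOn S d)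
    {p q v : Fin n} (hp : p ∈ S) (hq : q ∈ S) (hv : v ∉ S) (hpv : I.tree.Adj p v)
    (hqv : I.tree.Adj q v) : p = q := by
  obtain ⟨w, hw, -⟩ := hd.walk p hp q hq
  have hsupp : ∀ z ∈ w.toPath.1.support, z ∈ S := fun z hz =>
    hw z (w.support_toPath_subset_support hz)
  have hP : (SimpleGraph.Walk.cons hpv.symm w.toPath.1).IsPath :=
    w.toPath.2.cons fun h => hv (hsupp v h)
  have hQ : (SimpleGraph.Walk.cons hqv.symm .nil).IsPath := by
    simp [SimpleGraph.Walk.cons_isPath_iff, hqv.ne']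
  have := (I.isTree.isAcyclic.subsingleton_path v q).elim ⟨_, hP⟩ ⟨_, hQ⟩
  have h2 := congrArg (fun r : I.tree.Path v q => r.1.snd) this
  simpa using h2

/-- The new vertex `v` is a leaf at `p`. If it occurs once among the four points, replacing it by
`p` lowers all three sums by the same edge weight; if it occurs more often, the triangle inequality
or a trivial identity suffices. The uniqueness of the edge into `S` gives the distances of adjacent
vertices. -/
theorem TreeDistOn.insert {S : Set (Fin n)} {d d' : Fin n → Fin n → ℝ} (hd : I.TreeDistOn S d)
    {p v : Fin n} (hp : p ∈ S) (hv : v ∉ S) (hpv : I.tree.Adj p v)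
    (hS : ∀ x ∈ S, ∀ y ∈ S, d' x y = d x y) (hself : d' v v = 0)
    (hxv : ∀ x ∈ S, d' x v = d x p + I.δ ⟨s(p, v), hpv⟩) (hvx : ∀ x ∈ S, d' v x = d' x v) :
    I.TreeDistOn (insert v S) d' := by
  have hδ : (0 : ℝ) ≤ I.δ ⟨s(p, v), hpv⟩ := NNReal.coe_nonneg _
  have hvx' : ∀ x ∈ S, d' v x = d x p + I.δ ⟨s(p, v), hpv⟩ := fun x hx => by
    rw [hvx x hx, hxv x hx]
  have tri : ∀ x ∈ S, ∀ y ∈ S, d x y ≤ d x p + d y p := fun x hx y hy => by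
    have := hd.four x hx y hy p hp p hp
    rwa [hd.self p hp, add_zero, max_self] at this
  have hwalk : ∀ x ∈ S, ∃ q : I.tree.Walk x v, (∀ z ∈ q.support, z ∈ Insert.insert v S) ∧
      (I.wlen q : ℝ) = d' x v := by
    intro x hx
    obtain ⟨w, hw, hl⟩ := hd.walk x hx p hp
    refine ⟨w.append (.cons hpv .nil), fun z hz => ?_, ?_⟩
    · rw [SimpleGraph.Walk.mem_support_append_iff] at hz
      rcases hz with hz | hz
      · exact Or.inr (hw z hz)
      · simp only [SimpleGraph.Walk.support_cons, SimpleGraph.Walk.support_nil, List.mem_cons,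
          List.not_mem_nil, or_false] at hz
        rcases hz with rfl | rfl
        · exact Or.inr hp
        · exact Or.inl rfl
    · rw [wlen_append, hxv x hx, NNReal.coe_add, hl]
      simp [wlen]
  have hwalk' : ∀ x ∈ S, ∃ q : I.tree.Walk v x, (∀ z ∈ q.support, z ∈ Insert.insert v S) ∧
      (I.wlen q : ℝ) = d' v x := by
    intro x hx
    obtain ⟨w, hw, hl⟩ := hd.walk p hp x hx
    refine ⟨.cons hpv.symm w, fun z hz => ?_, ?_⟩
    · rw [SimpleGraph.Walk.support_cons, List.mem_cons] at hz
      exact hz.imp id (hw z)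
    · rw [hvx' x hx, wlen, NNReal.coe_add, hl, hd.symm p hp x hx, add_comm]
      congr 3
      simp [Sym2.eq_swap]
  refine ⟨?_, ?_, ?_, ?_, ?_, ?_⟩
  · rintro x (rfl | hx)
    · exact hself
    · rw [hS x hx x hx, hd.self x hx]
  · rintro x (rfl | hx) y (rfl | hy)
    · rfl
    · exact hvx y hy
    · exact (hvx x hx).symm
    · rw [hS x hx y hy, hS y hy x hx, hd.symm x hx y hy]
  · rintro x (rfl | hx) y (rfl | hy)
    · exact hself.ge
    · rw [hvx' y hy]; exact add_nonneg (hd.nonneg y hy p hp) hδ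
    · rw [hxv x hx]; exact add_nonneg (hd.nonneg x hx p hp) hδ
    · rw [hS x hx y hy]; exact hd.nonneg x hx y hy
  · have four3 : ∀ x ∈ S, ∀ y ∈ S, ∀ z ∈ S,
        d x y + d z p ≤ max (d x z + d y p) (d x p + d y z) := fun x hx y hy z hz =>
      hd.four x hx y hy z hz p hp
    rintro x (hx | hx) y (hy | hy) z (hz | hz) t (ht | ht) <;> try simp only [hx, hy, hz, ht]
    · simp
    · simp
    · exact le_max_of_le_left (by rw [hvx z hz]; linarith)
    · rw [hself, hS z hz t ht, hvx' z hz, hvx' t ht]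
      have := tri z hz t ht
      exact le_max_of_le_left (by linarith)
    · exact le_max_of_le_left (by rw [hvx y hy]; linarith)
    · exact le_max_of_le_right (by rw [hvx y hy]; linarith)
    · exact le_max_of_le_left (by rw [hvx y hy, hvx z hz]; linarith)
    · rw [hvx' y hy, hS z hz t ht, hvx' z hz, hvx' t ht, hS y hy z hz, hS y hy t ht]
      have := hd.four p hp y hy z hz t ht
      rw [hd.symm p hp y hy, hd.symm p hp z hz, hd.symm p hp t ht] at this
      rcases le_max_iff.1 this with h | h
      · exact le_max_of_le_left (by linarith)
      · exact le_max_of_le_right (by linarith)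
    · exact le_max_left _ _
    · exact le_max_left _ _
    · exact le_max_of_le_right (by rw [hvx z hz])
    · rw [hxv x hx, hS z hz t ht, hvx' t ht, hvx' z hz, hS x hx z hz, hS x hx t ht]
      have := hd.four x hx p hp z hz t ht
      rw [hd.symm p hp z hz, hd.symm p hp t ht] at this
      rcases le_max_iff.1 this with h | h
      · exact le_max_of_le_left (by linarith)
      · exact le_max_of_le_right (by linarith)
    · rw [hself, hS x hx y hy, hxv x hx, hxv y hy]
      have := tri x hx y hy
      exact le_max_of_le_left (by linarith)
    · rw [hvx' t ht, hS x hx y hy, hxv x hx, hxv y hy, hS x hx t ht, hS y hy t ht]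
      have := hd.four x hx y hy p hp t ht
      rw [hd.symm p hp t ht] at this
      rcases le_max_iff.1 this with h | h
      · exact le_max_of_le_left (by linarith)
      · exact le_max_of_le_right (by linarith)
    · rw [hxv z hz, hS x hx y hy, hxv x hx, hxv y hy, hS x hx z hz, hS y hy z hz]
      rcases le_max_iff.1 (four3 x hx y hy z hz) with h | h
      · exact le_max_of_le_left (by linarith)
      · exact le_max_of_le_right (by linarith)
    · rw [hS x hx y hy, hS z hz t ht, hS x hx z hz, hS y hy t ht, hS x hx t ht, hS y hy z hz]
      exact hd.four x hx y hy z hz t ht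
  · rintro x (rfl | hx) y (rfl | hy)
    · exact ⟨.nil, by simp, by simp [wlen, hself]⟩
    · exact hwalk' y hy
    · exact hwalk x hx
    · obtain ⟨w, hw, hl⟩ := hd.walk x hx y hy
      exact ⟨w, fun z hz => Or.inr (hw z hz), by rw [hl, hS x hx y hy]⟩
  · rintro x (rfl | hx) y (rfl | hy) h
    · exact absurd h (I.tree.loopless.irrefl _)
    · obtain rfl := hd.eq_of_adj hp hy hv hpv h.symm
      rw [hvx' p hp, hd.self p hp, zero_add]
      congr 2
      simp [Sym2.eq_swap]
    · obtain rfl := hd.eq_of_adj hp hx hv hpv h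
      rw [hxv p hp, hd.self p hp, zero_add]
    · rw [hS x hx y hy]; exact hd.edge x hx y hy h

theorem TreeDistOn.fourPoint {d : Fin n → Fin n → ℝ} (hd : I.TreeDistOn Set.univ d) :
    FourPoint d where
  self x := hd.self x trivial
  symm x y := hd.symm x trivial y trivial
  nonneg x y := hd.nonneg x trivial y trivial
  four x y z t := hd.four x trivial y trivial z trivial t trivial

/-- Along any edge, the distance to `y` drops by at most the weight of the edge: for tree edges by
the triangle inequality, and for the shortcut because crossing it twice is never useful. Summing up
along the walk gives the bound. -/
theorem TreeDistOn.augDist_le_length {d : Fin n → Fin n → ℝ} (hd : I.TreeDistOn Set.univ d)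
    {u v x y : Fin n} {es : List (Option I.tree.edgeSet)} (h : (I.augment u v).IsWalk x es y) :
    augDist d u v (I.c u v) x y ≤ (I.augment u v).length es := by
  have hf := hd.fourPoint
  have hc : (0 : ℝ) ≤ I.c u v := NNReal.coe_nonneg _
  induction h with
  | nil x =>
    refine (min_le_left _ _).trans ?_
    simp [hf.self, WeightedMultigraph.length]
  | @cons x w y e es he _ ih =>
    have hlen : ((I.augment u v).length (e :: es) : ℝ) =
        (I.augment u v).weight e + (I.augment u v).length es := by
      simp [WeightedMultigraph.length]
    rw [hlen, ← sub_le_iff_le_add']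
    refine le_trans ?_ ih
    rw [sub_le_iff_le_add', augDist_le_iff]
    rcases e with _ | ⟨e, he'⟩
    · have hw : (((I.augment u v).weight none : ℝ≥0) : ℝ) = I.c u v := rfl
      have hends : s(u, v) = s(x, w) := he
      rw [hw]
      have h1 := hf.nonneg u v
      rcases Sym2.eq_iff.1 hends with ⟨rfl, rfl⟩ | ⟨rfl, rfl⟩
      · rw [hf.self u, augDist, hf.self v, add_comm (I.c u v : ℝ)]
        rcases min_choice (d v y) (min (d v u + (I.c u v : ℝ) + d v y) (0 + I.c u v + d u y))
          with h | h
        · right; left; rw [h]; linarith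
        · rw [h]
          rcases min_choice (d v u + (I.c u v : ℝ) + d v y) (0 + I.c u v + d u y) with h' | h'
          · right; left; rw [h', hf.symm v u]; linarith
          · left; rw [h']; linarith
      · rw [hf.self v, augDist, hf.self u, add_comm (I.c u v : ℝ)]
        rcases min_choice (d u y) (min (0 + (I.c u v : ℝ) + d v y) (d u v + I.c u v + d u y))
          with h | h
        · right; right; rw [h]; linarith
        · rw [h]
          rcases min_choice (0 + (I.c u v : ℝ) + d v y) (d u v + I.c u v + d u y) with h' | h'
          · left; rw [h']; linarith
          · right; right; rw [h']; linarith
    · have hends : e = s(x, w) := he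
      subst hends
      have hw : (((I.augment u v).weight (some ⟨s(x, w), he'⟩) : ℝ≥0) : ℝ) = d x w :=
        (hd.edge x trivial w trivial he').symm
      rw [hw, augDist]
      have t1 := hf.triangle x y w
      have t2 := hf.triangle x u w
      have t3 := hf.triangle x v w
      rcases min_choice (d w y)
        (min (d w u + (I.c u v : ℝ) + d v y) (d w v + I.c u v + d u y)) with h | h
      · left; rw [h]; exact t1
      · rw [h]
        rcases min_choice (d w u + (I.c u v : ℝ) + d v y) (d w v + I.c u v + d u y) with h' | h'
        · right; left; rw [h']; linarith
        · right; right; rw [h']; linarith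

theorem TreeDistOn.exists_isWalk {d : Fin n → Fin n → ℝ} (hd : I.TreeDistOn Set.univ d)
    (u v x y : Fin n) : ∃ es, (I.augment u v).IsWalk x es y ∧
      ((I.augment u v).length es : ℝ) = augDist d u v (I.c u v) x y := by
  have tree : ∀ x y, ∃ es, (I.augment u v).IsWalk x es y ∧
      ((I.augment u v).length es : ℝ) = d x y := by
    intro x y
    obtain ⟨p, -, hp⟩ := hd.walk x trivial y trivial
    obtain ⟨es, hes, hl⟩ := I.isWalk_of_walk u v p
    exact ⟨es, hes, by rw [hl, hp]⟩
  have hnone : (I.augment u v).length [none] = I.c u v := by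
    simp [WeightedMultigraph.length, augment]
  rw [augDist]
  rcases min_choice (d x y) (min (d x u + (I.c u v : ℝ) + d v y) (d x v + I.c u v + d u y))
    with h | h
  · rw [h]; exact tree x y
  · rw [h]
    rcases min_choice (d x u + (I.c u v : ℝ) + d v y) (d x v + I.c u v + d u y) with h' | h'
    · rw [h']
      obtain ⟨es, hes, hl⟩ := tree x u
      obtain ⟨es', hes', hl'⟩ := tree v y
      have hmid : (I.augment u v).IsWalk u [none] v := .cons rfl (.nil v)
      refine ⟨_, (hes.append hmid).append hes', ?_⟩
      rw [WeightedMultigraph.length_append, WeightedMultigraph.length_append, hnone]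
      push_cast
      rw [hl, hl']
    · rw [h']
      obtain ⟨es, hes, hl⟩ := tree x v
      obtain ⟨es', hes', hl'⟩ := tree u y
      have hmid : (I.augment u v).IsWalk v [none] u := .cons Sym2.eq_swap (.nil u)
      refine ⟨_, (hes.append hmid).append hes', ?_⟩
      rw [WeightedMultigraph.length_append, WeightedMultigraph.length_append, hnone]
      push_cast
      rw [hl, hl']

theorem TreeDistOn.dist_eq {d : Fin n → Fin n → ℝ} (hd : I.TreeDistOn Set.univ d)
    (u v x y : Fin n) :
    (I.augment u v).dist x y = ENNReal.ofReal (augDist d u v (I.c u v) x y) := by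
  apply le_antisymm
  · obtain ⟨es, hes, hl⟩ := hd.exists_isWalk u v x y
    refine (iInf₂_le es hes).trans ?_
    rw [← hl, ENNReal.ofReal_coe_nnreal]
  · refine le_iInf₂ fun es hes => ?_
    rw [← ENNReal.ofReal_coe_nnreal]
    exact ENNReal.ofReal_le_ofReal (hd.augDist_le_length hes)

theorem TreeDistOn.diam_le {d : Fin n → Fin n → ℝ} (hd : I.TreeDistOn Set.univ d)
    {u v : Fin n} {r : ℝ} (h : ∀ x y, augDist d u v (I.c u v) x y ≤ r) :
    (I.augment u v).diam ≤ ENNReal.ofReal r :=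
  iSup₂_le fun x y => (hd.dist_eq u v x y).le.trans (ENNReal.ofReal_le_ofReal (h x y))

theorem TreeDistOn.augDist_le_diam {d : Fin n → Fin n → ℝ} (hd : I.TreeDistOn Set.univ d)
    {u v : Fin n} : ∃ r : ℝ, 0 ≤ r ∧ (I.augment u v).diam = ENNReal.ofReal r ∧
      ∀ x y, augDist d u v (I.c u v) x y ≤ r := by
  have hle : ∀ x y, (I.augment u v).dist x y ≤ (I.augment u v).diam := fun x y =>
    le_iSup₂ (f := fun x y => (I.augment u v).dist x y) x y
  have hfin : (I.augment u v).diam ≠ ⊤ := by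
    -- The sum of all distances is a crude bound that only serves to show finiteness.
    have : (I.augment u v).diam ≤ ENNReal.ofReal (∑ x, ∑ y, d x y) := by
      refine hd.diam_le fun x y => (min_le_left _ _).trans ?_
      refine (Finset.single_le_sum (f := fun y => d x y)
        (fun y _ => hd.fourPoint.nonneg x y) (Finset.mem_univ y)).trans ?_
      exact Finset.single_le_sum (f := fun x => ∑ y, d x y)
        (fun x _ => Finset.sum_nonneg fun y _ => hd.fourPoint.nonneg x y) (Finset.mem_univ x)
    exact ne_top_of_le_ne_top ENNReal.ofReal_ne_top this
  refine ⟨(I.augment u v).diam.toReal, ENNReal.toReal_nonneg, (ENNReal.ofReal_toReal hfin).symm,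
    fun x y => ?_⟩
  have := hle x y
  rw [hd.dist_eq] at this
  exact (ENNReal.ofReal_le_iff_le_toReal hfin).1 this

end Instance

end Doap

namespace Doap

/-! ### The values of grid cells and the diameters of augmented trees -/

theorem FourPoint.augDist_comm {V : Type*} {d : V → V → ℝ} (hd : FourPoint d) (u v : V) (c : ℝ)
    (x y : V) : augDist d u v c x y = augDist d u v c y x := by
  rw [augDist, augDist, hd.symm x y, hd.symm x u, hd.symm x v, hd.symm u y, hd.symm v y,
    min_comm (d u x + c + d y v)]
  congr 2 <;> ring

theorem augDist_swap {V : Type*} (d : V → V → ℝ) (u v : V) (c : ℝ) (x y : V) :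
    augDist d u v c x y = augDist d v u c x y := by
  rw [augDist, augDist, min_comm (d x u + c + d v y)]

/-- `G` is the grid of the points `o 0, …, o (n - 1)` of a tree with the diametral pair `(a, b)`, and
its table gives the doubled weights `c` of the shortcuts, closed along the rows. Weights that are
not less than the diameter may be missing. -/
structure Represents {V : Type*} (G : Grid) (d : V → V → ℝ) (a b : V) (c : V → V → ℝ)
    (o : ℕ → V) : Prop where
  D_eq : G.D = 2 * d a b
  x_eq : ∀ i < G.n, G.x i = position d a b (o i)
  h_eq : ∀ i < G.n, G.h i = height d a b (o i)
  surj : ∀ v, ∃ i < G.n, o i = v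
  T_le : ∀ i j, i < G.n → j < G.n → i ≠ j → G.T i j ≤ 2 * c (o i) (o j) + G.h i + G.h j
  T_le' : ∀ i j, i < G.n → j < G.n → i ≠ j → G.T i j ≤ 2 * c (o j) (o i) + G.h i + G.h j
  le_T : ∀ i j, i < G.n → j < G.n → G.D ≤ G.T i j ∨ ∃ k < G.n, k ≠ i ∧
    min (2 * c (o i) (o k)) (2 * c (o k) (o i)) + G.h i + G.h k + |G.x j - G.x k| ≤ G.T i j

/-- The value of the shortcut from the `i`-th to the `j`-th point as a connection for the cell
`(I, J)`. -/
noncomputable def Grid.shortcut {V : Type*} (G : Grid) (c : V → V → ℝ) (o : ℕ → V) (I J i j : ℕ) :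
    ℝ :=
  2 * c (o i) (o j) + min (G.h i + |G.x i - G.x I| + (G.h j + |G.x j - G.x J|))
    (G.h j + |G.x j - G.x I| + (G.h i + |G.x i - G.x J|))

namespace Represents

variable {V : Type*} {G : Grid} {d : V → V → ℝ} {a b : V} {c : V → V → ℝ} {o : ℕ → V}
  (hR : Represents G d a b c o) (hd : FourPoint d) (hab : ∀ x y, d x y ≤ d a b)
include hR hd hab

/-- The entry `E i j` is at most the real weight of the connection, and all four parts of the value
grow with `E i j`; so the estimates for the augmented tree bound them one by one. -/
theorem val_le_aux {i j : ℕ} (hi : i < G.n) (hj : j < G.n) (hij : G.x i ≤ G.x j) {w r : ℝ}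
    (hw : 0 ≤ w) (hr0 : 0 ≤ r) (hT : G.T i j ≤ 2 * w + G.h i + G.h j)
    (hr : ∀ x y, augDist d (o i) (o j) w x y ≤ r) : G.val i j ≤ 2 * r := by
  have hE := (G.E_le_T i j).trans hT
  have huv : position d a b (o i) ≤ position d a b (o j) := by
    rwa [← hR.x_eq i hi, ← hR.x_eq j hj]
  have xi := hR.x_eq i hi
  have xj := hR.x_eq j hj
  have hhi := hR.h_eq i hi
  have hhj := hR.h_eq j hj
  have hD := hR.D_eq
  refine max_le (max_le (max_le ?_ ?_) ?_) ?_
  · rw [Grid.U, min_le_iff]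
    exact (hd.aug_ends hw huv hr).imp (fun h => by linarith) (fun h => by linarith)
  · refine runMax_le (by linarith) fun k hk => min_le_iff.2 ?_
    have hx := hR.x_eq k hk
    have hh := hR.h_eq k hk
    exact (hd.aug_right hab hw huv hr (o k)).imp (fun h => by linarith) (fun h => by linarith)
  · refine runMax_le (by linarith) fun k hk => min_le_iff.2 ?_
    have hx := hR.x_eq k hk
    have hh := hR.h_eq k hk
    exact (hd.aug_left hab hw huv hr (o k)).imp (fun h => by linarith) (fun h => by linarith)
  · refine runMax_le (by linarith) fun k hk => runMax_le (by linarith) fun l hl => ?_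
    have hx := hR.x_eq k hk
    have hh := hR.h_eq k hk
    have hx' := hR.x_eq l hl
    have hh' := hR.h_eq l hl
    rw [Grid.arc, ← le_sub_iff_add_le', min_le_iff]
    exact (hd.aug_cycle hab hw huv hr (o k) (o l)).imp (fun h => by linarith)
      (fun h => by linarith)

/-- For every shortcut there is a grid cell with a value not greater than twice the diameter. -/
theorem exists_val_le (hc : ∀ x y, 0 ≤ c x y) {u v : V} (huv : u ≠ v) {r : ℝ} (hr0 : 0 ≤ r)
    (hr : ∀ x y, augDist d u v (c u v) x y ≤ r) :
    ∃ i j, i < G.n ∧ j < G.n ∧ G.val i j ≤ 2 * r := by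
  obtain ⟨i, hi, rfl⟩ := hR.surj u
  obtain ⟨j, hj, rfl⟩ := hR.surj v
  have hij : i ≠ j := fun h => huv (by rw [h])
  rcases le_total (G.x i) (G.x j) with h | h
  · exact ⟨i, j, hi, hj, hR.val_le_aux hd hab hi hj h (hc _ _) hr0 (hR.T_le i j hi hj hij) hr⟩
  · refine ⟨j, i, hj, hi, hR.val_le_aux hd hab hj hi h (hc _ _) hr0
      (hR.T_le' j i hj hi hij.symm) fun x y => ?_⟩
    rw [augDist_swap]
    exact hr x y

omit hab in
/-- The shortcut that realizes the weight of a grid cell best makes twice the diameter at most the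
value of the cell. -/
theorem augDist_le (hG : G.Valid) {I J i j : ℕ} (hI : I < G.n) (hJ : J < G.n) (hi : i < G.n)
    (hj : j < G.n)
    (hij : ∀ k l, k < G.n → l < G.n → k ≠ l → G.shortcut c o I J i j ≤ G.shortcut c o I J k l)
    (x y : V) : 2 * augDist d (o i) (o j) (c (o i) (o j)) x y ≤ G.val I J := by
  -- A table entry may stem from either order of the two query arguments. Minimality among ordered
  -- pairs covers both, since `G.shortcut` allows either end to serve `I`.
  have hcost : ∀ k l, k < G.n → l < G.n → k ≠ l → G.shortcut c o I J i j ≤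
      min (2 * c (o k) (o l)) (2 * c (o l) (o k)) + G.h k + G.h l + |G.x J - G.x l| +
        |G.x I - G.x k| := by
    intro k l hk hl hkl
    have h1 := hij k l hk hl hkl
    have h2 := hij l k hl hk hkl.symm
    rw [abs_sub_comm (G.x J), abs_sub_comm (G.x I)]
    rcases min_choice (2 * c (o k) (o l)) (2 * c (o l) (o k)) with h | h
    · rw [h]
      refine h1.trans ?_
      have := min_le_left (G.h k + |G.x k - G.x I| + (G.h l + |G.x l - G.x J|))
        (G.h l + |G.x l - G.x I| + (G.h k + |G.x k - G.x J|))
      rw [Grid.shortcut]; linarith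
    · rw [h]
      refine h2.trans ?_
      have := min_le_right (G.h l + |G.x l - G.x I| + (G.h k + |G.x k - G.x J|))
        (G.h k + |G.x k - G.x I| + (G.h l + |G.x l - G.x J|))
      rw [Grid.shortcut]; linarith
  -- Each entry is at least `D` or stems from a true shortcut, and the walks along row and column
  -- are part of the cost minimized by `(i, j)`. The diagonal value `D` stands for the absence of a
  -- shortcut.
  have hE : min G.D (G.shortcut c o I J i j) ≤ G.E I J := by
    refine le_runMin ?_ fun k hk => ?_
    · rcases hR.le_T I J hI hJ with h | ⟨l, hl, hlI, h⟩
      · exact min_le_of_left_le h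
      · have := hcost I l hI hl hlI.symm
        rw [sub_self, abs_zero] at this
        exact min_le_of_right_le (by linarith)
    · rcases hR.le_T k J hk hJ with h | ⟨l, hl, hlk, h⟩
      · have := abs_nonneg (G.x I - G.x k)
        exact min_le_of_left_le (by linarith)
      · have := hcost k l hk hl hlk.symm
        exact min_le_of_right_le (by linarith)
  have key : ∀ k l, k < G.n → l < G.n → G.x k ≤ G.x l →
      2 * augDist d (o i) (o j) (c (o i) (o j)) (o k) (o l) ≤ G.val I J := by
    intro k l hk hl hkl
    set A := augDist d (o i) (o j) (c (o i) (o j)) (o k) (o l) with hA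
    have hdle : ∀ p q, p < G.n → q < G.n → 2 * d (o p) (o q) ≤
        G.h p + G.h q + |G.x p - G.x q| := by
      intro p q hp hq
      rw [hR.h_eq p hp, hR.h_eq q hq, hR.x_eq p hp, hR.x_eq q hq]
      exact hd.two_dist_le _ _
    have q1 : 2 * A ≤ G.h k + G.h l + (G.x l - G.x k) := by
      have h1 : A ≤ d (o k) (o l) := min_le_left _ _
      have h2 := hdle k l hk hl
      rw [abs_sub_comm, abs_of_nonneg (sub_nonneg.2 hkl)] at h2
      linarith
    have hk1 := hG.h_le k hk
    have hl1 := hG.h_le' l hl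
    have hk0 := hG.h_nonneg k hk
    have hl0 := hG.h_nonneg l hl
    -- If `E I J ≥ D`, the direct route already is at most `D`, by the bounds on the heights.
    -- Otherwise `E I J` pays for the shortcut together with the walks from `I` and `J` to its ends.
    have q2 : 2 * A ≤ G.h k + G.h l + |G.x k - G.x I| + G.E I J + |G.x l - G.x J| := by
      have a1 := abs_nonneg (G.x k - G.x I)
      have a2 := abs_nonneg (G.x l - G.x J)
      rcases min_le_iff.1 hE with h | h
      · linarith
      · have h1 : A ≤ d (o k) (o i) + c (o i) (o j) + d (o j) (o l) :=
          (min_le_right _ _).trans (min_le_left _ _)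
        have h2 : A ≤ d (o k) (o j) + c (o i) (o j) + d (o i) (o l) :=
          (min_le_right _ _).trans (min_le_right _ _)
        have d1 := hdle k i hk hi
        have d2 := hdle j l hj hl
        have d3 := hdle k j hk hj
        have d4 := hdle i l hi hl
        have t1 := abs_sub_le (G.x k) (G.x I) (G.x i)
        have t2 := abs_sub_le (G.x j) (G.x J) (G.x l)
        have t3 := abs_sub_le (G.x k) (G.x I) (G.x j)
        have t4 := abs_sub_le (G.x i) (G.x J) (G.x l)
        rw [abs_sub_comm (G.x I)] at t1 t3
        rw [abs_sub_comm (G.x J)] at t2 t4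
        have hs : G.shortcut c o I J i j = 2 * c (o i) (o j) +
            min (G.h i + |G.x i - G.x I| + (G.h j + |G.x j - G.x J|))
              (G.h j + |G.x j - G.x I| + (G.h i + |G.x i - G.x J|)) := rfl
        rcases min_choice (G.h i + |G.x i - G.x I| + (G.h j + |G.x j - G.x J|))
          (G.h j + |G.x j - G.x I| + (G.h i + |G.x i - G.x J|)) with hm | hm <;>
          rw [hm] at hs <;> linarith
    -- The sides of `I` and `J` on which `k` and `l` lie decide which of `L`, `U`, `C`, `R` bounds
    -- the distance. A point outside the cycle is replaced by an end of the line, which is at least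
    -- as far away because of the bounds on heights.
    rcases le_total (G.x k) (G.x I) with hkI | hkI <;> rcases le_total (G.x l) (G.x J) with hlJ | hlJ
    · rw [abs_of_nonpos (sub_nonpos.2 hkI), abs_of_nonpos (sub_nonpos.2 hlJ)] at q2
      refine le_trans ?_ (le_max_of_le_left (le_max_right _ _))
      rw [Grid.L]
      refine le_trans ?_ (le_runMax hl)
      refine le_min ?_ ?_ <;> linarith
    · rw [abs_of_nonpos (sub_nonpos.2 hkI), abs_of_nonneg (sub_nonneg.2 hlJ)] at q2
      refine le_trans ?_ (le_max_of_le_left (le_max_of_le_left (le_max_left _ _)))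
      refine le_min ?_ ?_ <;> linarith
    · rw [abs_of_nonneg (sub_nonneg.2 hkI), abs_of_nonpos (sub_nonpos.2 hlJ)] at q2
      refine le_trans ?_ (le_max_right _ _)
      refine le_trans ?_ (Grid.arc_le_cyc hk hl)
      rw [Grid.arc, ← sub_le_iff_le_add']
      refine le_min ?_ ?_ <;> linarith
    · rw [abs_of_nonneg (sub_nonneg.2 hkI), abs_of_nonneg (sub_nonneg.2 hlJ)] at q2
      refine le_trans ?_ (le_max_of_le_left (le_max_of_le_left (le_max_right _ _)))
      rw [Grid.R]
      refine le_trans ?_ (le_runMax hk)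
      refine le_min ?_ ?_ <;> linarith
  obtain ⟨k, hk, rfl⟩ := hR.surj x
  obtain ⟨l, hl, rfl⟩ := hR.surj y
  rcases le_total (G.x k) (G.x l) with h | h
  · exact key k l hk hl h
  · rw [hd.augDist_comm]
    exact key l k hl hk h

end Represents

end Doap

/-! ### Row-wise indices of square tables. -/

namespace Doap

attribute [simp] IExp.eval IExp.Fits RExp.eval RExp.Fits Test.Holds Test.Fits

theorem index_lt {n i j : ℕ} (hi : i < n) (hj : j < n) : i * n + j < n * n := by
  calc i * n + j < i * n + n := by omega
    _ = (i + 1) * n := by ring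
    _ ≤ n * n := Nat.mul_le_mul_right _ hi

theorem index_inj {n i j i' j' : ℕ} (hj : j < n) (hj' : j' < n) :
    i' * n + j' = i * n + j ↔ i' = i ∧ j' = j := by
  constructor
  · intro h
    have h1 := congrArg (· / n) h
    have h2 := congrArg (· % n) h
    simp only [mul_comm _ n, Nat.mul_add_div (by omega : 0 < n), Nat.div_eq_of_lt hj,
      Nat.div_eq_of_lt hj', Nat.mul_add_mod, Nat.mod_eq_of_lt hj, Nat.mod_eq_of_lt hj'] at h1 h2
    omega
  · rintro ⟨rfl, rfl⟩; rfl

theorem update_index {n i j i' j' : ℕ} (hj : j < n) (hj' : j' < n) (f : ℕ → ℝ) (x : ℝ) :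
    Function.update f (i * n + j) x (i' * n + j') =
      if i' = i ∧ j' = j then x else f (i' * n + j') := by
  simp only [Function.update_apply, index_inj hj hj']

/-! ### The evaluation of grid cells -/

/-- The working memory holds the grid. -/
structure Tables (G : Grid) (m : Mem 24) : Prop where
  x : ∀ i < G.n, m.real 3 i = G.x i
  h : ∀ i < G.n, m.real 4 i = G.h i
  T : ∀ i < G.n, ∀ j < G.n, m.real 5 (i * G.n + j) = G.T i j
  D : m.real 8 0 = G.D

/-- The working memory holds the prefix and suffix maxima of the grid. -/
structure Maxima (G : Grid) (m : Mem 24) : Prop where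
  pre : ∀ t ≤ G.n, m.real 6 t = runMax (fun l => G.h l + G.x l) t
  le_suf : ∀ t l, t ≤ l → l < G.n → G.h l - G.x l ≤ m.real 7 t
  suf : ∀ t < G.n, ∃ l, t ≤ l ∧ l < G.n ∧ m.real 7 t = G.h l - G.x l

theorem Tables.congr {G : Grid} {m m' : Mem 24} (h : Tables G m) (h3 : m'.real 3 = m.real 3)
    (h4 : m'.real 4 = m.real 4) (h5 : m'.real 5 = m.real 5) (h8 : m'.real 8 = m.real 8) :
    Tables G m' :=
  ⟨by rw [h3]; exact h.x, by rw [h4]; exact h.h, by rw [h5]; exact h.T, by rw [h8]; exact h.D⟩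

theorem Maxima.congr {G : Grid} {m m' : Mem 24} (h : Maxima G m) (h6 : m'.real 6 = m.real 6)
    (h7 : m'.real 7 = m.real 7) : Maxima G m' :=
  ⟨by rw [h6]; exact h.pre, by rw [h7]; exact h.le_suf, by rw [h7]; exact h.suf⟩

theorem Tables.frame {G : Grid} {m m' : Mem 24} {p : BProgram 24} (h : Tables G m)
    (hF : p.Frame m m') (h3 : p.wr 3 = false := by rfl) (h4 : p.wr 4 = false := by rfl)
    (h5 : p.wr 5 = false := by rfl) (h8 : p.wr 8 = false := by rfl) : Tables G m' :=
  h.congr (hF.2 3 h3) (hF.2 4 h4) (hF.2 5 h5) (hF.2 8 h8)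

theorem Maxima.frame {G : Grid} {m m' : Mem 24} {p : BProgram 24} (h : Maxima G m)
    (hF : p.Frame m m') (h6 : p.wr 6 = false := by rfl) (h7 : p.wr 7 = false := by rfl) :
    Maxima G m' :=
  h.congr (hF.2 6 h6) (hF.2 7 h7)

open BProgram

variable {X : Input} {W : ℕ} {G : Grid}

theorem evalWeight_spec (hn : G.n = X.n) (hW : X.n * X.n + X.n + 8 ≤ W) (hG : G.Valid)
    {m : Mem 24} (hT : Tables G m) {i j : ℕ} (hi : i < G.n) (hj : j < G.n)
    (hmi : m.int 17 0 = i) (hmj : m.int 18 0 = j) :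
    Ex X W evalWeight m (fun m' => m'.real 9 0 = G.E i j) := by
  have hij := index_lt hi hj
  rw [hn] at hij
  have h0 : 0 < W := by omega
  refine Ex.seq (Ex.setReal (by simpa) (by simp [hmi, hmj]; omega) ?_)
  refine Ex.forTo (v := 19) X.n (fun k m' => m'.real 9 0 =
    runMin (G.T i j) (fun k => G.T k j + |G.x i - G.x k|) k) le_rfl (by omega)
    (fun m => ⟨by simp; omega, by simp⟩) rfl ?_ ?_ ?_
  · simp [hmi, hmj, runMin, ← hn, hT.T i hi j hj]
  · intro k m' hk hI hv hF
    have hkn : k < G.n := by omega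
    have hkj := index_lt hkn hj
    rw [hn] at hkj
    have hT' : Tables G m' := (hT.congr (by simp) (by simp) (by simp) (by simp) :
      Tables G (m.setReal 9 _ _)).frame hF
    have hi' : m'.int 17 0 = i := by rw [hF.1 17 rfl]; simpa
    have hj' : m'.int 18 0 = j := by rw [hF.1 18 rfl]; simpa
    have e1 := hT'.T k hkn j hj
    rw [hn] at e1
    refine Ex.ite (by simp [hi', hv]; omega) (fun hb => ?_) (fun hb => ?_)
    · simp only [Test.Holds, IExp.eval, hi', hv] at hb
      refine Ex.minInto (by simpa) (by simp [hi', hj', hv]; omega) ?_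
      simp only [runMin]
      simp [hi', hj', hv, hI, e1, hT'.x k hkn, hT'.x i hi]
      rw [abs_of_nonpos (sub_nonpos.2 (hG.mono i k hb.le hkn)), neg_sub]
    · simp only [Test.Holds, IExp.eval, hi', hv, not_lt] at hb
      refine Ex.minInto (by simpa) (by simp [hi', hj', hv]; omega) ?_
      simp only [runMin]
      simp [hi', hj', hv, hI, e1, hT'.x k hkn, hT'.x i hi]
      rw [abs_of_nonneg (sub_nonneg.2 (hG.mono k i hb hi))]
  · intro m' hI _
    rw [hI, Grid.E, hn]

end Doap

/-! ### The parts of the value of a cell and the update of the best cell. -/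

namespace Doap

open BProgram

variable {X : Input} {W : ℕ} {G : Grid}

theorem evalLinear_spec (hn : G.n = X.n) (hW : X.n * X.n + X.n + 8 ≤ W)
    {m : Mem 24} (hT : Tables G m) {i j : ℕ} (hi : i < G.n) (hj : j < G.n)
    (hmi : m.int 17 0 = i) (hmj : m.int 18 0 = j) (hE : m.real 9 0 = G.E i j) :
    Ex X W evalLinear m (fun m' => m'.real 10 0 = G.U i j ∧ m'.real 11 0 = G.R i j ∧
      m'.real 12 0 = G.L i j) := by
  have h0 : 0 < W := by omega
  refine Ex.seq (Ex.setReal (by simpa) (by simpa) ?_)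
  refine Ex.seq (Ex.minInto (by simpa) (by simp [hmi, hmj]; omega) ?_)
  refine Ex.seq (Ex.setReal (by simpa) (by simp) ?_)
  refine Ex.seq (Ex.setReal (by simpa) (by simp) ?_)
  generalize hm₁ : Mem.setReal (k := 24) _ 12 _ _ = m₁
  have hT₁ : Tables G m₁ := hT.congr (by simp [← hm₁]) (by simp [← hm₁]) (by simp [← hm₁])
    (by simp [← hm₁])
  have hU : m₁.real 10 0 = G.U i j := by
    simp [← hm₁, hmi, hmj, hE, hT.D, hT.x i hi, hT.x j hj, Grid.U]
  have hm₁i : m₁.int 17 0 = i := by simpa [← hm₁]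
  have hm₁j : m₁.int 18 0 = j := by simpa [← hm₁]
  have hE₁ : m₁.real 9 0 = G.E i j := by simpa [← hm₁]
  refine Ex.forTo (v := 19) X.n (fun k m' => m'.real 11 0 =
      runMax (fun k => min (G.h k + (G.D - G.x k))
        (G.h k + (G.D + (G.E i j - G.x i - G.x j + G.x k)))) k ∧
      m'.real 12 0 = runMax (fun k => min (G.h k + G.x k)
        (G.h k + (G.E i j + G.x i + G.x j - G.x k))) k) le_rfl (by omega)
    (fun m => ⟨by simp; omega, by simp⟩) rfl ?_ ?_ ?_
  · simp [← hm₁, runMax]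
  · rintro k m' hk ⟨hR, hL⟩ hv hF
    have hkn : k < G.n := by omega
    have hT' : Tables G m' := hT₁.frame hF
    have hi' : m'.int 17 0 = i := by rw [hF.1 17 rfl]; simpa
    have hj' : m'.int 18 0 = j := by rw [hF.1 18 rfl]; simpa
    have hE' : m'.real 9 0 = G.E i j := by rw [hF.2 9 rfl]; simpa
    refine Ex.seq (Ex.setReal (by simpa) (by simp [hv]; omega) ?_)
    refine Ex.seq (Ex.minInto (by simpa) (by simp [hv, hi', hj']; omega) ?_)
    refine Ex.seq (Ex.maxInto (by simpa) (by simpa) ?_)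
    refine Ex.seq (Ex.setReal (by simpa) (by simp [hv]; omega) ?_)
    refine Ex.seq (Ex.minInto (by simpa) (by simp [hv, hi', hj']; omega) ?_)
    refine Ex.maxInto (by simpa) (by simpa) ?_
    simp only [runMax]
    simp [hi', hj', hv, hR, hL, hE', hT'.x k hkn, hT'.x i hi, hT'.x j hj, hT'.h k hkn, hT'.D]
  · rintro m' ⟨hR, hL⟩ hF
    refine ⟨?_, ?_, ?_⟩
    · rw [hF.2 10 rfl, hU]
    · rw [hR, Grid.R, hn]
    · rw [hL, Grid.L, hn]

/-- For fixed `k`, the minimum in `arc` switches sides when `2 * (x l - x k)` exceeds `w`. The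
points are sorted, so this happens at a threshold `t` that never moves back as `k` grows. The best
partner before `t` comes from the prefix maxima of `h + x`, the best one from `t` on from the suffix
maxima of `h - x`. The potential `2 * n - k - t` drops in every round. -/
theorem evalCycle_spec (hn : G.n = X.n) (hW : X.n * X.n + X.n + 8 ≤ W) (hG : G.Valid)
    {m : Mem 24} (hT : Tables G m) (hM : Maxima G m) {i j : ℕ} (hi : i < G.n) (hj : j < G.n)
    (hmi : m.int 17 0 = i) (hmj : m.int 18 0 = j) (hE : m.real 9 0 = G.E i j) :
    Ex X W evalCycle m (fun m' => m'.real 13 0 = G.C i j) := by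
  have h0 : 0 < W := by omega
  refine Ex.seq (Ex.setReal (by simpa) (by simp) ?_)
  refine Ex.seq (Ex.setReal (by simpa) (by simp [hmi, hmj]; omega) ?_)
  refine Ex.seq (Ex.setInt (by simpa) (by simpa) ?_)
  refine Ex.seq (Ex.setInt (by simpa) (by simpa) ?_)
  generalize hm₁ : Mem.setInt (k := 24) _ 20 _ _ = m₁
  have hT₁ : Tables G m₁ := hT.congr (by simp [← hm₁]) (by simp [← hm₁]) (by simp [← hm₁])
    (by simp [← hm₁])
  have hM₁ : Maxima G m₁ := hM.congr (by simp [← hm₁]) (by simp [← hm₁])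
  set w := G.E i j - G.x i + G.x j with hw
  have hw₁ : m₁.real 14 0 = w := by simp [← hm₁, hmi, hmj, hE, hT.x i hi, hT.x j hj, hw]
  -- The condition on the threshold is restricted to `k < n`, since after the last round there is no
  -- `k`-th point.
  refine Ex.loop (fun f m' => ∃ k t, k ≤ G.n ∧ t ≤ G.n ∧ f = 2 * G.n - k - t ∧
    m'.int 19 0 = k ∧ m'.int 20 0 = t ∧ 0 ≤ m'.real 13 0 ∧ m'.real 13 0 ≤ G.cyc w ∧
    (k < G.n → ∀ l < t, (G.x l - G.x k) + (G.x l - G.x k) ≤ w) ∧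
    ∀ k' < k, ∀ l < G.n, G.arc w k' l ≤ m'.real 13 0) (2 * X.n) le_rfl ?_ ?_ ?_
  · refine ⟨0, 0, by omega, by omega, by omega, by simp [← hm₁], by simp [← hm₁], by simp [← hm₁],
      ?_, by simp, by simp⟩
    simp only [← hm₁]
    simpa using (show 0 ≤ G.cyc w from runMax_nonneg _ _)
  · rintro f m' ⟨k, t, hk, ht, hf, hmk, hmt, hpos, hub, hptr, hlb⟩ hF
    refine ⟨by simp [hmk]; omega, fun hb => ?_⟩
    simp only [Test.Holds, IExp.eval, hmk, ← hn] at hb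
    have hT' : Tables G m' := hT₁.frame hF
    have hM' : Maxima G m' := hM₁.frame hF
    have hw' : m'.real 14 0 = w := by rw [hF.2 14 rfl]; simpa
    refine Ex.ite (by simp [hmk, hmt]; omega) (fun hb' => ?_) (fun hb' => ?_)
    · simp only [Test.Holds, IExp.eval, RExp.eval, hmk, hmt, ← hn] at hb'
      obtain ⟨htn, hle⟩ := hb'
      rw [hT'.x t htn, hT'.x k hb, hw'] at hle
      refine Ex.setInt (by simpa) (by simp [hmt]; omega) ?_
      refine ⟨2 * G.n - k - (t + 1), by omega, k, t + 1, hk, htn, rfl, by simpa, by simp [hmt],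
        by simpa, by simpa, fun _ l hl => ?_, by simpa⟩
      rcases Nat.lt_succ_iff_lt_or_eq.1 hl with hl | rfl
      · exact hptr hb l hl
      · exact hle
    · simp only [Test.Holds, IExp.eval, RExp.eval, hmk, hmt, ← hn, not_and, not_le] at hb'
      have hgt : ∀ l, t ≤ l → l < G.n → w < (G.x l - G.x k) + (G.x l - G.x k) := by
        intro l htl hl
        have h1 := hb' (by omega)
        rw [hT'.x t (by omega), hT'.x k hb, hw'] at h1
        have := hG.mono t l htl hl
        linarith
      set c₁ := max (m'.real 13 0)
        (G.h k - G.x k + runMax (fun l => G.h l + G.x l) t) with hc₁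
      have hc₁ub : c₁ ≤ G.cyc w := by
        refine max_le hub ?_
        have : runMax (fun l => G.h l + G.x l) t ≤ G.cyc w - (G.h k - G.x k) := by
          refine runMax_le ?_ fun l hl => ?_
          -- The base value `0` of the prefix maximum contributes only `h k - x k ≤ 0`, so it does
          -- no harm.
          · have h1 := hG.h_le k hb
            have h2 : 0 ≤ G.cyc w := runMax_nonneg _ _
            linarith
          · have h1 := hptr hb l hl
            have h2 := Grid.arc_le_cyc (G := G) (w := w) hb (by omega : l < G.n)
            rw [Grid.arc, min_eq_left (by linarith)] at h2
            linarith
        linarith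
      have hnext : ∀ m'' : Mem 24, m''.int 19 0 = k → m''.int 20 0 = t →
          m''.real 13 0 ≤ G.cyc w → c₁ ≤ m''.real 13 0 →
          (∀ l, t ≤ l → l < G.n → G.arc w k l ≤ m''.real 13 0) →
          Ex X W (assignI 19 (.add (iv 19) (.lit 1))) m'' (fun m' => ∃ f' < f, ∃ k t, k ≤ G.n ∧
            t ≤ G.n ∧ f' = 2 * G.n - k - t ∧ m'.int 19 0 = k ∧ m'.int 20 0 = t ∧
            0 ≤ m'.real 13 0 ∧ m'.real 13 0 ≤ G.cyc w ∧
            (k < G.n → ∀ l < t, (G.x l - G.x k) + (G.x l - G.x k) ≤ w) ∧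
            ∀ k' < k, ∀ l < G.n, G.arc w k' l ≤ m'.real 13 0) := by
        intro m'' hk'' ht'' hub'' hc'' hsuf
        refine Ex.setInt (by simpa) (by simp [hk'']; omega) ?_
        refine ⟨2 * G.n - (k + 1) - t, by omega, k + 1, t, hb, ht, rfl, by simp [hk''],
          by simpa, ?_, by simpa, fun hk1 l hl => ?_, fun k' hk' l hl => ?_⟩
        · simpa using hpos.trans ((le_max_left _ _).trans hc'')
        · have h1 := hptr hb l hl
          have h2 := hG.mono k (k + 1) (by omega) hk1
          linarith
        · simp only [Mem.setInt_real]
          rcases Nat.lt_succ_iff_lt_or_eq.1 hk' with hk' | rfl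
          · exact (hlb k' hk' l hl).trans ((le_max_left _ _).trans hc'')
          · by_cases hlt : l < t
            · refine le_trans ?_ ((le_max_right _ _).trans hc'')
              have h1 := le_runMax (f := fun l => G.h l + G.x l) hlt
              have h2 := min_le_left (G.x l - G.x k') (w - (G.x l - G.x k'))
              rw [Grid.arc]
              linarith
            · exact hsuf l (by omega) hl
      refine Ex.seq (Ex.maxInto (by simpa) (by simp [hmk, hmt]; omega) ?_)
      simp only [RExp.eval, IExp.eval, hmk, hmt, hT'.h k hb, hT'.x k hb, hM'.pre t ht, ← hc₁]
      refine Ex.seq (Ex.ite (by simp [hmt]; omega) (fun ht' => ?_) (fun ht' => ?_))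
      · simp only [Test.Holds, IExp.eval, Mem.setReal_int, hmt, ← hn] at ht'
        refine Ex.maxInto (by simpa) (by simp [hmk, hmt]; omega) ?_
        refine hnext _ (by simpa) (by simpa) ?_ ?_ ?_ <;>
          simp [hmk, hmt, hT'.h k hb, hT'.x k hb, hw']
        · refine ⟨hc₁ub, ?_⟩
          obtain ⟨l, htl, hl, he⟩ := hM'.suf t ht'
          have h1 := hgt l htl hl
          have h2 := Grid.arc_le_cyc (G := G) (w := w) hb hl
          rw [Grid.arc, min_eq_right (by linarith)] at h2
          rw [he]
          linarith
        · intro l htl hl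
          right
          have h1 := hM'.le_suf t l htl hl
          have h2 := min_le_right (G.x l - G.x k) (w - (G.x l - G.x k))
          rw [Grid.arc]
          linarith
      · simp only [Test.Holds, IExp.eval, Mem.setReal_int, hmt, ← hn] at ht'
        refine Ex.skip (hnext _ (by simpa) (by simpa) (by simpa) (by simp) ?_)
        intro l htl hl
        omega
  · rintro f m' ⟨k, t, hk, ht, hf, hmk, hmt, hpos, hub, hptr, hlb⟩ hb hF
    simp only [Test.Holds, IExp.eval, hmk, ← hn] at hb
    refine le_antisymm hub ?_
    exact runMax_le hpos fun k' hk' => runMax_le hpos fun l hl => hlb k' (by omega) l hl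

/-- The variables `5` and `6` give a grid cell with a value not greater than the variable `16`. -/
structure Best (G : Grid) (m : Mem 24) : Prop where
  lt : m.int 5 0 < G.n
  lt' : m.int 6 0 < G.n
  val_le : G.val (m.int 5 0) (m.int 6 0) ≤ m.real 16 0

theorem evalAt_spec (hn : G.n = X.n) (hW : X.n * X.n + X.n + 8 ≤ W) (hG : G.Valid)
    {m : Mem 24} (hT : Tables G m) (hM : Maxima G m) (hB : Best G m) {i j : ℕ} (hi : i < G.n)
    (hj : j < G.n) (hmi : m.int 17 0 = i) (hmj : m.int 18 0 = j) :
    Ex X W evalAt m (fun m' => m'.real 10 0 = G.U i j ∧ m'.real 11 0 = G.R i j ∧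
      m'.real 12 0 = G.L i j ∧ m'.real 13 0 = G.C i j ∧ Best G m' ∧ m'.real 16 0 ≤ m.real 16 0 ∧
      m'.real 16 0 ≤ G.val i j) := by
  have h0 : 0 < W := by omega
  refine Ex.seq ((evalWeight_spec hn hW hG hT hi hj hmi hmj).mono fun m₁ hF₁ hE => ?_)
  have hi₁ : m₁.int 17 0 = i := by rw [hF₁.1 17 rfl, hmi]
  have hj₁ : m₁.int 18 0 = j := by rw [hF₁.1 18 rfl, hmj]
  refine Ex.seq ((evalLinear_spec hn hW (hT.frame hF₁) hi hj hi₁ hj₁ hE).mono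
    fun m₂ hF₂ ⟨hU, hR, hL⟩ => ?_)
  have hi₂ : m₂.int 17 0 = i := by rw [hF₂.1 17 rfl, hi₁]
  have hj₂ : m₂.int 18 0 = j := by rw [hF₂.1 18 rfl, hj₁]
  have hE₂ : m₂.real 9 0 = G.E i j := by rw [hF₂.2 9 rfl, hE]
  refine Ex.seq ((evalCycle_spec hn hW hG ((hT.frame hF₁).frame hF₂) ((hM.frame hF₁).frame hF₂)
    hi hj hi₂ hj₂ hE₂).mono fun m₃ hF₃ hC => ?_)
  have hi₃ : m₃.int 17 0 = i := by rw [hF₃.1 17 rfl, hi₂]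
  have hj₃ : m₃.int 18 0 = j := by rw [hF₃.1 18 rfl, hj₂]
  have h5 : m₃.int 5 = m.int 5 := by rw [hF₃.1 5 rfl, hF₂.1 5 rfl, hF₁.1 5 rfl]
  have h6 : m₃.int 6 = m.int 6 := by rw [hF₃.1 6 rfl, hF₂.1 6 rfl, hF₁.1 6 rfl]
  have h16 : m₃.real 16 = m.real 16 := by rw [hF₃.2 16 rfl, hF₂.2 16 rfl, hF₁.2 16 rfl]
  have hU₃ : m₃.real 10 0 = G.U i j := by rw [hF₃.2 10 rfl, hU]
  have hR₃ : m₃.real 11 0 = G.R i j := by rw [hF₃.2 11 rfl, hR]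
  have hL₃ : m₃.real 12 0 = G.L i j := by rw [hF₃.2 12 rfl, hL]
  refine Ex.seq (Ex.setReal (by simpa) (by simpa) ?_)
  refine Ex.seq (Ex.maxInto (by simpa) (by simpa) ?_)
  refine Ex.seq (Ex.maxInto (by simpa) (by simpa) ?_)
  refine Ex.seq (Ex.maxInto (by simpa) (by simpa) ?_)
  generalize hm₄ : Mem.setReal (k := 24) _ 15 _ _ = m₄
  have hval : m₄.real 15 0 = G.val i j := by
    simp [← hm₄, hU₃, hR₃, hL₃, hC, Grid.val]
  have hU₄ : m₄.real 10 0 = G.U i j := by simpa [← hm₄]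
  have hR₄ : m₄.real 11 0 = G.R i j := by simpa [← hm₄]
  have hL₄ : m₄.real 12 0 = G.L i j := by simpa [← hm₄]
  have hC₄ : m₄.real 13 0 = G.C i j := by simpa [← hm₄]
  have h16' : m₄.real 16 0 = m.real 16 0 := by simp [← hm₄, h16]
  have h5' : m₄.int 5 0 = m.int 5 0 := by simp [← hm₄, h5]
  have h6' : m₄.int 6 0 = m.int 6 0 := by simp [← hm₄, h6]
  have h17' : m₄.int 17 0 = i := by simpa [← hm₄]
  have h18' : m₄.int 18 0 = j := by simpa [← hm₄]
  refine Ex.ite (by simpa) (fun hb => ?_) (fun hb => ?_)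
  · simp only [Test.Holds, RExp.eval, IExp.eval, hval, h16'] at hb
    refine Ex.seq (Ex.setReal (by simpa) (by simpa) ?_)
    refine Ex.seq (Ex.setInt (by simpa) (by simp [h17']; omega) ?_)
    refine Ex.setInt (by simpa) (by simp [h18']; omega) ?_
    refine ⟨by simpa, by simpa, by simpa, by simpa, ⟨?_, ?_, ?_⟩, ?_, ?_⟩ <;>
      simp [h17', h18', hval, hi, hj, hb]
  · simp only [Test.Holds, RExp.eval, IExp.eval, hval, h16', not_le] at hb
    refine Ex.skip ⟨hU₄, hR₄, hL₄, hC₄, ⟨?_, ?_, ?_⟩, ?_, ?_⟩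
    · rw [h5']; exact hB.lt
    · rw [h6']; exact hB.lt'
    · rw [h5', h6', h16']; exact hB.val_le
    · exact h16'.le
    · rw [h16']; exact hb.le

end Doap

/-! ### The search along the border and the staircases. -/

namespace Doap

open BProgram

variable {X : Input} {W : ℕ} {G : Grid}

/-- The working memory during the search. -/
structure Searching (G : Grid) (m : Mem 24) : Prop where
  tables : Tables G m
  maxima : Maxima G m
  best : Best G m

theorem Searching.setInt {m : Mem 24} (h : Searching G m) {a : Fin 24} (i x : ℕ) (h5 : 5 ≠ a)
    (h6 : 6 ≠ a) : Searching G (m.setInt a i x) :=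
  ⟨h.tables.congr rfl rfl rfl rfl, h.maxima.congr rfl rfl,
    ⟨by simpa [h5] using h.best.lt, by simpa [h6] using h.best.lt',
      by simpa [h5, h6] using h.best.val_le⟩⟩

theorem evalCell_spec (hn : G.n = X.n) (hW : X.n * X.n + X.n + 8 ≤ W) (hG : G.Valid)
    {m : Mem 24} (hS : Searching G m) {a b : IExp 24} {i j : ℕ} (hi : i < G.n) (hj : j < G.n)
    (ha : a.Fits X W m ∧ a.eval X m = i)
    (hb : b.Fits X W (m.setInt 17 0 i) ∧ b.eval X (m.setInt 17 0 i) = j) :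
    Ex X W (evalCell a b) m (fun m' => m'.real 10 0 = G.U i j ∧ m'.real 11 0 = G.R i j ∧
      m'.real 12 0 = G.L i j ∧ m'.real 13 0 = G.C i j ∧ Searching G m' ∧
      m'.real 16 0 ≤ m.real 16 0 ∧ m'.real 16 0 ≤ G.val i j) := by
  have h0 : 0 < W := by omega
  refine Ex.seq (Ex.setInt (by simpa) ha.1 ?_)
  rw [ha.2]
  simp only [IExp.eval]
  refine Ex.seq (Ex.setInt (by simpa) hb.1 ?_)
  simp only [IExp.eval, hb.2]
  have hS' := (hS.setInt (a := 17) 0 i (by decide) (by decide)).setInt (a := 18) 0 j (by decide)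
    (by decide)
  refine (evalAt_spec hn hW hG hS'.tables hS'.maxima hS'.best hi hj (by simp)
    (by simp)).mono fun m' hF h => ?_
  exact ⟨h.1, h.2.1, h.2.2.1, h.2.2.2.1, ⟨hS'.tables.frame hF, hS'.maxima.frame hF, h.2.2.2.2.1⟩,
    h.2.2.2.2.2.1, h.2.2.2.2.2.2⟩

theorem border_spec (hn : G.n = X.n) (hn0 : 0 < G.n) (hW : X.n * X.n + X.n + 8 ≤ W) (hG : G.Valid)
    (hD : 0 ≤ G.D) {m : Mem 24} (hT : Tables G m) (hM : Maxima G m) :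
    Ex X W border m (fun m' => Searching G m' ∧ ∀ t < G.n, m'.real 16 0 ≤ G.val t 0 ∧
      m'.real 16 0 ≤ G.val t (G.n - 1) ∧ m'.real 16 0 ≤ G.val 0 t ∧
      m'.real 16 0 ≤ G.val (G.n - 1) t) := by
  have h0 : 0 < W := by omega
  refine Ex.seq (Ex.setReal (by simpa) (by simpa) ?_)
  refine Ex.seq (Ex.setInt (by simpa) (by simpa) ?_)
  refine Ex.seq (Ex.setInt (by simpa) (by simpa) ?_)
  refine Ex.forTo (v := 23) X.n (fun k m' => Searching G m' ∧ ∀ t < k, m'.real 16 0 ≤ G.val t 0 ∧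
      m'.real 16 0 ≤ G.val t (G.n - 1) ∧ m'.real 16 0 ≤ G.val 0 t ∧
      m'.real 16 0 ≤ G.val (G.n - 1) t) le_rfl (by omega)
    (fun m => ⟨by simp; omega, by simp⟩) rfl ?_ ?_ ?_
  · refine ⟨⟨hT.congr (by simp) (by simp) (by simp) (by simp), hM.congr (by simp) (by simp),
      ⟨by simpa, by simpa, ?_⟩⟩, by simp⟩
    -- The search starts with cell `(0, 0)` and the number `D`, which need not be its value but is
    -- an upper bound for it.
    simpa [hT.D] using hG.val_le hD 0 0
  · rintro k m' hk ⟨hS, hI⟩ hv hF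
    have hkn : k < G.n := by omega
    have hlast : G.n - 1 < G.n := by omega
    refine Ex.seq ((evalCell_spec hn hW hG hS hkn hn0 (by simp [hv]; omega)
      (by simp; omega)).mono fun m₁ hF₁ h₁ => ?_)
    have hv₁ : m₁.int 23 0 = k := by rw [hF₁.1 23 rfl, hv]
    refine Ex.seq ((evalCell_spec hn hW hG h₁.2.2.2.2.1 hkn hlast (by simp [hv₁]; omega)
      (by simp [hn]; omega)).mono fun m₂ hF₂ h₂ => ?_)
    have hv₂ : m₂.int 23 0 = k := by rw [hF₂.1 23 rfl, hv₁]
    refine Ex.seq ((evalCell_spec hn hW hG h₂.2.2.2.2.1 hn0 hkn (by simp; omega)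
      (by simp [hv₂]; omega)).mono fun m₃ hF₃ h₃ => ?_)
    have hv₃ : m₃.int 23 0 = k := by rw [hF₃.1 23 rfl, hv₂]
    refine (evalCell_spec hn hW hG h₃.2.2.2.2.1 hlast hkn (by simp [hn]; omega)
      (by simp [hv₃]; omega)).mono fun m₄ hF₄ h₄ => ?_
    have b₁ := h₁.2.2.2.2.2
    have b₂ := h₂.2.2.2.2.2
    have b₃ := h₃.2.2.2.2.2
    have b₄ := h₄.2.2.2.2.2
    refine ⟨h₄.2.2.2.2.1.setInt _ _ (by decide) (by decide), fun t ht => ?_⟩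
    simp only [Mem.setInt_real]
    rcases Nat.lt_succ_iff_lt_or_eq.1 ht with ht | rfl
    · have := hI t ht
      refine ⟨?_, ?_, ?_, ?_⟩ <;> linarith
    · refine ⟨?_, ?_, ?_, ?_⟩ <;> linarith
  · rintro m' ⟨hS, hI⟩ _
    exact ⟨hS, hn ▸ hI⟩

/-- The relation `P` persists when `i` grows or `j` shrinks, so its boundary is a staircase.
Stepping in `j` where `P` holds and in `i` where it fails keeps `P` true to the left of the walker
in its row and false before the walker in its column. Thus a pair that differs in `P` consists of a
walker position and a neighbour with `i` or `j` lowered by one, and there are at most `2 * n`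
positions. -/
theorem walk_spec (hn : G.n = X.n) (hW : X.n * X.n + X.n + 8 ≤ W) (hG : G.Valid)
    {col : IExp 24 → IExp 24} {colN : ℕ → ℕ} {b : Test 24} {P : ℕ → ℕ → Prop}
    (hcolN : ∀ j < G.n, colN j < G.n)
    (hcol : ∀ (e : IExp 24) (m : Mem 24), e.Fits X W m → e.eval X m < G.n →
      (col e).Fits X W m ∧ (col e).eval X m = colN (e.eval X m))
    (hb : ∀ (m : Mem 24) i j, m.real 10 0 = G.U i (colN j) → m.real 11 0 = G.R i (colN j) →
      m.real 12 0 = G.L i (colN j) → m.real 13 0 = G.C i (colN j) →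
      b.Fits X W m ∧ (b.Holds X m ↔ P i j))
    (hP : ∀ i j, i + 1 < G.n → j < G.n → P i j → P (i + 1) j)
    (hP' : ∀ i j, i < G.n → j + 1 < G.n → P i (j + 1) → P i j)
    {m : Mem 24} (hS : Searching G m) :
    Ex X W (walk col b) m (fun m' => Searching G m' ∧ m'.real 16 0 ≤ m.real 16 0 ∧
      Grid.Crossed G.n P (fun i j => m'.real 16 0 ≤ G.val i (colN j))) := by
  have h0 : 0 < W := by omega
  have monoP : ∀ i i' j, i ≤ i' → i' < G.n → j < G.n → P i j → P i' j := by
    intro i i' j hii' hi' hj hp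
    induction i', hii' using Nat.le_induction with
    | base => exact hp
    | succ k hk ih => exact hP k j hi' hj (ih (by omega))
  have monoP' : ∀ i j j', j ≤ j' → j' < G.n → i < G.n → P i j' → P i j := by
    intro i j j' hjj' hj' hi hp
    induction j', hjj' using Nat.le_induction with
    | base => exact hp
    | succ k hk ih => exact ih (by omega) (hP' i k hi hj' hp)
  refine Ex.seq (Ex.setInt (by simpa) (by simpa) ?_)
  refine Ex.seq (Ex.setInt (by simpa) (by simpa) ?_)
  refine Ex.loop (fun f m' => ∃ i j, i ≤ G.n ∧ j ≤ G.n ∧ f = 2 * G.n - i - j ∧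
    m'.int 21 0 = i ∧ m'.int 22 0 = j ∧ Searching G m' ∧ m'.real 16 0 ≤ m.real 16 0 ∧
    (i < G.n → ∀ j' < j, P i j') ∧ (j < G.n → ∀ i' < i, ¬ P i' j) ∧
    (∀ i' j', i' < i → j' + 1 < G.n → P i' j' → ¬ P i' (j' + 1) →
      m'.real 16 0 ≤ G.val i' (colN j') ∧ m'.real 16 0 ≤ G.val i' (colN (j' + 1))) ∧
    (∀ i' j', i' + 1 < G.n → j' < j → ¬ P i' j' → P (i' + 1) j' →
      m'.real 16 0 ≤ G.val i' (colN j') ∧ m'.real 16 0 ≤ G.val (i' + 1) (colN j')))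
    (2 * G.n) (by simp [hn]) ?_ ?_ ?_
  · refine ⟨0, 0, by omega, by omega, by omega, by simp, by simp, ?_, by simp, by simp, by simp,
      by simp, by simp⟩
    exact (hS.setInt _ _ (by decide) (by decide)).setInt _ _ (by decide) (by decide)
  · rintro f m' ⟨i, j, hi, hj, hf, hmi, hmj, hS', hle, hb1, hc1, hd1, he1⟩ hF
    refine ⟨by simp [hmi, hmj]; omega, fun hh => ?_⟩
    simp only [Test.Holds, IExp.eval, hmi, hmj, ← hn] at hh
    obtain ⟨hin, hjn⟩ := hh
    have hfit : ∀ m : Mem 24, m.int 22 0 = j → (iv 22 : IExp 24).Fits X W m := by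
      intro m hm
      simp [hm]; omega
    have c₁ := hcol (iv 22) (m'.setInt 17 0 (i - 1)) (hfit _ (by simpa)) (by simpa [hmj])
    simp only [IExp.eval, ne_eq, Fin.reduceEq, not_false_eq_true, Mem.setInt_int_ne, hmj] at c₁
    -- In row `0` the truncated difference gives the current row again, which is a harmless
    -- repetition; the same applies to `j - 1` below.
    refine Ex.seq ((evalCell_spec hn hW hG hS' (i := i - 1) (j := colN j) (by omega) (hcolN j hjn)
      (by simp [hmi]; omega) c₁).mono fun m₁ hF₁ h₁ => ?_)
    have hi₁ : m₁.int 21 0 = i := by rw [hF₁.1 21 rfl, hmi]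
    have hj₁ : m₁.int 22 0 = j := by rw [hF₁.1 22 rfl, hmj]
    have c₂ := hcol (.sub (iv 22) (.lit 1)) (m₁.setInt 17 0 i)
      ⟨hfit _ (by simpa), by simp; omega⟩ (by simp [hj₁]; omega)
    simp only [IExp.eval, ne_eq, Fin.reduceEq, not_false_eq_true, Mem.setInt_int_ne, hj₁] at c₂
    refine Ex.seq ((evalCell_spec hn hW hG h₁.2.2.2.2.1 (i := i) (j := colN (j - 1)) hin
      (hcolN _ (by omega)) (by simp [hi₁]; omega) c₂).mono fun m₂ hF₂ h₂ => ?_)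
    have hi₂ : m₂.int 21 0 = i := by rw [hF₂.1 21 rfl, hi₁]
    have hj₂ : m₂.int 22 0 = j := by rw [hF₂.1 22 rfl, hj₁]
    have c₃ := hcol (iv 22) (m₂.setInt 17 0 i) (hfit _ (by simpa)) (by simpa [hj₂])
    simp only [IExp.eval, ne_eq, Fin.reduceEq, not_false_eq_true, Mem.setInt_int_ne, hj₂] at c₃
    -- The cell `(i, j)` itself comes last, so that the variables read by the test hold its four
    -- parts.
    refine Ex.seq ((evalCell_spec hn hW hG h₂.2.2.2.2.1 (i := i) (j := colN j) hin (hcolN j hjn)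
      (by simp [hi₂]; omega) c₃).mono fun m₃ hF₃ h₃ => ?_)
    have hi₃ : m₃.int 21 0 = i := by rw [hF₃.1 21 rfl, hi₂]
    have hj₃ : m₃.int 22 0 = j := by rw [hF₃.1 22 rfl, hj₂]
    obtain ⟨-, -, -, -, -, b₁, v₁⟩ := h₁
    obtain ⟨-, -, -, -, -, b₂, v₂⟩ := h₂
    obtain ⟨hU, hR, hL, hC, hS₃, b₃, v₃⟩ := h₃
    obtain ⟨hbf, hbP⟩ := hb m₃ i j hU hR hL hC
    have hbest : m₃.real 16 0 ≤ m'.real 16 0 := by linarith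
    have v₁' : m₃.real 16 0 ≤ G.val (i - 1) (colN j) := by linarith
    have v₂' : m₃.real 16 0 ≤ G.val i (colN (j - 1)) := by linarith
    have hd2 : ∀ i' j', i' < i → j' + 1 < G.n → P i' j' → ¬ P i' (j' + 1) →
        m₃.real 16 0 ≤ G.val i' (colN j') ∧ m₃.real 16 0 ≤ G.val i' (colN (j' + 1)) :=
      fun i' j' h1 h2 h3 h4 => (hd1 i' j' h1 h2 h3 h4).imp hbest.trans hbest.trans
    have he2 : ∀ i' j', i' + 1 < G.n → j' < j → ¬ P i' j' → P (i' + 1) j' →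
        m₃.real 16 0 ≤ G.val i' (colN j') ∧ m₃.real 16 0 ≤ G.val (i' + 1) (colN j') :=
      fun i' j' h1 h2 h3 h4 => (he1 i' j' h1 h2 h3 h4).imp hbest.trans hbest.trans
    refine Ex.ite hbf (fun hh => ?_) (fun hh => ?_)
    · rw [hbP] at hh
      refine Ex.setInt (by simpa) (by simp [hj₃]; omega) ?_
      refine ⟨2 * G.n - i - (j + 1), by omega, i, j + 1, hi, hjn, rfl, by simpa, by simp [hj₃],
        hS₃.setInt _ _ (by decide) (by decide), ?_, fun _ j' hj' => ?_, fun hj1 i' hi' hp => ?_,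
        hd2, fun i' j' h1 h2 h3 h4 => ?_⟩
      · simpa using hbest.trans hle
      · rcases Nat.lt_succ_iff_lt_or_eq.1 hj' with hj' | rfl
        · exact hb1 hin j' hj'
        · exact hh
      · exact hc1 hjn i' hi' (hP' i' j (by omega) hj1 hp)
      · simp only [Mem.setInt_real]
        rcases Nat.lt_succ_iff_lt_or_eq.1 h2 with h2 | rfl
        · exact he2 i' j' h1 h2 h3 h4
        -- By monotonicity, column `j` changes from false to true exactly once, and the walker
        -- stands on the first true cell.
        · have hlt : i' < i := by
            by_contra hge
            exact h3 (monoP i i' j' (by omega) (by omega) hjn hh)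
          have hge : i ≤ i' + 1 := by
            by_contra hlt'
            exact hc1 hjn (i' + 1) (by omega) h4
          obtain rfl : i = i' + 1 := by omega
          exact ⟨v₁', v₃⟩
    · rw [hbP] at hh
      refine Ex.setInt (by simpa) (by simp [hi₃]; omega) ?_
      refine ⟨2 * G.n - (i + 1) - j, by omega, i + 1, j, hin, hj, rfl, by simp [hi₃], by simpa,
        hS₃.setInt _ _ (by decide) (by decide), ?_, fun hi1 j' hj' => ?_, fun _ i' hi' => ?_,
        fun i' j' h1 h2 h3 h4 => ?_, he2⟩
      · simpa using hbest.trans hle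
      · exact hP i j' hi1 (by omega) (hb1 hin j' hj')
      · rcases Nat.lt_succ_iff_lt_or_eq.1 hi' with hi' | rfl
        · exact hc1 hjn i' hi'
        · exact hh
      · simp only [Mem.setInt_real]
        rcases Nat.lt_succ_iff_lt_or_eq.1 h1 with h1 | rfl
        · exact hd2 i' j' h1 h2 h3 h4
        · have hlt : j' < j := by
            by_contra hge
            exact hh (monoP' i' j j' (by omega) (by omega) hin h3)
          have hge : j ≤ j' + 1 := by
            by_contra hlt'
            exact h4 (hb1 hin (j' + 1) (by omega))
          obtain rfl : j = j' + 1 := by omega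
          exact ⟨v₂', v₃⟩
  · rintro f m' ⟨i, j, hi, hj, hf, hmi, hmj, hS', hle, hb1, hc1, hd1, he1⟩ hh hF
    simp only [Test.Holds, IExp.eval, hmi, hmj, ← hn, not_and_or, not_lt] at hh
    refine ⟨hS', hle, ⟨fun i' j' h1 h2 h3 h4 => ?_, fun i' j' h1 h2 h3 h4 => ?_⟩⟩
    -- Rows the walker never left have no crossing: it stopped at `j = n`, so `P` holds in all of
    -- row `i` and hence in all later rows. Columns are treated likewise.
    · by_cases hlt : i' < i
      · exact hd1 i' j' hlt h2 h3 h4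
      · have hj' : j = G.n := by omega
        exact absurd (monoP i i' (j' + 1) (by omega) h1 h2 (hb1 (by omega) (j' + 1) (by omega))) h4
    · by_cases hlt : j' < j
      · exact he1 i' j' h1 hlt h3 h4
      · have hi' : i = G.n := by omega
        exact absurd (monoP' (i' + 1) j j' (by omega) h2 h1 h4)
          (hc1 (by omega) (i' + 1) (by omega))

end Doap

namespace Doap

/-! ### Sorting by counting -/

/-- The order by `f`, and by the index in case of equality. -/
def SortLt (f : ℕ → ℝ) (u v : ℕ) : Prop := f u ≤ f v ∧ ¬ (f v ≤ f u ∧ ¬ u < v)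

open Classical in
/-- The number of elements of `{0, …, k - 1}` before `v`. -/
noncomputable def rank (f : ℕ → ℝ) (k v : ℕ) : ℕ := ((Finset.range k).filter (SortLt f · v)).card

open Classical in
theorem rank_succ (f : ℕ → ℝ) (k v : ℕ) :
    rank f (k + 1) v = rank f k v + if SortLt f k v then 1 else 0 := by
  rw [rank, Finset.range_add_one, Finset.filter_insert]
  split_ifs with h
  · rw [Finset.card_insert_of_notMem (by simp), rank]
  · rfl

theorem SortLt.irrefl (f : ℕ → ℝ) (u : ℕ) : ¬ SortLt f u u := by simp [SortLt]

theorem SortLt.trans {f : ℕ → ℝ} {u v w : ℕ} (h : SortLt f u v) (h' : SortLt f v w) :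
    SortLt f u w := by
  refine ⟨h.1.trans h'.1, fun hw => ?_⟩
  have h1 := h.2
  have h2 := h'.2
  simp only [not_and, not_not] at h1 h2
  have := h1 (h'.1.trans hw.1)
  have := h2 (hw.1.trans h.1)
  omega

theorem sortLt_or {f : ℕ → ℝ} {u v : ℕ} (h : u ≠ v) : SortLt f u v ∨ SortLt f v u := by
  simp only [SortLt, not_and, not_not]
  rcases lt_trichotomy (f u) (f v) with h1 | h1 | h1
  · exact Or.inl ⟨h1.le, fun h2 => absurd h2 (not_le.2 h1)⟩
  · rcases Nat.lt_or_gt_of_ne h with h2 | h2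
    · exact Or.inl ⟨h1.le, fun _ => h2⟩
    · exact Or.inr ⟨h1.ge, fun _ => h2⟩
  · exact Or.inr ⟨h1.le, fun h2 => absurd h2 (not_le.2 h1)⟩

theorem rank_le (f : ℕ → ℝ) (k v : ℕ) : rank f k v ≤ k := by
  classical
  exact (Finset.card_filter_le _ _).trans (Finset.card_range k).le

theorem rank_lt {f : ℕ → ℝ} {n v : ℕ} (hv : v < n) : rank f n v < n := by
  classical
  have : (Finset.range n).filter (SortLt f · v) ⊂ Finset.range n := by
    refine Finset.filter_ssubset.2 ⟨v, by simpa, SortLt.irrefl f v⟩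
  simpa [rank] using Finset.card_lt_card this

theorem rank_lt_rank {f : ℕ → ℝ} {n u v : ℕ} (hu : u < n) (h : SortLt f u v) :
    rank f n u < rank f n v := by
  classical
  refine Finset.card_lt_card (Finset.ssubset_iff_of_subset (fun w hw => ?_) |>.2 ⟨u, ?_, ?_⟩)
  · simp only [Finset.mem_filter] at hw ⊢
    exact ⟨hw.1, hw.2.trans h⟩
  · simpa using ⟨hu, h⟩
  · simp [SortLt.irrefl]

theorem rank_inj {f : ℕ → ℝ} {n u v : ℕ} (hu : u < n) (hv : v < n) (h : rank f n u = rank f n v) :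
    u = v := by
  by_contra hne
  rcases sortLt_or (f := f) hne with h1 | h1
  · exact (rank_lt_rank hu h1).ne h
  · exact (rank_lt_rank hv h1).ne' h

theorem exists_rank_eq (f : ℕ → ℝ) {n i : ℕ} (hi : i < n) : ∃ v < n, rank f n v = i := by
  have hinj : Function.Injective (fun v : Fin n => (⟨rank f n v, rank_lt v.2⟩ : Fin n)) := by
    intro u v h
    exact Fin.ext (rank_inj u.2 v.2 (by simpa using h))
  obtain ⟨v, hv⟩ := Finite.surjective_of_injective hinj ⟨i, hi⟩
  exact ⟨v, v.2, by simpa using congrArg Fin.val hv⟩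

/-- The ranks of `n` distinct indices under a strict total order are a permutation of `0, …, n - 1`;
its inverse sorts. -/
theorem exists_sorting (f : ℕ → ℝ) (n : ℕ) : ∃ o : ℕ → ℕ, (∀ i < n, o i < n ∧ rank f n (o i) = i) ∧
    (∀ v < n, o (rank f n v) = v) ∧ (∀ i j, i ≤ j → j < n → f (o i) ≤ f (o j)) := by
  choose! o ho using fun i (hi : i < n) => exists_rank_eq f hi
  refine ⟨o, ho, fun v hv => ?_, fun i j hij hj => ?_⟩
  · have h := rank_lt (f := f) hv
    exact rank_inj (ho _ h).1 hv (ho _ h).2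
  · by_contra hlt
    have h1 : SortLt f (o j) (o i) := ⟨(not_le.1 hlt).le, fun h => hlt h.1⟩
    have h2 := rank_lt_rank (ho j hj).1 h1
    rw [(ho j hj).2, (ho i (by omega)).2] at h2
    omega

open BProgram

variable {X : Input} {W : ℕ}

/-! ### The preparation of the grid -/

theorem diametral_spec (hn : 2 ≤ X.n) (hW : X.n * X.n + X.n + 8 ≤ W) {m : Mem 24} {d : ℕ → ℕ → ℝ}
    (hd : ∀ u < X.n, ∀ v < X.n, m.real 0 (u * X.n + v) = d u v) :
    Ex X W diametral m (fun m' => m'.int 3 0 < X.n ∧ m'.int 4 0 < X.n ∧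
      ∀ u < X.n, ∀ v < X.n, d u v ≤ d (m'.int 3 0) (m'.int 4 0)) := by
  have h0 : 0 < W := by omega
  refine Ex.seq (Ex.setInt (by simpa) (by simpa) ?_)
  refine Ex.seq (Ex.setInt (by simpa) (by simpa) ?_)
  refine Ex.forTo (v := 14) X.n (fun i m' => m'.int 3 0 < X.n ∧ m'.int 4 0 < X.n ∧
      ∀ u < i, ∀ v < X.n, d u v ≤ d (m'.int 3 0) (m'.int 4 0)) le_rfl (by omega)
    (fun m => ⟨by simp; omega, by simp⟩) rfl ?_ ?_ fun m' h _ => h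
  · refine ⟨?_, ?_, by simp⟩ <;> simp <;> omega
  · rintro i m₁ hi ⟨hA, hB, hI⟩ hv₁ hF₁
    refine Ex.forTo (v := 15) X.n (fun j m' => m'.int 3 0 < X.n ∧ m'.int 4 0 < X.n ∧
        (∀ u < i, ∀ v < X.n, d u v ≤ d (m'.int 3 0) (m'.int 4 0)) ∧
        ∀ v < j, d i v ≤ d (m'.int 3 0) (m'.int 4 0)) le_rfl (by omega)
      (fun m => ⟨by simp; omega, by simp⟩) rfl ?_ ?_ ?_
    · simpa using ⟨hA, hB, hI⟩
    · rintro j m₂ hj ⟨hA, hB, hI, hJ⟩ hv₂ hF₂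
      have hi₂ : m₂.int 14 0 = i := by rw [hF₂.1 14 rfl, hv₁]
      have hd₂ : ∀ u < X.n, ∀ v < X.n, m₂.real 0 (u * X.n + v) = d u v := by
        rw [hF₂.2 0 rfl, hF₁.2 0 rfl]; simpa
      have h1 := index_lt hi hj
      have h2 := index_lt hA hB
      refine Ex.ite (by simp [hi₂, hv₂]; omega) (fun hb => Ex.skip ?_) (fun hb => ?_)
      · simp only [Test.Holds, RExp.eval, IExp.eval, hi₂, hv₂, hd₂ _ hi _ hj, hd₂ _ hA _ hB] at hb
        refine ⟨by simpa, by simpa, by simpa, fun v hv => ?_⟩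
        simp only [ne_eq, Fin.reduceEq, not_false_eq_true, Mem.setInt_int_ne]
        rcases Nat.lt_succ_iff_lt_or_eq.1 hv with hv | rfl
        · exact hJ v hv
        · exact hb
      · simp only [Test.Holds, RExp.eval, IExp.eval, hi₂, hv₂, hd₂ _ hi _ hj, hd₂ _ hA _ hB,
          not_le] at hb
        refine Ex.seq (Ex.setInt (by simpa) (by simp [hi₂]; omega) ?_)
        refine Ex.setInt (by simpa) (by simp [hv₂]; omega) ?_
        refine ⟨by simpa [hi₂], by simpa [hv₂], ?_, ?_⟩ <;> simp [hi₂, hv₂]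
        · exact fun u hu v hv => (hI u hu v hv).trans hb.le
        · intro v hv
          rcases hv.lt_or_eq with hv | rfl
          · exact (hJ v hv).trans hb.le
          · exact le_rfl
    · rintro m₂ ⟨hA, hB, hI, hJ⟩ _
      refine ⟨by simpa, by simpa, ?_⟩
      simp only [ne_eq, Fin.reduceEq, not_false_eq_true, Mem.setInt_int_ne]
      intro u hu
      rcases Nat.lt_succ_iff_lt_or_eq.1 hu with hu | rfl
      · exact hI u hu
      · exact hJ

theorem forall_lt_update {α : Type*} {f g : ℕ → α} {i : ℕ} {x : α} (h : ∀ v < i, f v = g v)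
    (hx : x = g i) : ∀ v ≤ i, Function.update f i x v = g v := by
  intro v hv
  rcases hv.lt_or_eq with hv | rfl
  · rw [Function.update_of_ne hv.ne, h v hv]
  · rw [Function.update_self, hx]

theorem coordinates_spec (hW : X.n * X.n + X.n + 8 ≤ W) {m : Mem 24} {d : ℕ → ℕ → ℝ}
    (hd : ∀ u < X.n, ∀ v < X.n, m.real 0 (u * X.n + v) = d u v) {a b : ℕ} (ha : m.int 3 0 = a)
    (hb : m.int 4 0 = b) (han : a < X.n) (hbn : b < X.n) :
    Ex X W coordinates m (fun m' => m'.real 8 0 = 2 * d a b ∧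
      (∀ v < X.n, m'.real 1 v = position d a b v) ∧ ∀ v < X.n, m'.real 2 v = height d a b v) := by
  have h0 : 0 < W := by omega
  have hab := index_lt han hbn
  refine Ex.seq (Ex.setReal (by simpa) (by simp [ha, hb]; omega) ?_)
  refine Ex.forTo (v := 14) X.n (fun i m' => (∀ v < i, m'.real 1 v = position d a b v) ∧
      ∀ v < i, m'.real 2 v = height d a b v) le_rfl (by omega)
    (fun m => ⟨by simp; omega, by simp⟩) rfl (by simp) ?_ ?_
  · rintro i m₁ hi ⟨h1, h2⟩ hv hF
    have ha₁ : m₁.int 3 0 = a := by rw [hF.1 3 rfl]; simpa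
    have hb₁ : m₁.int 4 0 = b := by rw [hF.1 4 rfl]; simpa
    have hd₁ : ∀ u < X.n, ∀ v < X.n, m₁.real 0 (u * X.n + v) = d u v := by
      rw [hF.2 0 rfl]; simpa
    have hai := index_lt han hi
    have hbi := index_lt hbn hi
    refine Ex.seq (Ex.setReal (by simp [hv]; omega) (by simp [hv, ha₁, hb₁]; omega) ?_)
    refine Ex.setReal (by simp [hv]; omega) (by simp [hv, ha₁, hb₁]; omega) ?_
    simp only [RExp.eval, IExp.eval, Mem.setReal_int, hv, ha₁, hb₁]
    constructor <;> simp <;> [refine forall_lt_update h1 ?_; refine forall_lt_update h2 ?_] <;>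
      simp [hd₁ a han b hbn, hd₁ a han i hi, hd₁ b hbn i hi, position, height]
  · rintro m₁ ⟨h1, h2⟩ hF
    refine ⟨?_, h1, h2⟩
    rw [hF.2 8 rfl]
    simp [ha, hb, hd a han b hbn, two_mul]

/-- Counting the predecessors of a vertex yields its place directly. Ties are broken by index, so
places are distinct and no entry is overwritten. -/
theorem sortVertices_spec (hW : X.n * X.n + X.n + 8 ≤ W) {m : Mem 24} {f g : ℕ → ℝ}
    (hf : ∀ v < X.n, m.real 1 v = f v) (hg : ∀ v < X.n, m.real 2 v = g v) :
    Ex X W sortVertices m (fun m' => ∀ v < X.n, m'.int 1 (rank f X.n v) = v ∧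
      m'.real 3 (rank f X.n v) = f v ∧ m'.real 4 (rank f X.n v) = g v) := by
  have h0 : 0 < W := by omega
  refine Ex.forTo (v := 14) X.n (fun i m' => ∀ v < i, m'.int 1 (rank f X.n v) = v ∧
      m'.real 3 (rank f X.n v) = f v ∧ m'.real 4 (rank f X.n v) = g v) le_rfl (by omega)
    (fun m => ⟨by simp; omega, by simp⟩) rfl (by simp) ?_ fun m' h _ => h
  intro i m₁ hi hI hv₁ hF₁
  have hf₁ : ∀ v < X.n, m₁.real 1 v = f v := by rw [hF₁.2 1 rfl]; exact hf
  have hg₁ : ∀ v < X.n, m₁.real 2 v = g v := by rw [hF₁.2 2 rfl]; exact hg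
  refine Ex.seq (Ex.setInt (by simpa) (by simpa) ?_)
  refine Ex.seq ?_
  refine Ex.forTo (v := 15) X.n (fun j m' => m'.int 16 0 = rank f j i) le_rfl (by omega)
      (fun m => ⟨by simp; omega, by simp⟩) rfl (by simp [rank]) ?_ ?_
  · intro j m₂ hj hJ hv₂ hF₂
    have hi₂ : m₂.int 14 0 = i := by rw [hF₂.1 14 rfl]; simpa
    have hf₂ : ∀ v < X.n, m₂.real 1 v = f v := by rw [hF₂.2 1 rfl]; exact hf₁
    have hle := rank_le f j i
    -- `SortLt` has its doubly negated form in order to match this test literally.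
    have htest : Test.Holds X m₂ (.and (.rle (.read 1 (iv 15)) (.read 1 (iv 14)))
        (.not (.and (.rle (.read 1 (iv 14)) (.read 1 (iv 15)))
          (.not (.ilt (iv 15) (iv 14)))))) ↔ SortLt f j i := by
      simp only [Test.Holds, RExp.eval, IExp.eval, hi₂, hv₂, hf₂ _ hi, hf₂ _ hj, SortLt]
    refine Ex.ite (by simp [hi₂, hv₂]; omega) (fun hb => ?_) (fun hb => Ex.skip ?_)
    · rw [htest] at hb
      refine Ex.setInt (by simpa) (by simp [hJ]; omega) ?_
      simp [hJ, rank_succ, hb]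
    · rw [htest] at hb
      simp [hJ, rank_succ, hb]
  · intro m₂ hJ hF₂
    have hi₂ : m₂.int 14 0 = i := by rw [hF₂.1 14 rfl]; simpa
    have hf₂ : ∀ v < X.n, m₂.real 1 v = f v := by rw [hF₂.2 1 rfl]; exact hf₁
    have hg₂ : ∀ v < X.n, m₂.real 2 v = g v := by rw [hF₂.2 2 rfl]; exact hg₁
    have hlt := rank_lt (f := f) hi
    have hI₂ : ∀ v < i, m₂.int 1 (rank f X.n v) = v ∧ m₂.real 3 (rank f X.n v) = f v ∧
        m₂.real 4 (rank f X.n v) = g v := by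
      rw [hF₂.1 1 rfl, hF₂.2 3 rfl, hF₂.2 4 rfl]
      simpa using hI
    refine Ex.seq (Ex.setInt (by simp [hJ]; omega) (by simp [hi₂]; omega) ?_)
    refine Ex.seq (Ex.setReal (by simp [hJ]; omega) (by simp [hi₂]; omega) ?_)
    refine Ex.setReal (by simp [hJ]; omega) (by simp [hi₂]; omega) ?_
    intro v hv
    simp [hJ, hi₂, hf₂ i hi, hg₂ i hi]
    rcases Nat.lt_succ_iff_lt_or_eq.1 hv with hv | rfl
    · have hne : rank f X.n v ≠ rank f X.n i := fun h =>
        hv.ne (rank_inj (by omega) hi h)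
      simpa [Function.update_of_ne hne] using hI₂ v hv
    · simp

end Doap

namespace Doap

/-! ### The table of the shortcut weights -/

/-- The first `k` entries of a row `y` are closed in increasing, and its last entries from `n - 1 - t`
on also in decreasing direction; `B` is the row to be closed. -/
def RowClosed (n : ℕ) (x B y : ℕ → ℝ) (k t : ℕ) : Prop :=
  ∀ j < k, y j ≤ B j ∧ (∃ l < n, B l + |x j - x l| ≤ y j) ∧
    (j + 1 < k → y (j + 1) ≤ y j + (x (j + 1) - x j)) ∧
    (n ≤ j + 1 + t → j + 1 < n → y j ≤ y (j + 1) + (x (j + 1) - x j))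

theorem RowClosed.congr {n k t : ℕ} {x B y y' : ℕ → ℝ} (h : RowClosed n x B y n t) (hk : k = n)
    (hy : ∀ j < n, y' j = y j) : RowClosed n x B y' k t := by
  subst hk
  intro j hj
  obtain ⟨h1, h2, h3, h4⟩ := h j hj
  refine ⟨by rwa [hy j hj], by rwa [hy j hj], fun hj1 => ?_, fun ht hj1 => ?_⟩
  · rw [hy j hj, hy _ hj1]; exact h3 hj1
  · rw [hy j hj, hy _ hj1]; exact h4 ht hj1

/-- The forward pass. If the new entry comes from its predecessor, it inherits the witness `l` by
the triangle inequality. -/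
theorem RowClosed.fill {n k : ℕ} {x B y y' : ℕ → ℝ} (h : RowClosed n x B y k 0) (hk : k < n)
    (hx : ∀ i j, i ≤ j → j < n → x i ≤ x j) (hy : ∀ j < k, y' j = y j)
    (hk' : y' k = if k = 0 then B k else min (B k) (y (k - 1) + (x k - x (k - 1)))) :
    RowClosed n x B y' (k + 1) 0 := by
  intro j hj
  refine ⟨?_, ?_, fun hj1 => ?_, fun h1 h2 => by omega⟩
  · rcases Nat.lt_succ_iff_lt_or_eq.1 hj with hj | rfl
    · rw [hy j hj]; exact (h j hj).1
    · rw [hk']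
      split_ifs with h0
      · exact le_rfl
      · exact min_le_left _ _
  · rcases Nat.lt_succ_iff_lt_or_eq.1 hj with hj | rfl
    · rw [hy j hj]; exact (h j hj).2.1
    · rw [hk']
      split_ifs with h0
      · exact ⟨j, hk, by simp⟩
      · rcases min_choice (B j) (y (j - 1) + (x j - x (j - 1))) with hm | hm
        · exact ⟨j, hk, by rw [hm]; simp⟩
        · obtain ⟨l, hl, hle⟩ := (h (j - 1) (by omega)).2.1
          refine ⟨l, hl, ?_⟩
          have h1 := abs_sub_le (x j) (x (j - 1)) (x l)
          rw [abs_of_nonneg (sub_nonneg.2 (hx (j - 1) j (by omega) hk))] at h1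
          rw [hm]; linarith
  · rcases Nat.lt_succ_iff_lt_or_eq.1 hj1 with hj2 | h2
    · rw [hy j (by omega), hy (j + 1) hj2]; exact (h j (by omega)).2.2.1 hj2
    · rw [hy j (by omega), h2, hk', if_neg (by omega)]
      refine (min_le_right _ _).trans ?_
      obtain rfl : j = k - 1 := by omega
      exact le_rfl

/-- The backward pass changes only entry `p`. The bounds of the forward pass survive: a lowered
entry stays below its left bound, and lowering it to `y (p + 1)` plus a nonnegative gap leaves room
for entry `p + 1`. -/
theorem RowClosed.back {n t p : ℕ} {x B y y' : ℕ → ℝ} (h : RowClosed n x B y n t)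
    (hp : p + t + 2 = n) (hx : ∀ i j, i ≤ j → j < n → x i ≤ x j)
    (hy : ∀ j < n, j ≠ p → y' j = y j)
    (hp' : y' p = min (y p) (y (p + 1) + (x (p + 1) - x p))) :
    RowClosed n x B y' n (t + 1) := by
  have hle : ∀ j < n, y' j ≤ y j := by
    intro j hj
    by_cases hjp : j = p
    · rw [hjp, hp']; exact min_le_left _ _
    · rw [hy j hj hjp]
  have hxp := hx p (p + 1) (by omega) (by omega)
  intro j hj
  obtain ⟨h1, h2, h3, h4⟩ := h j hj
  refine ⟨(hle j hj).trans h1, ?_, fun hj1 => ?_, fun ht hj1 => ?_⟩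
  · by_cases hjp : j = p
    · subst hjp
      rw [hp']
      rcases min_choice (y j) (y (j + 1) + (x (j + 1) - x j)) with hm | hm
      · rwa [hm]
      · obtain ⟨l, hl, hle⟩ := (h (j + 1) (by omega)).2.1
        refine ⟨l, hl, ?_⟩
        have h1 := abs_sub_le (x j) (x (j + 1)) (x l)
        rw [abs_sub_comm (x j) (x (j + 1)), abs_of_nonneg (sub_nonneg.2 hxp)] at h1
        rw [hm]; linarith
    · rwa [hy j hj hjp]
  · by_cases hjp : j = p
    · subst hjp
      rw [hy (j + 1) hj1 (by omega), hp']
      rcases min_choice (y j) (y (j + 1) + (x (j + 1) - x j)) with hm | hm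
      · rw [hm]; exact h3 hj1
      · rw [hm]; linarith
    · rw [hy j hj hjp]
      exact (hle _ hj1).trans (h3 hj1)
  · by_cases hjp : j = p
    · subst hjp
      rw [hy (j + 1) hj1 (by omega), hp']
      exact min_le_right _ _
    · rw [hy j hj hjp, hy (j + 1) hj1 (by omega)]
      exact h4 (by omega) hj1

/-- The doubled weight of the connection from the `i`-th to the `j`-th point by the shortcut of their
vertices, with the value `D` in the diagonal. -/
noncomputable def baseWeight (D : ℝ) (h : ℕ → ℝ) (q : ℕ → ℕ → ℝ) (i j : ℕ) : ℝ :=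
  if i = j then D else min (q i j + q i j + h i + h j) (q j i + q j i + h i + h j)

open BProgram

variable {X : Input} {W : ℕ}

theorem fillTable_spec (hW : X.n * X.n + X.n + 8 ≤ W) {m : Mem 24} {x h : ℕ → ℝ}
    {D : ℝ} {o : ℕ → ℕ} (hx : ∀ i < X.n, m.real 3 i = x i) (hh : ∀ i < X.n, m.real 4 i = h i)
    (hD : m.real 8 0 = D) (ho : ∀ i < X.n, m.int 1 i = o i) (hon : ∀ i < X.n, o i < X.n)
    (mono : ∀ i j, i ≤ j → j < X.n → x i ≤ x j) :
    Ex X W fillTable m (fun m' => ∀ i < X.n,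
      RowClosed X.n x (baseWeight D h (fun i j => X.query (o i) (o j)) i)
        (fun j => m'.real 5 (i * X.n + j)) X.n X.n) := by
  have h0 : 0 < W := by omega
  set B := baseWeight D h (fun i j => X.query (o i) (o j)) with hB
  refine Ex.forTo (v := 14) X.n (fun i m' => ∀ i' < i, RowClosed X.n x (B i')
        (fun j => m'.real 5 (i' * X.n + j)) X.n X.n) le_rfl (by omega)
    (fun m => ⟨by simp; omega, by simp⟩) rfl (by simp) ?_ fun m' h _ => h
  intro i m₁ hi hI hv₁ hF₁
  refine Ex.seq ?_
  refine Ex.forTo (v := 15) X.n (fun k m' => (∀ i' < i, RowClosed X.n x (B i')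
        (fun j => m'.real 5 (i' * X.n + j)) X.n X.n) ∧
      RowClosed X.n x (B i) (fun j => m'.real 5 (i * X.n + j)) k 0) le_rfl (by omega)
    (fun m => ⟨by simp; omega, by simp⟩) rfl ⟨by simpa using hI, fun j hj => by omega⟩ ?_ ?_
  · rintro k m₂ hk ⟨hI₂, hrow⟩ hv₂ hF₂
    have hi₂ : m₂.int 14 0 = i := by rw [hF₂.1 14 rfl]; simpa
    have hx₂ : ∀ i < X.n, m₂.real 3 i = x i := by rw [hF₂.2 3 rfl, hF₁.2 3 rfl]; simpa
    have hh₂ : ∀ i < X.n, m₂.real 4 i = h i := by rw [hF₂.2 4 rfl, hF₁.2 4 rfl]; simpa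
    have hD₂ : m₂.real 8 0 = D := by rw [hF₂.2 8 rfl, hF₁.2 8 rfl]; simpa
    have ho₂ : ∀ i < X.n, m₂.int 1 i = o i := by rw [hF₂.1 1 rfl, hF₁.1 1 rfl]; simpa
    have hik := index_lt hi hk
    have hoi := hon i hi
    have hok := hon k hk
    have base : Ex X W (.ite (.ieq (iv 14) (iv 15)) (.setReal 5 (ix (iv 14) (iv 15)) (rv 8))
            (.seq (.setReal 5 (ix (iv 14) (iv 15))
                (.add (.add (dq (iv 14) (iv 15)) (.read 4 (iv 14))) (.read 4 (iv 15))))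
              (minInto 5 (ix (iv 14) (iv 15))
                (.add (.add (dq (iv 15) (iv 14)) (.read 4 (iv 14))) (.read 4 (iv 15))))) :
            BProgram 24) m₂
        (fun m' => m'.real 5 = Function.update (m₂.real 5) (i * X.n + k) (B i k)) := by
      refine Ex.ite (by simp [hi₂, hv₂]; omega) (fun hb => ?_) (fun hb => ?_)
      · simp only [Test.Holds, IExp.eval, hi₂, hv₂] at hb
        refine Ex.setReal (by simp [hi₂, hv₂]; omega) (by simp; omega) ?_
        simp [hi₂, hv₂, hD₂, hB, baseWeight, hb]
      · simp only [Test.Holds, IExp.eval, hi₂, hv₂] at hb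
        refine Ex.seq (Ex.setReal (by simp [hi₂, hv₂]; omega)
          (by simp [hi₂, hv₂, ho₂ i hi, ho₂ k hk]; omega) ?_)
        refine Ex.minInto (by simp [hi₂, hv₂]; omega)
          (by simp [hi₂, hv₂, ho₂ i hi, ho₂ k hk]; omega) ?_
        simp [hi₂, hv₂, ho₂ i hi, ho₂ k hk, hh₂ i hi, hh₂ k hk, hB, baseWeight, hb]
    refine Ex.seq (base.mono fun m₃ hF₃ hm₃ => ?_)
    have hi₃ : m₃.int 14 0 = i := by rw [hF₃.1 14 rfl, hi₂]
    have hv₃ : m₃.int 15 0 = k := by rw [hF₃.1 15 rfl, hv₂]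
    have hx₃ : ∀ i < X.n, m₃.real 3 i = x i := by rw [hF₃.2 3 rfl]; exact hx₂
    have finish : ∀ (m' : Mem 24) z, m'.real 5 = Function.update (m₂.real 5) (i * X.n + k) z →
        z = (if k = 0 then B i k else
          min (B i k) (m₂.real 5 (i * X.n + (k - 1)) + (x k - x (k - 1)))) →
        (∀ i' < i, RowClosed X.n x (B i') (fun j => m'.real 5 (i' * X.n + j)) X.n X.n) ∧
        RowClosed X.n x (B i) (fun j => m'.real 5 (i * X.n + j)) (k + 1) 0 := by
      intro m' z hm' hz
      refine ⟨fun i' hi' => (hI₂ i' hi').congr rfl fun j hj => ?_, hrow.fill hk mono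
        (fun j hj => ?_) ?_⟩
      · rw [hm', update_index hk hj, if_neg (by omega)]
      · simp only [hm']
        rw [update_index hk (by omega), if_neg (by omega)]
      · simp only [hm', Function.update_self, hz]
    refine Ex.ite (by simp [hv₃]; omega) (fun hb => Ex.skip ?_) (fun hb => ?_)
    · simp only [Test.Holds, IExp.eval, hv₃] at hb
      exact finish _ (B i k) (by simpa using hm₃) (by rw [if_pos hb])
    · simp only [Test.Holds, IExp.eval, hv₃] at hb
      have e : m₃.real 5 (i * X.n + (k - 1)) = m₂.real 5 (i * X.n + (k - 1)) := by
        rw [hm₃, update_index hk (by omega), if_neg (by omega)]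
      refine Ex.minInto (by simp [hi₃, hv₃]; omega) (by simp [hi₃, hv₃]; omega) ?_
      refine finish _ (min (B i k) (m₂.real 5 (i * X.n + (k - 1)) + (x k - x (k - 1)))) ?_
        (by rw [if_neg hb])
      simp only [IExp.eval, RExp.eval, hi₃, hv₃, Mem.setInt_real, Mem.setReal_real, e,
        hx₃ k hk, hx₃ (k - 1) (by omega)]
      rw [hm₃]
      simp
  · rintro m₂ ⟨hI₂, hrow⟩ hF₂
    have hi₂ : m₂.int 14 0 = i := by rw [hF₂.1 14 rfl]; simpa
    have hx₂ : ∀ i < X.n, m₂.real 3 i = x i := by rw [hF₂.2 3 rfl, hF₁.2 3 rfl]; simpa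
    refine Ex.forTo (v := 15) (X.n - 1) (fun t m' => (∀ i' < i, RowClosed X.n x (B i')
          (fun j => m'.real 5 (i' * X.n + j)) X.n X.n) ∧
        RowClosed X.n x (B i) (fun j => m'.real 5 (i * X.n + j)) X.n t) (by omega) (by omega)
      (fun m => ⟨by simp; omega, by simp⟩) rfl ⟨by simpa using hI₂, by simpa using hrow⟩ ?_ ?_
    · rintro t m₃ ht ⟨hI₃, hrow₃⟩ hv₃ hF₃
      have hi₃ : m₃.int 14 0 = i := by rw [hF₃.1 14 rfl, hi₂]
      have hx₃ : ∀ i < X.n, m₃.real 3 i = x i := by rw [hF₃.2 3 rfl]; exact hx₂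
      obtain ⟨p, hp⟩ : ∃ p, p + t + 2 = X.n := ⟨X.n - (t + 2), by omega⟩
      have hp' : X.n - (t + 2) = p := by omega
      have hip := index_lt hi (show p + 1 < X.n by omega)
      refine Ex.seq (Ex.setInt (by simpa) (by simp [hv₃]; omega) ?_)
      simp only [IExp.eval, hv₃, hp']
      refine Ex.minInto (by simp [hi₃]; omega) (by simp [hi₃]; omega) ?_
      have hm' : ∀ z, (((m₃.setInt 16 0 p).setReal 5 (i * X.n + p) z).setInt 15 0 (t + 1)).real 5 =
          Function.update (m₃.real 5) (i * X.n + p) z := by simp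
      simp only [IExp.eval, RExp.eval, Mem.setInt_int, Function.update_self, Mem.setInt_real,
        ne_eq, Fin.reduceEq, not_false_eq_true, Mem.setInt_int_ne, hi₃,
        hx₃ p (by omega), hx₃ (p + 1) (by omega), Mem.setReal_real]
      refine ⟨fun i' hi' => (hI₃ i' hi').congr rfl fun j hj => ?_, hrow₃.back hp mono
        (fun j hj hjp => ?_) ?_⟩
      · rw [update_index (by omega) hj, if_neg (by omega)]
      · rw [update_index (by omega) hj, if_neg (by omega)]
      · simp
    · rintro m₃ ⟨hI₃, hrow₃⟩ hF₃
      intro i' hi'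
      simp only [Mem.setInt_real]
      rcases Nat.lt_succ_iff_lt_or_eq.1 hi' with hi' | rfl
      · exact hI₃ i' hi'
      · intro j hj
        obtain ⟨h1, h2, h3, h4⟩ := hrow₃ j hj
        exact ⟨h1, h2, h3, fun _ hj1 => h4 (by omega) hj1⟩

/-! ### Prefix and suffix maxima. -/

variable {G : Grid}

theorem prefixMaxima_spec (hn : G.n = X.n) (hW : X.n * X.n + X.n + 8 ≤ W) {m : Mem 24}
    (hT : Tables G m) : Ex X W prefixMaxima m (Maxima G) := by
  have h0 : 0 < W := by omega
  refine Ex.seq (Ex.setReal (by simpa) (by simp) (Ex.seq ?_))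
  have hT₁ : Tables G (m.setReal 6 0 0) := hT.congr (by simp) (by simp) (by simp) (by simp)
  simp only [IExp.eval, RExp.eval]
  refine Ex.forTo (v := 14) X.n (fun k m' => ∀ t ≤ k,
      m'.real 6 t = runMax (fun l => G.h l + G.x l) t) le_rfl (by omega)
    (fun m => ⟨by simp; omega, by simp⟩) rfl (by simp [runMax]) ?_ ?_
  · intro k m₂ hk hI hv hF
    have hT₂ := hT₁.frame hF
    refine Ex.seq (Ex.setReal (by simp [hv]; omega) (by simp [hv]; omega) ?_)
    refine Ex.maxInto (by simp [hv]; omega) (by simp [hv]; omega) ?_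
    intro t ht
    simp only [IExp.eval, RExp.eval, Mem.setReal_int, hv, Mem.setInt_real, Mem.setReal_real,
      Function.update_self, ne_eq, Fin.reduceEq, not_false_eq_true, Mem.setReal_real_ne,
      Function.update_idem]
    rcases ht.lt_or_eq with ht | rfl
    · rw [Function.update_of_ne (by omega), hI t (by omega)]
    · rw [Function.update_self, runMax, hI k le_rfl, hT₂.h k (by omega), hT₂.x k (by omega)]
  · intro m₂ hpre hF₂
    have hT₂ := hT₁.frame hF₂
    refine Ex.forTo (v := 14) X.n (fun t m' => ∀ p, X.n ≤ p + t → p < X.n →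
        (∀ l, p ≤ l → l < X.n → G.h l - G.x l ≤ m'.real 7 p) ∧
        ∃ l, p ≤ l ∧ l < X.n ∧ m'.real 7 p = G.h l - G.x l) le_rfl (by omega)
      (fun m => ⟨by simp; omega, by simp⟩) rfl (fun p h1 h2 => by omega) ?_ ?_
    · intro t m₃ ht hI hv hF
      have hT₃ := hT₂.frame hF
      obtain ⟨p, hp⟩ : ∃ p, p + t + 1 = X.n := ⟨X.n - (t + 1), by omega⟩
      have hp' : X.n - (t + 1) = p := by omega
      refine Ex.seq (Ex.setInt (by simpa) (by simp [hv]; omega) ?_)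
      simp only [IExp.eval, hv, hp']
      refine Ex.seq (Ex.setReal (by simp; omega) (by simp; omega) ?_)
      have finish : ∀ (m' : Mem 24) z, m'.real 7 = Function.update (m₃.real 7) p z →
          z = (if t = 0 then G.h p - G.x p else max (G.h p - G.x p) (m₃.real 7 (p + 1))) →
          ∀ p, X.n ≤ p + (t + 1) → p < X.n →
            (∀ l, p ≤ l → l < X.n → G.h l - G.x l ≤ m'.real 7 p) ∧
            ∃ l, p ≤ l ∧ l < X.n ∧ m'.real 7 p = G.h l - G.x l := by
        intro m' z hm' hz p₁ h1 h2
        rw [hm']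
        by_cases hpp : p₁ = p
        · subst hpp
          rw [Function.update_self, hz]
          split_ifs with ht0
          · refine ⟨fun l hl hln => ?_, p₁, le_rfl, h2, rfl⟩
            obtain rfl : l = p₁ := by omega
            exact le_rfl
          · obtain ⟨g1, l, hl, hln, g2⟩ := hI (p₁ + 1) (by omega) (by omega)
            refine ⟨fun l hl hln => ?_, ?_⟩
            · rcases hl.lt_or_eq with hl | rfl
              · exact le_max_of_le_right (g1 l hl hln)
              · exact le_max_left _ _
            · rcases max_choice (G.h p₁ - G.x p₁) (m₃.real 7 (p₁ + 1)) with hm | hm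
              · exact ⟨p₁, le_rfl, h2, hm⟩
              · exact ⟨l, by omega, hln, by rw [hm, g2]⟩
        · rw [Function.update_of_ne hpp]
          exact hI p₁ (by omega) h2
      refine Ex.ite (by simp [hv]; omega) (fun hb => Ex.skip ?_) (fun hb => ?_)
      · simp only [Test.Holds, IExp.eval] at hb
        refine finish _ (G.h p - G.x p) ?_ ?_
        · simp [hT₃.h p (by omega), hT₃.x p (by omega)]
        · simp [hv] at hb
          rw [if_pos hb]
      · simp only [Test.Holds, IExp.eval] at hb
        refine Ex.maxInto (by simp; omega) (by simp; omega) ?_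
        refine finish _ (max (G.h p - G.x p) (m₃.real 7 (p + 1))) ?_ ?_
        · simp [hT₃.h p (by omega), hT₃.x p (by omega)]
        · simp [hv] at hb
          rw [if_neg hb]
    · intro m₃ hI hF₃
      refine ⟨?_, ?_, ?_⟩
      · rw [hF₃.2 6 rfl, hn]; exact hpre
      · intro t l htl hl
        exact (hI t (by omega) (by omega)).1 l htl (by omega)
      · intro t ht
        rw [hn]
        exact (hI t (by omega) (by omega)).2

end Doap

namespace Doap

open BProgram

variable {X : Input} {W : ℕ}

/-! ### The choice of the shortcut -/

theorem connections_spec (hW : X.n * X.n + X.n + 8 ≤ W) {m : Mem 24} {x h : ℕ → ℝ}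
    (hx : ∀ i < X.n, m.real 3 i = x i) (hh : ∀ i < X.n, m.real 4 i = h i)
    (mono : ∀ i j, i ≤ j → j < X.n → x i ≤ x j) {I J : ℕ} (hI : m.int 5 0 = I)
    (hJ : m.int 6 0 = J) (hIn : I < X.n) (hJn : J < X.n) :
    Ex X W connections m (fun m' => (∀ k < X.n, m'.real 17 k = h k + |x k - x I|) ∧
      ∀ k < X.n, m'.real 18 k = h k + |x k - x J|) := by
  have h0 : 0 < W := by omega
  refine Ex.forTo (v := 14) X.n (fun i m' => (∀ k < i, m'.real 17 k = h k + |x k - x I|) ∧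
      ∀ k < i, m'.real 18 k = h k + |x k - x J|) le_rfl (by omega)
    (fun m => ⟨by simp; omega, by simp⟩) rfl (by simp) ?_ fun m' h _ => h
  rintro k m₁ hk ⟨h1, h2⟩ hv hF
  have hI₁ : m₁.int 5 0 = I := by rw [hF.1 5 rfl, hI]
  have hJ₁ : m₁.int 6 0 = J := by rw [hF.1 6 rfl, hJ]
  have hx₁ : ∀ i < X.n, m₁.real 3 i = x i := by rw [hF.2 3 rfl]; exact hx
  have hh₁ : ∀ i < X.n, m₁.real 4 i = h i := by rw [hF.2 4 rfl]; exact hh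
  refine Ex.seq (Ex.mono (Q := fun m' => m' = m₁.setReal 17 k (h k + |x k - x I|)) ?_ ?_)
  · refine Ex.ite (by simp [hI₁, hv]; omega) (fun hb => ?_) (fun hb => ?_)
    · simp only [Test.Holds, IExp.eval, hI₁, hv] at hb
      refine Ex.setReal (by simp [hv]; omega) (by simp [hI₁, hv]; omega) ?_
      simp only [IExp.eval, RExp.eval, hI₁, hv, hx₁ k hk, hh₁ k hk, hx₁ I hIn]
      rw [abs_of_nonneg (sub_nonneg.2 (mono I k hb.le hk))]
    · simp only [Test.Holds, IExp.eval, hI₁, hv, not_lt] at hb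
      refine Ex.setReal (by simp [hv]; omega) (by simp [hI₁, hv]; omega) ?_
      simp only [IExp.eval, RExp.eval, hI₁, hv, hx₁ k hk, hh₁ k hk, hx₁ I hIn]
      rw [abs_of_nonpos (sub_nonpos.2 (mono k I hb hIn)), neg_sub]
  rintro m₂ - rfl
  refine Ex.mono (Q := fun m' => m' = (m₁.setReal 17 k (h k + |x k - x I|)).setReal 18 k
    (h k + |x k - x J|)) ?_ ?_
  · refine Ex.ite (by simp [hJ₁, hv]; omega) (fun hb => ?_) (fun hb => ?_)
    · simp only [Test.Holds, IExp.eval, Mem.setReal_int, hJ₁, hv] at hb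
      refine Ex.setReal (by simp [hv]; omega) (by simp [hJ₁, hv]; omega) ?_
      simp [hJ₁, hv, hx₁ k hk, hh₁ k hk, hx₁ J hJn]
      rw [abs_of_nonneg (sub_nonneg.2 (mono J k hb.le hk))]
    · simp only [Test.Holds, IExp.eval, Mem.setReal_int, hJ₁, hv, not_lt] at hb
      refine Ex.setReal (by simp [hv]; omega) (by simp [hJ₁, hv]; omega) ?_
      simp [hJ₁, hv, hx₁ k hk, hh₁ k hk, hx₁ J hJn]
      rw [abs_of_nonpos (sub_nonpos.2 (mono k J hb hJn)), neg_sub]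
  rintro m₂ - rfl
  constructor <;> simp <;> [exact forall_lt_update h1 rfl; exact forall_lt_update h2 rfl]

theorem shortcutValue_spec (hW : X.n * X.n + X.n + 8 ≤ W) {m : Mem 24} {A B : ℕ → ℝ} {o : ℕ → ℕ}
    (hA : ∀ i < X.n, m.real 17 i = A i) (hB : ∀ i < X.n, m.real 18 i = B i)
    (ho : ∀ i < X.n, m.int 1 i = o i) (hon : ∀ i < X.n, o i < X.n) {a b : Fin 24} {i j : ℕ}
    (hi : i < X.n) (hj : j < X.n) (ha : m.int a 0 = i) (hb : m.int b 0 = j) :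
    Ex X W (shortcutValue (iv a) (iv b)) m (fun m' => m'.real 14 0 =
      X.query (o i) (o j) + X.query (o i) (o j) + min (A i + B j) (A j + B i)) := by
  have h0 : 0 < W := by omega
  have h1 := hon i hi
  have h2 := hon j hj
  refine Ex.seq (Ex.setReal (by simpa) (by simp [ha, hb]; omega) ?_)
  refine Ex.seq (Ex.minInto (by simpa) (by simp [ha, hb]; omega) ?_)
  refine Ex.setReal (by simpa) (by simp [ha, hb, ho i hi, ho j hj]; omega) ?_
  simp [ha, hb, ho i hi, ho j hj, hA i hi, hA j hj, hB i hi, hB j hj]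

/-- A fresh search through all pairs is quadratic, so the table need not remember which shortcut
produced an entry. The first candidate `(0, 1)` is a valid pair because `n ≥ 2`. -/
theorem chooseShortcut_spec (hn : 2 ≤ X.n) (hW : X.n * X.n + X.n + 8 ≤ W) {m : Mem 24}
    {x h : ℕ → ℝ} (hx : ∀ i < X.n, m.real 3 i = x i) (hh : ∀ i < X.n, m.real 4 i = h i)
    (mono : ∀ i j, i ≤ j → j < X.n → x i ≤ x j) {I J : ℕ} (hI : m.int 5 0 = I)
    (hJ : m.int 6 0 = J) (hIn : I < X.n) (hJn : J < X.n) {o : ℕ → ℕ}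
    (ho : ∀ i < X.n, m.int 1 i = o i) (hon : ∀ i < X.n, o i < X.n) {κ : ℕ → ℕ → ℝ}
    (hκ : ∀ i j, κ i j = X.query (o i) (o j) + X.query (o i) (o j) +
      min (h i + |x i - x I| + (h j + |x j - x J|)) (h j + |x j - x I| + (h i + |x i - x J|))) :
    Ex X W chooseShortcut m (fun m' => ∃ i j, i < X.n ∧ j < X.n ∧ i ≠ j ∧ m'.int 0 0 = o i ∧
      m'.int 0 1 = o j ∧ ∀ k l, k < X.n → l < X.n → k ≠ l → κ i j ≤ κ k l) := by
  have h0 : 0 < W := by omega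
  refine Ex.seq ((connections_spec hW hx hh mono hI hJ hIn hJn).mono fun m₁ hF₁ ⟨hA₁, hB₁⟩ => ?_)
  have ho₁ : ∀ i < X.n, m₁.int 1 i = o i := by rw [hF₁.1 1 rfl]; exact ho
  refine Ex.seq (Ex.setInt (by simpa) (by simpa) ?_)
  refine Ex.seq (Ex.setInt (by simpa) (by simp; omega) ?_)
  refine Ex.seq ((shortcutValue_spec hW (i := 0) (j := 1) (by simpa using hA₁) (by simpa using hB₁)
    (by simpa using ho₁) hon (by omega) (by omega) (by simp) (by simp)).mono fun m₂ hF₂ hval => ?_)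
  rw [← hκ] at hval
  have h7 : m₂.int 7 0 = 0 := by rw [hF₂.1 7 rfl]; simp
  have h8 : m₂.int 8 0 = 1 := by rw [hF₂.1 8 rfl]; simp
  have hA₂ : ∀ i < X.n, m₂.real 17 i = h i + |x i - x I| := by rw [hF₂.2 17 rfl]; simpa using hA₁
  have hB₂ : ∀ i < X.n, m₂.real 18 i = h i + |x i - x J| := by rw [hF₂.2 18 rfl]; simpa using hB₁
  have ho₂ : ∀ i < X.n, m₂.int 1 i = o i := by rw [hF₂.1 1 rfl]; simpa using ho₁
  refine Ex.seq (Ex.setReal (by simpa) (by simpa) ?_)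
  refine Ex.seq ?_
  refine Ex.forTo (v := 14) X.n (fun k m' => m'.int 7 0 < X.n ∧ m'.int 8 0 < X.n ∧
      m'.int 7 0 ≠ m'.int 8 0 ∧ κ (m'.int 7 0) (m'.int 8 0) ≤ m'.real 19 0 ∧
      ∀ k' l, k' < k → l < X.n → k' ≠ l → m'.real 19 0 ≤ κ k' l) le_rfl (by omega)
    (fun m => ⟨by simp; omega, by simp⟩) rfl ?_ ?_ ?_
  · refine ⟨?_, ?_, ?_, ?_, ?_⟩ <;> simp [h7, h8, hval] <;> omega
  · rintro k m₃ hk ⟨g1, g2, g3, g4, g5⟩ hv₃ hF₃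
    refine Ex.forTo (v := 15) X.n (fun l m' => m'.int 7 0 < X.n ∧ m'.int 8 0 < X.n ∧
        m'.int 7 0 ≠ m'.int 8 0 ∧ κ (m'.int 7 0) (m'.int 8 0) ≤ m'.real 19 0 ∧
        (∀ k' l, k' < k → l < X.n → k' ≠ l → m'.real 19 0 ≤ κ k' l) ∧
        ∀ l' < l, k ≠ l' → m'.real 19 0 ≤ κ k l') le_rfl (by omega)
      (fun m => ⟨by simp; omega, by simp⟩) rfl ?_ ?_ ?_
    · refine ⟨by simpa, by simpa, by simpa, by simpa, ?_, by simp⟩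
      simpa using g5
    · rintro l m₄ hl ⟨g1, g2, g3, g4, g5, g6⟩ hv₄ hF₄
      have hk₄ : m₄.int 14 0 = k := by rw [hF₄.1 14 rfl, hv₃]
      have hA₄ : ∀ i < X.n, m₄.real 17 i = h i + |x i - x I| := by
        rw [hF₄.2 17 rfl, hF₃.2 17 rfl]; simpa
      have hB₄ : ∀ i < X.n, m₄.real 18 i = h i + |x i - x J| := by
        rw [hF₄.2 18 rfl, hF₃.2 18 rfl]; simpa
      have ho₄ : ∀ i < X.n, m₄.int 1 i = o i := by rw [hF₄.1 1 rfl, hF₃.1 1 rfl]; simpa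
      refine Ex.ite (by simp [hk₄, hv₄]; omega) (fun hb => Ex.skip ?_) (fun hb => ?_)
      · simp only [Test.Holds, IExp.eval, hk₄, hv₄] at hb
        subst hb
        refine ⟨by simpa, by simpa, by simpa, by simpa, by simpa using g5, fun l' hl' hne => ?_⟩
        exact g6 l' (by omega) hne
      · simp only [Test.Holds, IExp.eval, hk₄, hv₄] at hb
        refine Ex.seq ((shortcutValue_spec hW hA₄ hB₄ ho₄ hon hk hl hk₄ hv₄).mono
          fun m₅ hF₅ hval₅ => ?_)
        rw [← hκ] at hval₅
        have h7 : m₅.int 7 = m₄.int 7 := hF₅.1 7 rfl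
        have h8 : m₅.int 8 = m₄.int 8 := hF₅.1 8 rfl
        have h19 : m₅.real 19 = m₄.real 19 := hF₅.2 19 rfl
        have hk₅ : m₅.int 14 0 = k := by rw [hF₅.1 14 rfl, hk₄]
        have hv₅ : m₅.int 15 0 = l := by rw [hF₅.1 15 rfl, hv₄]
        refine Ex.ite (by simpa) (fun hb' => ?_) (fun hb' => Ex.skip ?_)
        · simp only [Test.Holds, RExp.eval, IExp.eval, hval₅, h19] at hb'
          refine Ex.seq (Ex.setReal (by simpa) (by simpa) ?_)
          refine Ex.seq (Ex.setInt (by simpa) (by simp [hk₅]; omega) ?_)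
          refine Ex.setInt (by simpa) (by simp [hv₅]; omega) ?_
          simp only [IExp.eval, RExp.eval, Mem.setReal_int, ne_eq, Fin.reduceEq, not_false_eq_true,
            Mem.setInt_int_ne, Mem.setInt_int, Function.update_self, Mem.setInt_real,
            Mem.setReal_real, hk₅, hv₅, hval₅]
          refine ⟨hk, hl, hb, le_rfl, fun k' l' h1 h2 h3 => hb'.trans (g5 k' l' h1 h2 h3),
            fun l' hl' hne => ?_⟩
          rcases Nat.lt_succ_iff_lt_or_eq.1 hl' with hl' | rfl
          · exact hb'.trans (g6 l' hl' hne)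
          · exact le_rfl
        · simp only [Test.Holds, RExp.eval, IExp.eval, hval₅, h19, not_le] at hb'
          simp only [ne_eq, Fin.reduceEq, not_false_eq_true, Mem.setInt_int_ne, Mem.setInt_real,
            h7, h8, h19]
          refine ⟨g1, g2, g3, g4, g5, fun l' hl' hne => ?_⟩
          rcases Nat.lt_succ_iff_lt_or_eq.1 hl' with hl' | rfl
          · exact g6 l' hl' hne
          · exact hb'.le
    · rintro m₄ ⟨g1, g2, g3, g4, g5, g6⟩ _
      simp only [ne_eq, Fin.reduceEq, not_false_eq_true, Mem.setInt_int_ne, Mem.setInt_real]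
      refine ⟨g1, g2, g3, g4, fun k' l h1 h2 h3 => ?_⟩
      rcases Nat.lt_succ_iff_lt_or_eq.1 h1 with h1 | rfl
      · exact g5 k' l h1 h2 h3
      · exact g6 l h2 h3
  · rintro m₃ ⟨g1, g2, g3, g4, g5⟩ hF₃
    have ho₃ : ∀ i < X.n, m₃.int 1 i = o i := by rw [hF₃.1 1 rfl]; simpa
    have e1 := hon _ g1
    have e2 := hon _ g2
    refine Ex.seq (Ex.setInt (by simpa) (by simp [ho₃ _ g1]; omega) ?_)
    refine Ex.setInt (by simp; omega) (by simp [ho₃ _ g2]; omega) ?_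
    refine ⟨_, _, g1, g2, g3, ?_, ?_, fun k l hk hl hkl => g4.trans (g5 k l hk hl hkl)⟩ <;>
      simp [ho₃ _ g1, ho₃ _ g2]

end Doap

namespace Doap

open BProgram

variable {X : Input} {W : ℕ}

/-! ### The distances in the tree -/

theorem findEdge_spec (hn : 2 ≤ X.n) (hW : X.n * X.n + X.n + 8 ≤ W)
    (hfst : ∀ i < X.n - 1, X.fst i < X.n) (hsnd : ∀ i < X.n - 1, X.snd i < X.n) {m : Mem 24}
    (hvis : ∀ x < X.n, m.int 2 x ≤ 1)
    (hex : ∃ i < X.n - 1, m.int 2 (X.fst i) ≠ m.int 2 (X.snd i)) :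
    Ex X W findEdge m (fun m' => m'.int 11 0 < X.n - 1 ∧
      m.int 2 (X.fst (m'.int 11 0)) ≠ m.int 2 (X.snd (m'.int 11 0))) := by
  refine Ex.seq (Ex.setInt (by simp; omega) (by simp; omega) ?_)
  refine Ex.forTo (v := 10) (X.n - 1) (fun k m' => m'.int 11 0 < X.n - 1 ∧
    ((∃ i < k, m.int 2 (X.fst i) ≠ m.int 2 (X.snd i)) →
      m.int 2 (X.fst (m'.int 11 0)) ≠ m.int 2 (X.snd (m'.int 11 0)))) (by omega) (by omega)
    (fun m => ⟨by simp; omega, by simp⟩) rfl ⟨by simp; omega, by simp⟩ ?_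
    fun m' h _ => ⟨h.1, h.2 hex⟩
  rintro k m₁ hk ⟨hI, hJ⟩ hv hF
  have h2 : m₁.int 2 = m.int 2 := by rw [hF.1 2 rfl]; simp
  have a₁ := hfst k hk
  have a₂ := hsnd k hk
  have b₁ := hvis _ a₁
  have b₂ := hvis _ a₂
  refine Ex.ite (by simp [hv, h2]; omega) (fun hb => ?_) (fun hb => Ex.skip ?_)
  · simp only [Test.Holds, IExp.eval, hv, h2] at hb
    exact Ex.setInt (by simp; omega) (by simp [hv]; omega)
      ⟨by simpa [hv], fun _ => by simpa [hv] using hb⟩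
  · simp only [Test.Holds, IExp.eval, hv, h2, not_not] at hb
    refine ⟨by simpa, ?_⟩
    simp only [ne_eq, Fin.reduceEq, not_false_eq_true, Mem.setInt_int_ne]
    rintro ⟨i, hi, hne⟩
    rcases Nat.lt_succ_iff_lt_or_eq.1 hi with hi | rfl
    · exact hJ ⟨i, hi, hne⟩
    · exact absurd hb hne

theorem orient_spec (hW : X.n * X.n + X.n + 8 ≤ W)
    (hfst : ∀ i < X.n - 1, X.fst i < X.n) (hsnd : ∀ i < X.n - 1, X.snd i < X.n) {m : Mem 24}
    (hvis : ∀ x < X.n, m.int 2 x ≤ 1) {e : ℕ} (he : m.int 11 0 = e) (hen : e < X.n - 1)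
    (hne : m.int 2 (X.fst e) ≠ m.int 2 (X.snd e)) :
    Ex X W orient m (fun m' => m.int 2 (m'.int 12 0) = 1 ∧ m.int 2 (m'.int 13 0) = 0 ∧
      (m'.int 12 0 = X.fst e ∧ m'.int 13 0 = X.snd e ∨
        m'.int 12 0 = X.snd e ∧ m'.int 13 0 = X.fst e)) := by
  have a₁ := hfst e hen
  have a₂ := hsnd e hen
  have b₁ := hvis _ a₁
  have b₂ := hvis _ a₂
  refine Ex.ite (by simp [he]; omega) (fun hb => ?_) (fun hb => ?_) <;>
    simp only [Test.Holds, IExp.eval, he] at hb <;>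
    refine Ex.seq (Ex.setInt (by simp; omega) (by simp [he]; omega) ?_) <;>
    refine Ex.setInt (by simp; omega) (by simp [he]; omega) ?_ <;>
    simp [he] <;> omega

theorem enterVertex_spec (hW : X.n * X.n + X.n + 8 ≤ W) {m : Mem 24}
    (hvis : ∀ x < X.n, m.int 2 x ≤ 1) {e p v : ℕ} (he : m.int 11 0 = e) (hp : m.int 12 0 = p)
    (hv : m.int 13 0 = v) (hen : e < X.n - 1) (hpn : p < X.n) (hvn : v < X.n)
    (hp2 : m.int 2 p = 1) (hv2 : m.int 2 v = 0) :
    Ex X W enterVertex m (fun m' => ∀ x < X.n,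
      (m.int 2 x = 1 → m'.real 0 (x * X.n + v) = m.real 0 (x * X.n + p) + X.weight e ∧
        m'.real 0 (v * X.n + x) = m.real 0 (x * X.n + p) + X.weight e) ∧
      ∀ y < X.n, ¬ (m.int 2 x = 1 ∧ y = v) → ¬ (x = v ∧ m.int 2 y = 1) →
        m'.real 0 (x * X.n + y) = m.real 0 (x * X.n + y)) := by
  refine (Ex.forTo (v := 10) X.n (fun k m' => ∀ x < X.n, ∀ y < X.n,
      m'.real 0 (x * X.n + y) =
        if y = v ∧ x < k ∧ m.int 2 x = 1 then m.real 0 (x * X.n + p) + X.weight e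
        else if x = v ∧ y < k ∧ m.int 2 y = 1 then m.real 0 (y * X.n + p) + X.weight e
        else m.real 0 (x * X.n + y)) le_rfl (by omega)
    (fun m => ⟨by simp; omega, by simp⟩) rfl (by simp) ?_
    fun m' h _ => h : Ex X W enterVertex m _).mono fun m' _ h x hx => ⟨fun hx2 => ⟨?_, ?_⟩,
      fun y hy h1 h2 => ?_⟩
  · intro k m₁ hk hI hv₁ hF
    have e2 : m₁.int 2 = m.int 2 := hF.1 2 rfl
    have e11 : m₁.int 11 0 = e := by rw [hF.1 11 rfl]; simpa
    have e12 : m₁.int 12 0 = p := by rw [hF.1 12 rfl]; simpa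
    have e13 : m₁.int 13 0 = v := by rw [hF.1 13 rfl]; simpa
    have b := hvis k hk
    have hkv := index_lt hk hvn
    have hvk := index_lt hvn hk
    have hkp := index_lt hk hpn
    refine Ex.ite (by simp [hv₁, e2]; omega) (fun hb => ?_) (fun hb => Ex.skip ?_)
    · simp only [Test.Holds, IExp.eval, hv₁, e2] at hb
      have hne : k ≠ v := by rintro rfl; omega
      -- The entry `(k, p)` to be read has not been overwritten: `p` and `k` are visited and `v` is
      -- not, so it lies neither in row nor in column `v`.
      have hkp' := hI k hk p hpn
      rw [if_neg (by rintro ⟨rfl, -⟩; omega), if_neg (fun h => hne h.1)] at hkp'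
      refine Ex.seq (Ex.setReal (by simp [hv₁, e13]; omega) (by simp [hv₁, e11, e12]; omega) ?_)
      refine Ex.setReal (by simp [hv₁, e13]; omega) (by simp [hv₁, e13]; omega) ?_
      intro x hx y hy
      simp only [Mem.setInt_real, IExp.eval, RExp.eval, Mem.setReal_int, hv₁, e11, e12, e13,
        Mem.setReal_real, update_index hvn hy, update_index hk hy, Function.update_self, hkp',
        hI x hx y hy]
      by_cases h1 : x = v ∧ y = k
      · obtain ⟨rfl, rfl⟩ := h1
        rw [if_pos ⟨rfl, rfl⟩, if_neg (by rintro ⟨h, -⟩; exact hne h),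
          if_pos ⟨rfl, Nat.lt_succ_self _, hb⟩]
      · rw [if_neg h1]
        by_cases h2 : x = k ∧ y = v
        · obtain ⟨rfl, rfl⟩ := h2
          rw [if_pos ⟨rfl, rfl⟩, if_pos ⟨rfl, Nat.lt_succ_self _, hb⟩]
        · rw [if_neg h2]
          refine if_congr ?_ rfl (if_congr ?_ rfl rfl)
          · refine and_congr_right fun hyv => and_congr_left fun _ => ?_
            have : x ≠ k := fun h => h2 ⟨h, hyv⟩
            omega
          · refine and_congr_right fun hxv => and_congr_left fun _ => ?_
            have : y ≠ k := fun h => h1 ⟨hxv, h⟩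
            omega
    · simp only [Test.Holds, IExp.eval, hv₁, e2] at hb
      intro x hx y hy
      rw [Mem.setInt_real, hI x hx y hy]
      refine if_congr ?_ rfl (if_congr ?_ rfl rfl)
      · refine and_congr_right fun _ => and_congr_left fun h => ?_
        have : x ≠ k := by rintro rfl; exact hb h
        omega
      · refine and_congr_right fun _ => and_congr_left fun h => ?_
        have : y ≠ k := by rintro rfl; exact hb h
        omega
  · rw [h x hx v hvn, if_pos ⟨rfl, hx, hx2⟩]
  · have hne : x ≠ v := by rintro rfl; omega
    rw [h v hvn x hx, if_neg (by rintro ⟨h, -⟩; exact hne h), if_pos ⟨rfl, hx, hx2⟩]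
  · rw [h x hx y hy, if_neg (fun h => h1 ⟨h.2.2, h.1⟩), if_neg (fun h => h2 ⟨h.1, h.2.2⟩)]

variable {n : ℕ} {I : Instance n} {L : I.EdgeList}

namespace Instance

theorem input_fst {i : ℕ} (hi : i < n - 1) : (I.input L).fst i = (L.ends ⟨i, hi⟩).1 := dif_pos hi

theorem input_snd {i : ℕ} (hi : i < n - 1) : (I.input L).snd i = (L.ends ⟨i, hi⟩).2 := dif_pos hi

theorem EdgeList.adj (L : I.EdgeList) (i : Fin (n - 1)) : I.tree.Adj (L.ends i).1 (L.ends i).2 :=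
  (SimpleGraph.mem_edgeSet _).1 (L.bijOn.mapsTo (Set.mem_univ i))

theorem input_weight {i : ℕ} (hi : i < n - 1) {p v : Fin n} (h : I.tree.Adj p v)
    (he : (L.ends ⟨i, hi⟩).1 = p ∧ (L.ends ⟨i, hi⟩).2 = v ∨
      (L.ends ⟨i, hi⟩).2 = p ∧ (L.ends ⟨i, hi⟩).1 = v) :
    (I.input L).weight i = I.δ ⟨s(p, v), h⟩ := by
  have hs : s((L.ends ⟨i, hi⟩).1, (L.ends ⟨i, hi⟩).2) = s(p, v) := by
    rcases he with ⟨rfl, rfl⟩ | ⟨rfl, rfl⟩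
    · rfl
    · exact Sym2.eq_swap
  have : (I.input L).weight i = _ := dif_pos hi
  rw [this]
  simp only [hs]

/-- A set of vertices that is neither empty nor everything has an edge that leaves it. -/
theorem EdgeList.exists_leaving (L : I.EdgeList) {S : Finset (Fin n)} (hS : S.Nonempty)
    (hS' : S.card < n) : ∃ i, ¬ ((L.ends i).1 ∈ S ↔ (L.ends i).2 ∈ S) := by
  by_contra! hall
  obtain ⟨x, hx⟩ := hS
  obtain ⟨y, hy⟩ : ∃ y, y ∉ S := by
    by_contra! h
    rw [Finset.eq_univ_iff_forall.2 h, Finset.card_univ, Fintype.card_fin] at hS'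
    exact hS'.false
  have hadj : ∀ u v, I.tree.Adj u v → u ∈ S → v ∈ S := by
    intro u v huv hu
    obtain ⟨i, -, hi⟩ := L.bijOn.surjOn ((SimpleGraph.mem_edgeSet _).2 huv)
    rcases Sym2.eq_iff.1 hi with ⟨rfl, rfl⟩ | ⟨rfl, rfl⟩
    · exact (hall i).1 hu
    · exact (hall i).2 hu
  obtain ⟨w⟩ := I.isTree.connected.preconnected x y
  refine hy ?_
  clear hy
  induction w with
  | nil => exact hx
  | cons h _ ih => exact ih (hadj _ _ h hx)

end Instance

-- After `r` rounds the marked set `S` has `r + 1` vertices and spans a subtree with correct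
-- distances; some edge leaves it as the tree is connected. The diagonal is known to vanish for all
-- vertices, not only for those in `S`, since no assignment provides the distance of a new vertex to
-- itself.
open Instance in
theorem distances_spec (hn : 2 ≤ n) (hW : n * n + n + 8 ≤ W) :
    Ex (I.input L) W distances Mem.zero
      (fun m => I.TreeDistOn Set.univ (fun x y => m.real 0 (x * n + y))) := by
  have hX : (I.input L).n = n := rfl
  have hfst : ∀ i < (I.input L).n - 1, (I.input L).fst i < (I.input L).n := fun i hi => by
    rw [input_fst (n := n) hi]; exact Fin.is_lt _
  have hsnd : ∀ i < (I.input L).n - 1, (I.input L).snd i < (I.input L).n := fun i hi => by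
    rw [input_snd (n := n) hi]; exact Fin.is_lt _
  refine Ex.seq (Ex.setInt (by simp; omega) (by simp; omega) ?_)
  refine Ex.forTo (v := 9) (n - 1) (fun r m => ∃ S : Finset (Fin n), S.card = r + 1 ∧
      (∀ x : Fin n, m.int 2 x = if x ∈ S then 1 else 0) ∧
      I.TreeDistOn S (fun x y => m.real 0 (x * n + y)) ∧ ∀ x : Fin n, m.real 0 (x * n + x) = 0)
    (by omega) (by omega) (fun m => ⟨by simp [hX]; omega, by simp [hX]⟩) rfl ?_ ?_ ?_
  · refine ⟨{⟨0, by omega⟩}, by simp, fun x => ?_, ?_, fun x => by simp [Mem.zero]⟩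
    · simp [Mem.zero, Function.update_apply, Fin.ext_iff]
    · rw [Finset.coe_singleton]
      exact treeDistOn_singleton _ (by simp [Mem.zero])
  · rintro r m₁ hr ⟨S, hcard, hvis, hd, hself⟩ - -
    have hvis' : ∀ x < (I.input L).n, m₁.int 2 x ≤ 1 := by
      intro x hx
      rw [hvis ⟨x, hx⟩]
      split_ifs <;> omega
    have hex : ∃ i < (I.input L).n - 1,
        m₁.int 2 ((I.input L).fst i) ≠ m₁.int 2 ((I.input L).snd i) := by
      obtain ⟨i, hi⟩ := L.exists_leaving (S := S) (Finset.card_pos.1 (by omega)) (by omega)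
      refine ⟨i, i.2, fun h => hi ?_⟩
      rw [input_fst i.2, input_snd i.2, hvis, hvis] at h
      by_cases h1 : (L.ends i).1 ∈ S <;> by_cases h2 : (L.ends i).2 ∈ S <;> simp_all
    refine Ex.seq ((findEdge_spec hn hW hfst hsnd hvis' hex).mono fun m₂ hF₂ ⟨he, hne⟩ => ?_)
    have e2 : m₂.int 2 = m₁.int 2 := hF₂.1 2 rfl
    rw [← e2] at hvis' hvis hne
    refine Ex.seq ((orient_spec hW hfst hsnd hvis' rfl he hne).mono
      fun m₃ hF₃ ⟨hp, hv, hpv⟩ => ?_)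
    have e2' : m₃.int 2 = m₂.int 2 := hF₃.1 2 rfl
    have e11 : m₃.int 11 0 = m₂.int 11 0 := by rw [hF₃.1 11 rfl]
    generalize m₂.int 11 0 = e at *
    rw [← e2'] at hvis hvis' hp hv
    have hpn : m₃.int 12 0 < n := by
      rcases hpv with h | h <;> rw [h.1]
      exacts [hfst e he, hsnd e he]
    have hvn : m₃.int 13 0 < n := by
      rcases hpv with h | h <;> rw [h.2]
      exacts [hsnd e he, hfst e he]
    obtain ⟨p, hp'⟩ : ∃ p : Fin n, m₃.int 12 0 = p := ⟨⟨_, hpn⟩, rfl⟩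
    obtain ⟨v, hv'⟩ : ∃ v : Fin n, m₃.int 13 0 = v := ⟨⟨_, hvn⟩, rfl⟩
    rw [hp', hv', input_fst (n := n) he, input_snd (n := n) he] at hpv
    rw [hp', hvis] at hp
    rw [hv', hvis] at hv
    have hpS : p ∈ S := by by_contra h; simp [h] at hp
    have hvS : v ∉ S := by intro h; simp [h] at hv
    have hends : (L.ends ⟨e, he⟩).1 = p ∧ (L.ends ⟨e, he⟩).2 = v ∨
        (L.ends ⟨e, he⟩).2 = p ∧ (L.ends ⟨e, he⟩).1 = v :=
      hpv.imp (fun h => ⟨Fin.ext h.1.symm, Fin.ext h.2.symm⟩)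
        (fun h => ⟨Fin.ext h.1.symm, Fin.ext h.2.symm⟩)
    have hadj : I.tree.Adj p v := by
      have := L.adj ⟨e, he⟩
      rcases hends with ⟨rfl, rfl⟩ | ⟨rfl, rfl⟩
      exacts [this, this.symm]
    refine Ex.seq ((enterVertex_spec hW hvis' e11 hp' hv' he p.2 v.2 (by rw [hvis, hp])
      (by rw [hvis, hv])).mono fun m₄ hF₄ hd₄ => ?_)
    have e13 : m₄.int 13 0 = v := by rw [hF₄.1 13 rfl, hv']
    have e2'' : m₄.int 2 = m₃.int 2 := hF₄.1 2 rfl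
    refine Ex.setInt (by simp [e13]; omega) (by simp; omega) ?_
    have hmem : ∀ x : Fin n, m₃.int 2 x = 1 ↔ x ∈ S := fun x => by rw [hvis]; simp
    have hr₃ : m₃.real 0 = m₁.real 0 := by rw [hF₃.2 0 rfl, hF₂.2 0 rfl]
    simp only [hX, hr₃] at hd₄
    have hself' : ∀ x : Fin n, m₄.real 0 (x * n + x) = 0 := fun x => by
      rw [(hd₄ x x.2).2 x x.2, hself]
      · rintro ⟨h1, h2⟩
        exact hvS (Fin.ext h2 ▸ (hmem x).1 h1)
      · rintro ⟨h2, h1⟩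
        exact hvS (Fin.ext h2 ▸ (hmem x).1 h1)
    refine ⟨insert v S, by rw [Finset.card_insert_of_notMem hvS, hcard], fun x => ?_, ?_, ?_⟩
    · simp only [IExp.eval, e13, Mem.setInt_int_ne _ _ _ (show (2 : Fin 24) ≠ 9 by decide),
        Mem.setInt_int, Function.update_apply, e2'', hvis, Finset.mem_insert, Fin.ext_iff]
      by_cases h : (x : ℕ) = v <;> simp [h]
    · rw [Finset.coe_insert]
      simp only [Mem.setInt_real]
      refine hd.insert hpS hvS hadj (fun x hx y hy => ?_) (hself' v) (fun x hx => ?_)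
        fun x hx => ?_
      · refine (hd₄ x x.2).2 y y.2 ?_ ?_
        · rintro ⟨-, h⟩
          exact hvS (Fin.ext h ▸ hy)
        · rintro ⟨h, -⟩
          exact hvS (Fin.ext h ▸ hx)
      · rw [((hd₄ x x.2).1 ((hmem x).2 hx)).1, input_weight (n := n) he hadj hends]
      · rw [((hd₄ x x.2).1 ((hmem x).2 hx)).1, ((hd₄ x x.2).1 ((hmem x).2 hx)).2]
    · simpa using hself'
  · rintro m ⟨S, hcard, -, hd, -⟩ -
    have : S = Finset.univ := by
      rw [← Finset.card_eq_iff_eq_univ, hcard, Fintype.card_fin]; omega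
    rwa [this, Finset.coe_univ] at hd

end Doap

namespace Doap

/-! ### The grid of an instance -/

/-- The grid of the points `o 0, …, o (n - 1)`, with the path from `a` to `b` as its line. -/
noncomputable def pathGrid {V : Type*} (d : V → V → ℝ) (a b : V) (o : ℕ → V) (n : ℕ)
    (T : ℕ → ℕ → ℝ) : Grid :=
  ⟨n, fun i => position d a b (o i), fun i => height d a b (o i), 2 * d a b, T⟩

section pathGrid

variable {V : Type*} {d : V → V → ℝ} {a b : V} {o : ℕ → V} {n : ℕ} {T : ℕ → ℕ → ℝ}
  {c : V → V → ℝ}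

theorem pathGrid_valid (hd : FourPoint d) (hab : ∀ x y, d x y ≤ d a b)
    (mono : ∀ i j, i ≤ j → j < n → position d a b (o i) ≤ position d a b (o j))
    {B : ℕ → ℕ → ℝ}
    (hT : ∀ i < n, RowClosed n (fun i => position d a b (o i)) (B i) (T i) n n) :
    (pathGrid d a b o n T).Valid where
  mono := mono
  h_nonneg _ _ := hd.height_nonneg _
  h_le _ _ := FourPoint.height_le hab _
  h_le' _ _ := FourPoint.height_le' hab _
  lip i j hi hj := (hT i hi j (Nat.lt_of_succ_lt hj)).2.2.1 hj
  lip' i j hi hj := (hT i hi j (Nat.lt_of_succ_lt hj)).2.2.2 (Nat.le_add_left _ _) hj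

theorem pathGrid_represents (ho : ∀ v, ∃ i < n, o i = v)
    (hT : ∀ i < n, RowClosed n (fun i => position d a b (o i))
      (baseWeight (2 * d a b) (fun i => height d a b (o i)) (fun i j => c (o i) (o j)) i)
      (T i) n n) :
    Represents (pathGrid d a b o n T) d a b c o where
  D_eq := rfl
  x_eq _ _ := rfl
  h_eq _ _ := rfl
  surj := ho
  T_le i j hi hj hij := by
    refine (hT i hi j hj).1.trans ?_
    rw [baseWeight, if_neg hij, two_mul]
    exact min_le_left _ _
  T_le' i j hi hj hij := by
    refine (hT i hi j hj).1.trans ?_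
    rw [baseWeight, if_neg hij, two_mul]
    exact min_le_right _ _
  le_T i j hi hj := by
    obtain ⟨k, hk, hle⟩ := (hT i hi j hj).2.1
    rw [baseWeight] at hle
    split_ifs at hle with hik
    -- The witness is the diagonal cell of the row, whose base weight is `D`.
    · exact Or.inl ((le_add_of_nonneg_right (abs_nonneg _)).trans hle)
    · refine Or.inr ⟨k, hk, Ne.symm hik, le_trans (le_of_eq ?_) hle⟩
      rw [two_mul, two_mul, ← min_add_add_right, ← min_add_add_right]
      rfl

end pathGrid

theorem exists_sorting_fin (f : ℕ → ℝ) {n : ℕ} (hn : 0 < n) : ∃ o : ℕ → Fin n,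
    (∀ i < n, rank f n (o i) = i) ∧ (∀ v : Fin n, o (rank f n v) = v) ∧
      ∀ i j, i ≤ j → j < n → f (o i) ≤ f (o j) := by
  obtain ⟨o, h1, h2, h3⟩ := exists_sorting f n
  have ho : ∀ i < n, ((if h : o i < n then ⟨o i, h⟩ else ⟨0, hn⟩ : Fin n) : ℕ) = o i := by
    intro i hi
    rw [dif_pos (h1 i hi).1]
  -- The default vertex `0` occurs only for indices out of range, where nothing is claimed.
  refine ⟨fun i => if h : o i < n then ⟨o i, h⟩ else ⟨0, hn⟩, fun i hi => ?_,
    fun v => Fin.ext ?_, fun i j hij hj => ?_⟩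
  · rw [ho i hi, (h1 i hi).2]
  · rw [ho _ (rank_lt v.2), h2 v v.2]
  · rw [ho i (by omega), ho j hj]
    exact h3 i j hij hj

/-! ### Correctness of the program -/

open BProgram

variable {X : Input} {W : ℕ}

/-- The rest `q` of the program appears as a continuation because sequences associate to the right.
-/
theorem search_spec {G : Grid} (hn : G.n = X.n) (hn0 : 0 < G.n) (hW : X.n * X.n + X.n + 8 ≤ W)
    (hG : G.Valid) (hD : 0 ≤ G.D) {m : Mem 24} (hT : Tables G m) {q : BProgram 24}
    {Q : Mem 24 → Prop}
    (hq : ∀ m' : Mem 24, m'.int 1 = m.int 1 → Tables G m' → Best G m' →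
      (∀ i j, i < G.n → j < G.n → m'.real 16 0 ≤ G.val i j) → Ex X W q m' Q) :
    Ex X W (.seq prefixMaxima (.seq border (.seq (walk id (.not (.rle (rv 10) (rv 13))))
      (.seq (walk (fun j => .sub nV (.add j (.lit 1))) (.not (.rle (rv 12) (rv 11)))) q)))) m Q := by
  refine Ex.seq ((prefixMaxima_spec hn hW hT).mono fun m₁ hF₁ hM => ?_)
  refine Ex.seq ((border_spec hn hn0 hW hG hD (hT.frame hF₁) hM).mono fun m₂ hF₂ ⟨hS₂, hB⟩ => ?_)
  refine Ex.seq ((walk_spec (colN := id) (P := fun i j => G.C i j < G.U i j) hn hW hG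
    (fun j hj => hj) (fun e m he _ => ⟨he, rfl⟩) (fun m i j hU _ _ hC => ?_)
    (fun i j hi _ h => (hG.C_row hi).trans_lt (h.trans_le (hG.U_row hi)))
    (fun i j hi hj h => (hG.C_col hi hj).trans_lt (h.trans_le (hG.U_col hi hj)))
    hS₂).mono fun m₃ hF₃ ⟨hS₃, hle₃, hC₃⟩ => ?_)
  · simp only [id] at hU hC
    simp [hU, hC]
    omega
  -- `R < L` persists when either coordinate grows; reading the columns backwards gives it the
  -- monotonicity that a walk requires.
  refine Ex.seq ((walk_spec (colN := fun j => G.n - (j + 1))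
    (P := fun i j => G.R i (G.n - (j + 1)) < G.L i (G.n - (j + 1))) hn hW hG
    (fun j hj => by omega) (fun e m he hlt => ?_) (fun m i j _ hR hL _ => ?_)
    (fun i j hi _ h => (hG.R_row hi).trans_lt (h.trans_le (hG.L_row hi)))
    (fun i j hi hj h => ?_) hS₃).mono fun m₄ hF₄ ⟨hS₄, hle₄, hC₄⟩ => ?_)
  · simp [he, hn]
    omega
  · simp [hR, hL]
    omega
  · have e : G.n - (j + 1) = G.n - (j + 1 + 1) + 1 := by omega
    rw [e]
    exact (hG.R_col hi (by omega)).trans_lt (h.trans_le (hG.L_col hi (by omega)))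
  refine hq m₄ ?_ hS₄.tables hS₄.best (hG.le_val (fun t ht => ?_) ⟨fun i j hi hj h h' => ?_,
    fun i j hi hj h h' => ?_⟩ hC₄)
  · rw [hF₄.1 1 rfl, hF₃.1 1 rfl, hF₂.1 1 rfl, hF₁.1 1 rfl]
  · obtain ⟨h1, h2, h3, h4⟩ := hB t ht
    -- The best value only drops during the walks, so the bounds obtained earlier remain valid.
    have := hle₄.trans hle₃
    exact ⟨this.trans h1, this.trans h2, this.trans h3, this.trans h4⟩
  · exact (hC₃.row i j hi hj h h').imp hle₄.trans hle₄.trans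
  · exact (hC₃.col i j hi hj h h').imp hle₄.trans hle₄.trans

variable {n : ℕ} {I : Instance n} {L : I.EdgeList}

theorem Instance.input_query (u v : Fin n) : (I.input L).query u v = I.c u v :=
  dif_pos ⟨u.2, v.2⟩

theorem doap_spec (hn : 2 ≤ n) (hW : n * n + n + 8 ≤ W) :
    Ex (I.input L) W doap Mem.zero (fun m => ∃ u v : Fin n, m.int 0 0 = u ∧ m.int 0 1 = v ∧
      I.IsOptimalShortcut u v) := by
  have hX : (I.input L).n = n := rfl
  refine Ex.seq ((distances_spec hn hW).mono fun m₁ _ hd => ?_)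
  refine Ex.seq ((diametral_spec (d := fun x y => m₁.real 0 (x * n + y)) hn hW
    fun _ _ _ _ => rfl).mono fun m₂ hF₂ ⟨ha, hb, hab⟩ => ?_)
  obtain ⟨a, ha'⟩ : ∃ a : Fin n, m₂.int 3 0 = a := ⟨⟨_, ha⟩, rfl⟩
  obtain ⟨b, hb'⟩ : ∃ b : Fin n, m₂.int 4 0 = b := ⟨⟨_, hb⟩, rfl⟩
  rw [ha', hb'] at hab
  refine Ex.seq ((coordinates_spec (d := fun x y => m₁.real 0 (x * n + y)) hW
    (fun _ _ _ _ => by rw [hF₂.2 0 rfl]; rfl) ha' hb' a.2 b.2).mono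
      fun m₃ _ ⟨hD₃, hx₃, hh₃⟩ => ?_)
  refine Ex.seq ((sortVertices_spec hW hx₃ hh₃).mono fun m₄ hF₄ h₄ => ?_)
  obtain ⟨o, ho, ho', mono⟩ := exists_sorting_fin
    (position (fun x y => m₁.real 0 (x * n + y)) (a : ℕ) b) (by omega : 0 < n)
  set d : Fin n → Fin n → ℝ := fun x y => m₁.real 0 (x * n + y) with hd_def
  have h₄' : ∀ i < n, m₄.int 1 i = o i ∧ m₄.real 3 i = position d a b (o i) ∧
      m₄.real 4 i = height d a b (o i) := by
    intro i hi
    have := h₄ (o i) (o i).2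
    rwa [hX, ho i hi] at this
  have hD₄ : m₄.real 8 0 = 2 * d a b := by rw [hF₄.2 8 rfl, hD₃]
  refine Ex.seq ((fillTable_spec hW (fun i hi => (h₄' i hi).2.1) (fun i hi => (h₄' i hi).2.2) hD₄
    (fun i hi => (h₄' i hi).1) (fun i _ => (o i).2) mono).mono fun m₅ hF₅ hT => ?_)
  simp only [Instance.input_query] at hT
  set G := pathGrid d a b o n (fun i j => m₅.real 5 (i * n + j)) with hG_def
  have hfour := hd.fourPoint
  have hab' : ∀ x y, d x y ≤ d a b := fun x y => hab x x.2 y y.2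
  have hG : G.Valid := pathGrid_valid hfour hab' mono hT
  have hR : Represents G d a b (fun u v => (I.c u v : ℝ)) o :=
    pathGrid_represents (fun v => ⟨_, rank_lt v.2, ho' v⟩) hT
  have hT₅ : Tables G m₅ := by
    refine ⟨?_, ?_, fun i _ j _ => rfl, ?_⟩
    · rw [hF₅.2 3 rfl]; exact fun i hi => (h₄' i hi).2.1
    · rw [hF₅.2 4 rfl]; exact fun i hi => (h₄' i hi).2.2
    · rw [hF₅.2 8 rfl]; exact hD₄
  refine search_spec (G := G) rfl (show 0 < n by omega) hW hG
    (mul_nonneg zero_le_two (hfour.nonneg a b)) hT₅ fun m₆ h1 hT₆ hB₆ hval => ?_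
  have h1' : ∀ i < n, m₆.int 1 i = o i := by
    rw [h1, hF₅.1 1 rfl]
    exact fun i hi => (h₄' i hi).1
  refine (chooseShortcut_spec (X := I.input L) hn hW hT₆.x hT₆.h mono rfl rfl hB₆.lt hB₆.lt' h1'
    (fun i _ => (o i).2) (κ := G.shortcut (fun u v => (I.c u v : ℝ)) o (m₆.int 5 0) (m₆.int 6 0))
    (fun i j => by rw [Grid.shortcut, Instance.input_query, two_mul])).mono
      fun m₇ _ ⟨i, j, hi, hj, hij, hu, hv, hopt⟩ => ⟨o i, o j, hu, hv, fun h => hij ?_,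
        fun u' v' huv => ?_⟩
  · rw [← ho i hi, ← ho j hj, h]
  -- Twice a distance after adding the chosen shortcut is at most the value of the best cell, hence
  -- at most the best number found, the value of a cell belonging to `(u', v')`, and finally `2 *
  -- r`.
  · obtain ⟨r, hr0, hr, hle⟩ := hd.augDist_le_diam (u := u') (v := v')
    obtain ⟨i', j', hi', hj', hv'⟩ := hR.exists_val_le hfour hab'
      (fun x y => NNReal.coe_nonneg _) huv hr0 hle
    rw [hr]
    refine hd.diam_le fun x y => ?_
    have h2 := hR.augDist_le hfour hG hB₆.lt hB₆.lt' hi hj hopt x y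
    have h3 := hB₆.val_le
    have h4 := hval i' j' hi' hj'
    linarith

end Doap

/-! ### The theorem. -/

theorem mainTheorem1 :
    ∃ (k : ℕ) (p : Doap.Program (k + 1)) (K : ℕ),
      ∀ (n : ℕ), 2 ≤ n → ∀ (I : Doap.Instance n) (L : I.EdgeList),
        Doap.Solves p I L (K * n ^ 2) (K * n ^ 2) := by
  refine ⟨23, Doap.BProgram.doap.erase, 100000, fun n hn I L => ?_⟩
  have hn2 : 2 * n ≤ n * n := Nat.mul_le_mul_right n hn
  -- For `n ≥ 2`, capacity `4 * n ^ 2` covers the required `n ^ 2 + n + 8`. The 24 arrays of each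
  -- kind then have `192 * n ^ 2` cells, well within the constant needed for the time.
  obtain ⟨t, m, ht, he, -, u, v, hu, hv, hopt⟩ :=
    Doap.doap_spec (I := I) (L := L) (W := 4 * (n * n)) hn (by omega)
  refine ⟨4 * (n * n), t, m, u, v, ?_, ht.trans (Doap.time_doap_le n hn), he, hu, hv, hopt⟩
  rw [Doap.space, pow_two]
  omega
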